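/- For an integer $m\ge 2$ and a complex number $\beta$ with $|\beta|\le 1$, let $S(m,\beta)$ be the set of polynomials of degree $m$ with complex coefficients, all of whose roots lie in the closed unit disk and which have at least one root at $\beta$. For such a polynomial $P$, let $|P|_\beta$ be the distance between $\beta$ and the closest root of the derivative $P'$. Let $n\ge 3$ be an integer, let $k$ be the largest integer with $k\le (n+1)/3$, and let \begin{align*} u_1&=\cos\frac{2\pi k}{n+1},\qquad u_2=\cos\frac{2\pi(k+1)}{n+1},\\ D_1&=\frac{-2u_1u_2-1}{2(1-u_1)(1-u_2)},\qquad D_2=\frac{-1}{2(1-u_1)(1-u_2)},\\ D_3&=(-1-4D_1-3D_1^2+2D_2^2)/2,\\ D_4&=(3D_1-4D_2+3D_1^2-2D_1D_2-6D_2^2)/2,\\ D_5&=(2+4D_1+5D_2+2D_1^2+4D_1D_2+3D_2^2)/2,\\ D_6&=(2D_2+2D_1D_2+3D_2^2)/2,\\ D&=D_3n+D_4+D_5/n+D_6/n^2. \end{align*} Let $\alpha=3/2$ if $n=3$ or $n=5$, and $\alpha=2$ otherwise; let $\Delta=7/225$ if $n=5$, and $\Delta=0$ otherwise. Then there are constants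 $C$ and $\varepsilon>0$, depending only on $n$, such that for every real $\beta$ with $1-\varepsilon<\beta\le 1$ and every $P\in S(n+1,\beta)$, $$|P|_\beta\le 1+\Bigl(D_1+\frac{D_2}{n}\Bigr)(1-\beta)+(D+\Delta)(1-\beta)^2+C(1-\beta)^{\alpha+1}.$$ -/

import Mathlib

open Polynomial

namespace Sendov

/-- `S(n, β)`: the complex polynomials of degree `n` with all roots in the closed unit disk
and with at least one root at `β`. -/
def S (n : ℕ) (β : ℂ) : Set ℂ[X] :=
  {P | P.degree = n ∧ (∀ z : ℂ, P.IsRoot z → ‖z‖ ≤ 1) ∧ P.IsRoot β}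

/-- `|P|_β`: the distance between `β` and the closest root of the derivative `P'`. -/
noncomputable def critDist (P : ℂ[X]) (β : ℂ) : ℝ :=
  Metric.infDist β {ζ : ℂ | P.derivative.IsRoot ζ}

/-- The largest integer `k` with `k ≤ (n + 1) / 3` (division of natural numbers rounds down). -/
def k (n : ℕ) : ℕ := (n + 1) / 3

noncomputable def u₁ (n : ℕ) : ℝ := Real.cos (2 * Real.pi * (k n : ℝ) / ((n : ℝ) + 1))

noncomputable def u₂ (n : ℕ) : ℝ := Real.cos (2 * Real.pi * ((k n : ℝ) + 1) / ((n : ℝ) + 1))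

noncomputable def D₁ (n : ℕ) : ℝ :=
  (-2 * u₁ n * u₂ n - 1) / (2 * (1 - u₁ n) * (1 - u₂ n))

noncomputable def D₂ (n : ℕ) : ℝ := -1 / (2 * (1 - u₁ n) * (1 - u₂ n))

noncomputable def D₃ (n : ℕ) : ℝ :=
  (-1 - 4 * D₁ n - 3 * D₁ n ^ 2 + 2 * D₂ n ^ 2) / 2

noncomputable def D₄ (n : ℕ) : ℝ :=
  (3 * D₁ n - 4 * D₂ n + 3 * D₁ n ^ 2 - 2 * D₁ n * D₂ n - 6 * D₂ n ^ 2) / 2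

noncomputable def D₅ (n : ℕ) : ℝ :=
  (2 + 4 * D₁ n + 5 * D₂ n + 2 * D₁ n ^ 2 + 4 * D₁ n * D₂ n + 3 * D₂ n ^ 2) / 2

noncomputable def D₆ (n : ℕ) : ℝ :=
  (2 * D₂ n + 2 * D₁ n * D₂ n + 3 * D₂ n ^ 2) / 2

noncomputable def D (n : ℕ) : ℝ :=
  D₃ n * (n : ℝ) + D₄ n + D₅ n / (n : ℝ) + D₆ n / (n : ℝ) ^ 2

noncomputable def α (n : ℕ) : ℝ := if n = 3 ∨ n = 5 then 3 / 2 else 2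

noncomputable def Δ (n : ℕ) : ℝ := if n = 5 then 7 / 225 else 0

end Sendov

/-! Write `β = 1 - s²` and let `r` be the distance from `β` to the nearest critical point. If no
constant worked, there would be a sequence of counterexamples with `s → 0`, each with `r` at least
the claimed main terms; the task is to bound `r` above along it up to `O(s⁶)`.

For `‖x‖ = 1` and all roots in the disk, `Re (conj P(x) · (x P'(x) - (n+1)/2 · P(x))) ≥ 0`, because
`Re (x / (x - a)) ≥ 1/2` when `‖a‖ ≤ 1`. This is used only at the `(n+1)`-th roots of unity, where
it becomes an inequality in the symmetric functions of the critical points (`boundary_inequality`).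
Near-extremality forces the critical points to have real part `O(s²)` and imaginary part `O(s)`
(`critical_point_bounds`), so only the first four symmetric functions matter modulo `O(s⁶)`.

To first order this is a linear program. With `R₁`, `R₂` the real parts of the first two
coefficients, `r - 1` is at most `-s² + R₁ + (1 - 1/n) R₂`, while `A + R₁ cos θ + R₂ cos 2θ` must be
nonnegative at the angles `2πj/(n+1)` and equal `s²` at `θ = 0`. The optimum vanishes at the two
angles `θ₁ ≤ 2π/3 ≤ θ₂`, and the positive multipliers `lam₁`, `lam₂` certify it. Since the gap and
all the slacks are nonnegative with sum `O(s⁴)` (`first_order_total`), each is `O(s⁴)`, which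
determines `R₁` and `R₂` to that order.

The same certificate, expanded to `O(s⁶)` (`second_order_total`), gives `r ≤ 1 + rate s² + D s⁴ -
curv · W + O(s⁶)`, where `W` (`quarticDefect`) is the leading part of `Re e₄`. When `n ≥ 4` and `n ≠
5`, `curv ≥ 0` and both angles lie strictly between `0` and `π`; the odd parts of the inequalities
at `θ₁` and `θ₂` make the sum of cubes of the imaginary parts `O(s⁴)`, and `power_sum_newton` yields
`-W ≤ O(s⁶)`. For `n = 3` and `n = 5`, `θ₂ = π` and its odd condition is empty. For `n = 3`, `e₄ =
0`. For `n = 5`, a sharp quartic inequality for five real numbers with sum zero costs exactly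
`7/225`. The error obtained is `O((1-β)³)` in every case. -/

namespace CritBound

open Finset

/-! ### Critical points as coordinates, and the boundary inequality at roots of unity. -/

theorem exists_fin_factorization (Q : ℂ[X]) {n : ℕ} (hn : Q.natDegree = n) :
    ∃ ζ : Fin n → ℂ, Q = C Q.leadingCoeff * ∏ i, (X - C (ζ i)) := by
  have hs := IsAlgClosed.splits Q
  have hcard : Q.roots.toList.length = n := by
    rw [Multiset.length_toList, ← hn]
    exact hs.natDegree_eq_card_roots.symm
  refine ⟨fun i => Q.roots.toList.get (i.cast hcard.symm), ?_⟩
  conv_lhs => rw [hs.eq_prod_roots]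
  congr 1
  conv_lhs => rw [← Multiset.coe_toList Q.roots]
  rw [Multiset.map_coe, Multiset.prod_coe]
  subst hcard
  rw [← List.prod_ofFn]
  congr 1
  apply List.ext_getElem <;> simp

theorem exists_crit_root_data {n : ℕ} {β : ℂ} {P : ℂ[X]} (hP : P ∈ Sendov.S (n + 1) β) :
    ∃ (a : ℂ) (z ζ : Fin n → ℂ), a ≠ 0 ∧ P = C a * ((X - C β) * ∏ i, (X - C (z i))) ∧
      derivative ((X - C β) * ∏ i, (X - C (z i))) = C ((n : ℂ) + 1) * ∏ i, (X - C (ζ i)) ∧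
      ∀ i, ‖z i‖ ≤ 1 := by
  obtain ⟨hdeg, hroot, hβ⟩ := hP
  have hP0 : P ≠ 0 := by
    rintro rfl
    rw [degree_zero] at hdeg
    exact absurd hdeg (by simp [-Nat.cast_add])
  have hnat : P.natDegree = n + 1 := natDegree_eq_of_degree_eq_some hdeg
  obtain ⟨Q, hQ⟩ := dvd_iff_isRoot.mpr hβ
  have hQ0 : Q ≠ 0 := by
    rintro rfl
    exact hP0 (by simpa using hQ)
  have hQn : Q.natDegree = n := by
    have := natDegree_mul (X_sub_C_ne_zero β) hQ0
    rw [← hQ, hnat, natDegree_X_sub_C] at this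
    omega
  obtain ⟨z, hz⟩ := exists_fin_factorization Q hQn
  set p := (X - C β) * ∏ i, (X - C (z i)) with hp
  have hpm : p.Monic := (monic_X_sub_C β).mul (monic_prod_of_monic _ _ fun i _ => monic_X_sub_C _)
  have hpn : p.natDegree = n + 1 := by
    rw [hp, (monic_X_sub_C β).natDegree_mul (monic_prod_of_monic _ _ fun i _ => monic_X_sub_C _),
      natDegree_X_sub_C, natDegree_prod_of_monic _ _ fun i _ => monic_X_sub_C _]
    simp [add_comm]
  have hPp : P = C Q.leadingCoeff * p := by
    rw [hQ, hp]
    conv_lhs => rw [hz]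
    ring
  have hdn : p.derivative.natDegree = n := by
    rw [natDegree_derivative, hpn]; rfl
  have hlead : p.derivative.leadingCoeff = (n : ℂ) + 1 := by
    rw [leadingCoeff, hdn, coeff_derivative]
    have : p.coeff (n + 1) = 1 := by rw [← hpn]; exact hpm
    rw [this]; ring
  obtain ⟨ζ, hζ⟩ := exists_fin_factorization p.derivative hdn
  refine ⟨Q.leadingCoeff, z, ζ, leadingCoeff_ne_zero.mpr hQ0, hPp, ?_, ?_⟩
  · rw [← hlead]; exact hζ
  · intro i
    apply hroot
    rw [IsRoot, hPp, hp, eval_mul, eval_mul, eval_prod,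
      Finset.prod_eq_zero (mem_univ i) (by simp)]
    simp

/-- Elementary symmetric sums of a finite family. -/
noncomputable def esym {n : ℕ} (ζ : Fin n → ℂ) (m : ℕ) : ℂ :=
  ∑ t ∈ (univ : Finset (Fin n)).powersetCard m, ∏ i ∈ t, ζ i

/-- The coefficient of `X ^ (n + 1 - m)` in the antiderivative of `∏ (X - ζ i)`. At `m = n + 1` the
denominator is zero, but so is the symmetric sum. -/
noncomputable def coef {n : ℕ} (ζ : Fin n → ℂ) (m : ℕ) : ℂ :=
  (-1) ^ m * esym ζ m / ((n : ℂ) + 1 - m)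

/-- On the `(n+1)`-th roots of unity the leading power equals `1`, so it merges with the constant
that makes the antiderivative vanish at `b`. -/
noncomputable def constCoef {n : ℕ} (ζ : Fin n → ℂ) (b : ℂ) : ℂ :=
  (1 - b ^ (n + 1)) / ((n : ℂ) + 1) - ∑ j ∈ range (n + 1), coef ζ (j + 1) * b ^ (n - j)

/-- For `w ^ (n + 1) = 1` this is the value at `w⁻¹` of the normalised antiderivative, and `hsum` is
`w d/dw` of it. The range includes the vanishing term of index `n + 1`, so that four terms can be
split off even when `n = 3`. -/
noncomputable def gsum {n : ℕ} (ζ : Fin n → ℂ) (b w : ℂ) : ℂ :=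
  constCoef ζ b + ∑ j ∈ range (n + 1), coef ζ (j + 1) * w ^ (j + 1)

noncomputable def hsum {n : ℕ} (ζ : Fin n → ℂ) (w : ℂ) : ℂ :=
  ∑ j ∈ range (n + 1), ((j : ℂ) + 1) * coef ζ (j + 1) * w ^ (j + 1)

theorem esym_eq_zero {n : ℕ} (ζ : Fin n → ℂ) {m : ℕ} (h : n < m) : esym ζ m = 0 := by
  rw [esym, powersetCard_eq_empty.mpr (by simpa using h), sum_empty]

theorem esym_zero {n : ℕ} (ζ : Fin n → ℂ) : esym ζ 0 = 1 := by simp [esym]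

theorem coef_eq_zero {n : ℕ} (ζ : Fin n → ℂ) {m : ℕ} (h : n < m) : coef ζ m = 0 := by
  rw [coef, esym_eq_zero ζ h]; simp

theorem eval_prod_X_sub_C {n : ℕ} (ζ : Fin n → ℂ) (z : ℂ) :
    (∏ i, (X - C (ζ i))).eval z = ∑ j ∈ range (n + 1), (-1) ^ j * esym ζ j * z ^ (n - j) := by
  have h := Multiset.prod_X_sub_X_eq_sum_esymm ((univ : Finset (Fin n)).val.map ζ)
  rw [Multiset.map_map] at h
  have h2 : (∏ i, (X - C (ζ i))) =
      (Multiset.map ((fun t => X - C t) ∘ ζ) (univ : Finset (Fin n)).val).prod := rfl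
  rw [h2, h, Multiset.card_map, card_val, card_univ, Fintype.card_fin, eval_finsetSum]
  refine sum_congr rfl fun j _ => ?_
  rw [Finset.esymm_map_val, esym]
  simp [eval_finsetSum, eval_prod, mul_assoc]

theorem natCast_add_one_sub_ne {n j : ℕ} (h : j < n + 1) : (n : ℂ) + 1 - j ≠ 0 := by
  have : (n : ℂ) + 1 - j = ((n + 1 - j : ℕ) : ℂ) := by
    rw [Nat.cast_sub h.le]; push_cast; ring
  rw [this, Nat.cast_ne_zero]; omega

/-- Values of the antiderivative normalised to vanish at `β`. -/
theorem eval_eq_of_derivative_eq {n : ℕ} {β : ℂ} {p : ℂ[X]} {ζ : Fin n → ℂ}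
    (hd : derivative p = C ((n : ℂ) + 1) * ∏ i, (X - C (ζ i))) (hβ : p.eval β = 0) (z : ℂ) :
    p.eval z = ((n : ℂ) + 1) * ∑ j ∈ range (n + 1), coef ζ j * (z ^ (n + 1 - j) - β ^ (n + 1 - j)) := by
  set q : ℂ[X] := C ((n : ℂ) + 1) * ∑ j ∈ range (n + 1), C (coef ζ j) * X ^ (n + 1 - j) with hq
  have hdq : derivative (p - q) = 0 := by
    rw [derivative_sub, hd, sub_eq_zero, hq, derivative_C_mul]
    congr 1
    apply Polynomial.funext
    intro x
    rw [eval_prod_X_sub_C, derivative_sum, eval_finsetSum]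
    refine sum_congr rfl fun j hj => ?_
    have hj' := mem_range.mp hj
    rw [derivative_C_mul, derivative_X_pow, eval_mul, eval_C, eval_mul, eval_C, eval_pow, eval_X, coef,
      Nat.cast_sub hj'.le, show n + 1 - j - 1 = n - j by omega]
    have := natCast_add_one_sub_ne hj'
    push_cast
    field_simp
  obtain ⟨c, hc⟩ := natDegree_eq_zero.mp (derivative_eq_zero.mp hdq)
  have key : ∀ x, p.eval x = c + q.eval x := fun x => by
    have := congrArg (eval x) hc
    rw [eval_C, eval_sub] at this
    linear_combination -this
  have hz := key z
  have hb := key β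
  rw [hβ] at hb
  have hqe : ∀ x, q.eval x = ((n : ℂ) + 1) * ∑ j ∈ range (n + 1), coef ζ j * x ^ (n + 1 - j) := by
    intro x
    simp [hq, eval_finsetSum]
  simp only [mul_sub, sum_sub_distrib]
  rw [hz, hqe]
  rw [hqe] at hb
  linear_combination -hb

theorem coef_zero {n : ℕ} (ζ : Fin n → ℂ) : coef ζ 0 = 1 / ((n : ℂ) + 1) := by
  simp [coef, esym_zero]

theorem eval_eq_gsum {n : ℕ} {β : ℂ} {p : ℂ[X]} {ζ : Fin n → ℂ}
    (hd : derivative p = C ((n : ℂ) + 1) * ∏ i, (X - C (ζ i))) (hβ : p.eval β = 0) {w : ℂ}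
    (hw : w ^ (n + 1) = 1) :
    p.eval w⁻¹ = ((n : ℂ) + 1) * gsum ζ β w := by
  have hw0 : w ≠ 0 := by rintro rfl; simp at hw
  have hpow : ∀ j, j ≤ n → w⁻¹ ^ (n - j) = w ^ (j + 1) := fun j hj => by
    rw [inv_pow, inv_eq_iff_eq_inv, ← mul_eq_one_iff_eq_inv₀ (pow_ne_zero _ hw0), ← pow_add,
      show n - j + (j + 1) = n + 1 by omega, hw]
  rw [eval_eq_of_derivative_eq hd hβ, gsum, constCoef, sum_range_succ', sum_range_succ,
    sum_range_succ, coef_eq_zero ζ (Nat.lt_succ_self n), coef_zero, inv_pow]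
  simp only [zero_mul, add_zero, Nat.sub_zero, hw, inv_one, mul_sub, sum_sub_distrib,
    Nat.add_sub_add_right]
  rw [sum_congr rfl fun j hj => by rw [hpow j (mem_range.mp hj).le]]
  ring

theorem eval_derivative_eq_gsum {n : ℕ} {β : ℂ} {p : ℂ[X]} {ζ : Fin n → ℂ}
    (hd : derivative p = C ((n : ℂ) + 1) * ∏ i, (X - C (ζ i))) {w : ℂ}
    (hw : w ^ (n + 1) = 1) :
    w⁻¹ * p.derivative.eval w⁻¹ =
      ((n : ℂ) + 1) * (1 + ((n : ℂ) + 1) * (gsum ζ β w - constCoef ζ β) - hsum ζ w) := by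
  have hw0 : w ≠ 0 := by rintro rfl; simp at hw
  have hpow : ∀ j, j < n → w⁻¹ * w⁻¹ ^ (n - (j + 1)) = w ^ (j + 1) := fun j hj => by
    rw [← pow_succ', inv_pow, inv_eq_iff_eq_inv, ← mul_eq_one_iff_eq_inv₀ (pow_ne_zero _ hw0), ← pow_add,
      show n - (j + 1) + 1 + (j + 1) = n + 1 by omega, hw]
  rw [hd, eval_mul, eval_C, eval_prod_X_sub_C, gsum, hsum, sum_range_succ', esym_zero,
    sum_range_succ, sum_range_succ, coef_eq_zero ζ (Nat.lt_succ_self n)]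
  have h0 : w⁻¹ * (w⁻¹ ^ (n - 0)) = 1 := by
    rw [Nat.sub_zero, ← pow_succ', inv_pow, hw, inv_one]
  have hsumeq : w⁻¹ * ∑ j ∈ range n, (-1) ^ (j + 1) * esym ζ (j + 1) * w⁻¹ ^ (n - (j + 1)) =
      ((n : ℂ) + 1) * ∑ j ∈ range n, coef ζ (j + 1) * w ^ (j + 1) -
        ∑ j ∈ range n, ((j : ℂ) + 1) * coef ζ (j + 1) * w ^ (j + 1) := by
    rw [mul_sum, mul_sum, ← sum_sub_distrib]
    refine sum_congr rfl fun j hj => ?_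
    have hj' := mem_range.mp hj
    rw [← hpow j hj', coef]
    have := natCast_add_one_sub_ne (n := n) (j := j + 1) (by omega)
    push_cast at this ⊢
    field_simp
  linear_combination ((n : ℂ) + 1) * h0 + ((n : ℂ) + 1) * hsumeq

theorem half_le_re_div {z a : ℂ} (hz : ‖z‖ = 1) (ha : ‖a‖ ≤ 1) (hne : z - a ≠ 0) :
    1 / 2 ≤ (z / (z - a)).re := by
  have hpos : 0 < Complex.normSq (z - a) := Complex.normSq_pos.mpr hne
  rw [Complex.div_re, ← add_div, div_le_div_iff₀ two_pos hpos]
  have h1 : Complex.normSq z = 1 := by rw [Complex.normSq_eq_norm_sq, hz]; norm_num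
  have h2 : Complex.normSq a ≤ 1 := by
    rw [Complex.normSq_eq_norm_sq]; nlinarith [norm_nonneg a]
  rw [Complex.normSq_apply] at *
  simp only [Complex.sub_re, Complex.sub_im]
  nlinarith

theorem eval_derivative_prod {n : ℕ} {z : Fin n → ℂ} {x : ℂ} (hz : ∀ i, x - z i ≠ 0) :
    (derivative (∏ i, (X - C (z i)))).eval x = (∏ i, (x - z i)) * ∑ i, 1 / (x - z i) := by
  rw [derivative_prod_finset, eval_finsetSum, mul_sum]
  refine sum_congr rfl fun i hi => ?_
  rw [← mul_prod_erase univ _ hi]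
  simp [eval_prod]
  field_simp [hz i]

theorem eval_derivative_div_eval {n : ℕ} {β : ℂ} {z : Fin n → ℂ} {x : ℂ} (hβ : x - β ≠ 0)
    (hz : ∀ i, x - z i ≠ 0) :
    (derivative ((X - C β) * ∏ i, (X - C (z i)))).eval x =
      ((X - C β) * ∏ i, (X - C (z i))).eval x * (1 / (x - β) + ∑ i, 1 / (x - z i)) := by
  rw [derivative_mul, eval_add, eval_mul, eval_mul, eval_derivative_prod hz]
  simp [eval_prod]
  field_simp

/-- `x p'(x) / p(x)` is a sum of `n + 1` terms `x / (x - root)`, each of real part at least `1/2`.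
Multiplying by `|p(x)|²` keeps the inequality meaningful at roots on the circle. -/
theorem nonneg_re_of_roots {n : ℕ} {β : ℂ} {z : Fin n → ℂ} {x : ℂ} (hx : ‖x‖ = 1) (hβ : ‖β‖ ≤ 1)
    (hz : ∀ i, ‖z i‖ ≤ 1) {p : ℂ[X]} (hp : p = (X - C β) * ∏ i, (X - C (z i))) :
    0 ≤ ((starRingEnd ℂ) (p.eval x) *
      (x * p.derivative.eval x - ((n : ℂ) + 1) / 2 * p.eval x)).re := by
  by_cases h0 : p.eval x = 0
  · simp [h0]
  have hne : x - β ≠ 0 ∧ ∀ i, x - z i ≠ 0 := by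
    rw [hp, eval_mul, eval_prod, mul_eq_zero, prod_eq_zero_iff] at h0
    simpa [not_or] using h0
  have hd : x * p.derivative.eval x = p.eval x * (x / (x - β) + ∑ i, x / (x - z i)) := by
    rw [hp, eval_derivative_div_eval hne.1 hne.2]
    have : ∑ i, x / (x - z i) = x * ∑ i, 1 / (x - z i) := by
      rw [mul_sum]; exact sum_congr rfl fun i _ => by ring
    rw [this]; ring
  have hre : ((n : ℝ) + 1) / 2 ≤ (x / (x - β) + ∑ i, x / (x - z i)).re := by
    rw [Complex.add_re, Complex.re_sum]
    have h1 := half_le_re_div hx hβ hne.1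
    have h2 : ∑ i : Fin n, (1 / 2 : ℝ) ≤ ∑ i, (x / (x - z i)).re :=
      sum_le_sum fun i _ => half_le_re_div hx (hz i) (hne.2 i)
    simp at h2
    linarith
  rw [hd]
  set S := x / (x - β) + ∑ i, x / (x - z i)
  have : (starRingEnd ℂ) (p.eval x) * (p.eval x * S - ((n : ℂ) + 1) / 2 * p.eval x) =
      (Complex.normSq (p.eval x) : ℂ) * (S - (((n : ℝ) + 1) / 2 : ℝ)) := by
    rw [Complex.normSq_eq_conj_mul_self]; push_cast; ring
  rw [this, Complex.re_ofReal_mul]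
  apply mul_nonneg (Complex.normSq_nonneg _)
  rw [Complex.sub_re, Complex.ofReal_re]
  linarith

theorem boundary_inequality {n : ℕ} {β : ℂ} (hβ : ‖β‖ ≤ 1) {z ζ : Fin n → ℂ}
    (hz : ∀ i, ‖z i‖ ≤ 1)
    (hd : derivative ((X - C β) * ∏ i, (X - C (z i))) = C ((n : ℂ) + 1) * ∏ i, (X - C (ζ i)))
    {w : ℂ} (hw : w ^ (n + 1) = 1) :
    0 ≤ ((starRingEnd ℂ) (gsum ζ β w) *
      (1 + ((n : ℂ) + 1) / 2 * gsum ζ β w - ((n : ℂ) + 1) * constCoef ζ β - hsum ζ w)).re := by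
  have hwn : ‖w‖ = 1 := Complex.norm_eq_one_of_pow_eq_one hw (Nat.succ_ne_zero n)
  have h := nonneg_re_of_roots (x := w⁻¹) (by rw [norm_inv, hwn, inv_one]) hβ hz rfl
  rw [eval_derivative_eq_gsum (β := β) hd hw, eval_eq_gsum (β := β) hd (by simp) hw] at h
  have e : (starRingEnd ℂ) (((n : ℂ) + 1) * gsum ζ β w) *
      (((n : ℂ) + 1) * (1 + ((n : ℂ) + 1) * (gsum ζ β w - constCoef ζ β) - hsum ζ w) -
        ((n : ℂ) + 1) / 2 * (((n : ℂ) + 1) * gsum ζ β w)) =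
      ((((n : ℝ) + 1) ^ 2 : ℝ) : ℂ) * ((starRingEnd ℂ) (gsum ζ β w) *
      (1 + ((n : ℂ) + 1) / 2 * gsum ζ β w - ((n : ℂ) + 1) * constCoef ζ β - hsum ζ w)) := by
    simp only [map_mul, map_add, map_natCast, map_one]
    push_cast
    ring
  rw [e, Complex.re_ofReal_mul] at h
  exact nonneg_of_mul_nonneg_right h (by positivity)

theorem critDist_le {n : ℕ} {β a : ℂ} {p : ℂ[X]} {ζ : Fin n → ℂ}
    (hd : derivative p = C ((n : ℂ) + 1) * ∏ i, (X - C (ζ i))) (i : Fin n) :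
    Sendov.critDist (C a * p) β ≤ ‖β - ζ i‖ := by
  rw [← dist_eq_norm]
  apply Metric.infDist_le_dist_of_mem
  simp only [Set.mem_ofPred_eq, IsRoot, derivative_C_mul, hd, eval_mul, eval_prod]
  rw [prod_eq_zero (mem_univ i) (by simp)]
  simp

/-! ### Localisation of the critical points near the imaginary axis. -/

theorem prod_sub_eq {n : ℕ} {β : ℂ} {z ζ : Fin n → ℂ}
    (hd : derivative ((X - C β) * ∏ i, (X - C (z i))) = C ((n : ℂ) + 1) * ∏ i, (X - C (ζ i))) :
    ∏ i, (β - z i) = ((n : ℂ) + 1) * ∏ i, (β - ζ i) := by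
  have := congrArg (eval β) hd
  simpa [derivative_mul, eval_prod] using this

/-- If `p = (X - β) q`, then `p'(β) = q(β)` and `p''(β) = 2 q'(β)`; the two sides are the
logarithmic derivatives of `p'` and (doubled) of `q` at `β`. -/
theorem sum_inv_sub_eq {n : ℕ} {β : ℂ} {z ζ : Fin n → ℂ}
    (hd : derivative ((X - C β) * ∏ i, (X - C (z i))) = C ((n : ℂ) + 1) * ∏ i, (X - C (ζ i)))
    (hζ : ∀ i, β - ζ i ≠ 0) (hz : ∀ i, β - z i ≠ 0) :
    ∑ i, 1 / (β - ζ i) = 2 * ∑ i, 1 / (β - z i) := by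
  have h2 := congrArg (fun q => eval β (derivative q)) hd
  simp only [derivative_mul, derivative_add, derivative_sub, derivative_X, derivative_C, eval_add,
    eval_mul, eval_sub, eval_X, eval_C, eval_derivative_prod hζ, eval_derivative_prod hz,
    sub_self, sub_zero, zero_mul, zero_add, add_zero, one_mul] at h2
  have h1 := prod_sub_eq hd
  have h0 : ((n : ℂ) + 1) * ∏ i, (β - ζ i) ≠ 0 := by
    rw [← h1]; exact prod_ne_zero_iff.mpr fun i _ => hz i
  apply mul_left_cancel₀ h0
  rw [h1] at h2
  linear_combination -h2

theorem norm_sub_lower_bound {n : ℕ} {u : Fin n → ℂ} (hu : ∀ i, ‖u i‖ ≤ 2)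
    (hprod : (1 / 2 : ℝ) ^ n ≤ ∏ i, ‖u i‖) (i : Fin n) : (1 / 4 : ℝ) ^ n ≤ ‖u i‖ := by
  rw [← mul_prod_erase univ _ (mem_univ i)] at hprod
  have h1 : ∏ j ∈ univ.erase i, ‖u j‖ ≤ 2 ^ n := by
    calc ∏ j ∈ univ.erase i, ‖u j‖ ≤ ∏ j ∈ univ.erase i, (2 : ℝ) :=
          prod_le_prod (fun _ _ => norm_nonneg _) fun j _ => hu j
      _ = 2 ^ (n - 1) := by simp
      _ ≤ 2 ^ n := pow_le_pow_right₀ (by norm_num) (by omega)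
  have h2 : (1 / 2 : ℝ) ^ n ≤ ‖u i‖ * 2 ^ n :=
    hprod.trans (mul_le_mul_of_nonneg_left h1 (norm_nonneg _))
  have h3 : (1 / 4 : ℝ) ^ n * 2 ^ n = (1 / 2) ^ n := by rw [← mul_pow]; norm_num
  have h4 : (0 : ℝ) < 2 ^ n := by positivity
  nlinarith

/-- A perturbation of `Re (1 / (1 - z)) ≥ 1/2`, valid as long as `z` stays away from `b`. -/
theorem re_inv_sub_lower_bound {b c₀ : ℝ} (hb : b ≤ 1) (hc₀ : 0 < c₀) (hδ : 1 - b ≤ c₀ / 2)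
    {z : ℂ} (hz : ‖z‖ ≤ 1) (h : c₀ ≤ ‖(b : ℂ) - z‖) :
    1 / 2 - 2 / c₀ ^ 2 * (1 - b) ≤ (1 / ((b : ℂ) - z)).re := by
  have hbd : ‖(1 : ℂ) - b‖ = 1 - b := by
    rw [show (1 : ℂ) - b = ((1 - b : ℝ) : ℂ) by push_cast; ring, Complex.norm_real,
      Real.norm_of_nonneg (by linarith)]
  have h1 : c₀ / 2 ≤ ‖(1 : ℂ) - z‖ := by
    have : ‖(b : ℂ) - z‖ ≤ ‖(1 : ℂ) - z‖ + ‖(1 : ℂ) - b‖ := by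
      rw [show (b : ℂ) - z = (1 - z) - (1 - b) by ring]; exact norm_sub_le _ _
    linarith
  have hbz : (b : ℂ) - z ≠ 0 := norm_pos_iff.mp (by linarith)
  have h1z : (1 : ℂ) - z ≠ 0 := norm_pos_iff.mp (by linarith)
  have h2 := half_le_re_div (z := 1) (by simp) hz h1z
  have h3 : ‖1 / ((1 : ℂ) - z) - 1 / ((b : ℂ) - z)‖ ≤ 2 / c₀ ^ 2 * (1 - b) := by
    have e : 1 / ((1 : ℂ) - z) - 1 / ((b : ℂ) - z) = -((1 - b) / ((1 - z) * (b - z))) := by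
      field_simp; ring
    rw [e, norm_neg, norm_div, norm_mul, hbd, div_le_iff₀ (by positivity)]
    have : c₀ / 2 * c₀ ≤ ‖(1 : ℂ) - z‖ * ‖(b : ℂ) - z‖ :=
      mul_le_mul h1 h hc₀.le (norm_nonneg _)
    calc 1 - b = 2 / c₀ ^ 2 * (1 - b) * (c₀ / 2 * c₀) := by field_simp
      _ ≤ _ := mul_le_mul_of_nonneg_left this (mul_nonneg (by positivity) (by linarith))
  have h4 := (Complex.abs_re_le_norm _).trans h3
  rw [Complex.sub_re] at h4
  linarith [(abs_le.mp h4).2]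

/-- If `1 / u` has real part at least `1 - a` and `|u| ≥ 1 - b`, then `u` is close to `1`. -/
theorem near_one_of_re_inv {p y a b : ℝ} (ha : 0 ≤ a) (hb : 0 ≤ b) (ha2 : a ≤ 1 / 2)
    (hb2 : b ≤ 1 / 2) (h1 : (1 - b) ^ 2 ≤ p ^ 2 + y ^ 2) (h2 : 1 - a ≤ p / (p ^ 2 + y ^ 2)) :
    |p - 1| ≤ 2 * (a + b) ∧ y ^ 2 ≤ 8 * (a + b) := by
  have hpos : 0 < p ^ 2 + y ^ 2 := by nlinarith
  rw [le_div_iff₀ hpos] at h2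
  have hp : 0 < p := by nlinarith
  have hp1 : (1 - a) * p ≤ 1 := by
    by_contra h
    push Not at h
    nlinarith [mul_nonneg (by linarith : (0 : ℝ) ≤ 1 - a) (sq_nonneg y)]
  have hp2 : p ≤ 1 + 2 * a := by nlinarith
  have hp3 : 1 - a - 2 * b ≤ p := by
    have e1 : (1 - a) * (1 - b) ^ 2 ≤ p :=
      (mul_le_mul_of_nonneg_left h1 (by linarith)).trans h2
    nlinarith [mul_nonneg ha hb, mul_nonneg (by linarith : (0 : ℝ) ≤ 1 - a) (sq_nonneg b)]
  refine ⟨abs_le.mpr ⟨by linarith, by linarith⟩, ?_⟩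
  have : (1 - a) * y ^ 2 ≤ p * (1 - (1 - a) * p) := by nlinarith
  nlinarith

-- The real parts of `1 / (b - ζ i)` are each at most `1 + O(1 - b)`, while by `sum_inv_sub_eq` they
-- add up to at least `n - O(1 - b)`. Hence each is `1 - O(1 - b)`, and `near_one_of_re_inv`
-- applies.
set_option maxHeartbeats 1000000 in
theorem critical_point_bounds (n : ℕ) {c : ℝ} (hc : 0 ≤ c) :
    ∃ K ε : ℝ, 0 < ε ∧ ∀ b : ℝ, 1 - ε < b → b ≤ 1 → ∀ z ζ : Fin n → ℂ, (∀ i, ‖z i‖ ≤ 1) →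
      (∀ i, 1 - c * (1 - b) ≤ ‖(b : ℂ) - ζ i‖) →
      derivative ((X - C (b : ℂ)) * ∏ i, (X - C (z i))) = C ((n : ℂ) + 1) * ∏ i, (X - C (ζ i)) →
      ∀ i, |(ζ i).re| ≤ K * (1 - b) ∧ (ζ i).im ^ 2 ≤ K * (1 - b) := by
  -- Lower bound for the distance from `b` to the other roots: their product is at least `(1/2)^n`
  -- and each is at most `2`.
  set c₀ : ℝ := (1 / 4) ^ n with hc₀
  have hc₀pos : 0 < c₀ := by positivity
  -- The first summand is twice the total loss over the roots, the second bounds the excess of the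
  -- other `n - 1` critical points.
  set K₁ : ℝ := 4 * n / c₀ ^ 2 + 2 * c * n with hK₁
  have hK₁nn : 0 ≤ K₁ := by positivity
  refine ⟨8 * (K₁ + c) + 1, min (min (1 / (2 * (c + 1))) (1 / (2 * (K₁ + 1)))) (min (c₀ / 2) 1),
    by positivity, ?_⟩
  intro b hb hb1 z ζ hz hζ hd i
  set δ := 1 - b with hδ
  have hδ0 : 0 ≤ δ := by linarith
  have hδε : δ < min (min (1 / (2 * (c + 1))) (1 / (2 * (K₁ + 1)))) (min (c₀ / 2) 1) := by linarith
  have hδ1 : δ < 1 / (2 * (c + 1)) := hδε.trans_le ((min_le_left _ _).trans (min_le_left _ _))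
  have hδ2 : δ < 1 / (2 * (K₁ + 1)) := hδε.trans_le ((min_le_left _ _).trans (min_le_right _ _))
  have hδ3 : δ < c₀ / 2 := hδε.trans_le ((min_le_right _ _).trans (min_le_left _ _))
  have hδ4 : δ < 1 := hδε.trans_le ((min_le_right _ _).trans (min_le_right _ _))
  rw [lt_div_iff₀ (by positivity)] at hδ1 hδ2
  have hcδ : c * δ ≤ 1 / 2 := by nlinarith
  have hKδ : K₁ * δ ≤ 1 / 2 := by nlinarith
  have hζn : ∀ j, (1 / 2 : ℝ) ≤ ‖(b : ℂ) - ζ j‖ := fun j => by linarith [hζ j]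
  have hζ0 : ∀ j, (b : ℂ) - ζ j ≠ 0 := fun j => norm_pos_iff.mp (by linarith [hζn j])
  have hb2 : ‖(b : ℂ)‖ ≤ 1 := by
    rw [Complex.norm_real, Real.norm_eq_abs, abs_le]; constructor <;> linarith
  have hprod : (1 / 2 : ℝ) ^ n ≤ ∏ j, ‖(b : ℂ) - z j‖ := by
    rw [← norm_prod, prod_sub_eq hd, norm_mul, norm_prod]
    have h1 : ∏ j : Fin n, (1 / 2 : ℝ) ≤ ∏ j, ‖(b : ℂ) - ζ j‖ :=
      prod_le_prod (fun _ _ => by norm_num) fun j _ => hζn j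
    have h2 : (1 : ℝ) ≤ ‖(n : ℂ) + 1‖ := by
      rw [← Nat.cast_add_one, Complex.norm_natCast]; push_cast; linarith [n.cast_nonneg (α := ℝ)]
    simp only [prod_const, card_univ, Fintype.card_fin] at h1
    nlinarith [pow_pos (by norm_num : (0 : ℝ) < 1 / 2) n]
  have hzlow : ∀ j, c₀ ≤ ‖(b : ℂ) - z j‖ := norm_sub_lower_bound
    (fun j => (norm_sub_le _ _).trans (by linarith [hz j])) hprod
  have hz0 : ∀ j, (b : ℂ) - z j ≠ 0 := fun j => norm_pos_iff.mp (by linarith [hzlow j])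
  have hsum := congrArg Complex.re (sum_inv_sub_eq hd hζ0 hz0)
  rw [Complex.re_sum, show (2 : ℂ) = ((2 : ℝ) : ℂ) by norm_num, Complex.re_ofReal_mul,
    Complex.re_sum] at hsum
  have hlow : (n : ℝ) * (1 / 2 - 2 / c₀ ^ 2 * δ) ≤ ∑ j, (1 / ((b : ℂ) - z j)).re := by
    have := sum_le_sum fun j (_ : j ∈ (univ : Finset (Fin n))) =>
      re_inv_sub_lower_bound hb1 hc₀pos hδ3.le (hz j) (hzlow j)
    simpa only [sum_const, card_univ, Fintype.card_fin, nsmul_eq_mul] using this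
  have hup : ∀ j, (1 / ((b : ℂ) - ζ j)).re ≤ 1 + 2 * c * δ := fun j => by
    refine (Complex.re_le_norm _).trans ?_
    rw [norm_div, norm_one, div_le_iff₀ (by linarith [hζn j])]
    nlinarith [hζ j, mul_nonneg hc hδ0]
  have hothers : ∑ j ∈ univ.erase i, (1 / ((b : ℂ) - ζ j)).re ≤ ((n : ℝ) - 1) * (1 + 2 * c * δ) := by
    have := sum_le_sum fun j (_ : j ∈ (univ : Finset (Fin n)).erase i) => hup j
    rw [sum_const, card_erase_of_mem (mem_univ i), card_univ, Fintype.card_fin, nsmul_eq_mul,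
      Nat.cast_sub (Nat.one_le_iff_ne_zero.mpr (by rintro rfl; exact i.elim0))] at this
    simpa using this
  rw [← add_sum_erase univ _ (mem_univ i)] at hsum
  have hre : 1 - K₁ * δ ≤ (1 / ((b : ℂ) - ζ i)).re := by
    have e : K₁ * δ = (n : ℝ) * (4 / c₀ ^ 2 * δ) + 2 * c * n * δ := by rw [hK₁]; ring
    have : 0 ≤ c * δ := mul_nonneg hc hδ0
    rw [e]
    have e2 : (n : ℝ) * (1 / 2 - 2 / c₀ ^ 2 * δ) * 2 = n - (n : ℝ) * (4 / c₀ ^ 2 * δ) := by ring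
    nlinarith
  have hre2 : (1 / ((b : ℂ) - ζ i)).re =
      (b - (ζ i).re) / ((b - (ζ i).re) ^ 2 + (ζ i).im ^ 2) := by
    rw [one_div, Complex.inv_re, Complex.normSq_apply]
    simp only [Complex.sub_re, Complex.ofReal_re, Complex.sub_im, Complex.ofReal_im]
    congr 1; ring
  have hns : (1 - c * δ) ^ 2 ≤ (b - (ζ i).re) ^ 2 + (ζ i).im ^ 2 := by
    have h1 : (1 - c * δ) ^ 2 ≤ ‖(b : ℂ) - ζ i‖ ^ 2 :=
      pow_le_pow_left₀ (by linarith) (hζ i) 2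
    rw [← Complex.normSq_eq_norm_sq, Complex.normSq_apply] at h1
    simp only [Complex.sub_re, Complex.ofReal_re, Complex.sub_im, Complex.ofReal_im] at h1
    linarith
  obtain ⟨g1, g2⟩ := near_one_of_re_inv (mul_nonneg hK₁nn hδ0) (mul_nonneg hc hδ0) hKδ hcδ hns
    (hre2 ▸ hre)
  have hcδ0 : 0 ≤ c * δ := mul_nonneg hc hδ0
  have hKδ0 : 0 ≤ K₁ * δ := mul_nonneg hK₁nn hδ0
  refine ⟨?_, by nlinarith⟩
  rw [abs_le] at g1 ⊢
  constructor <;> nlinarith [g1.1, g1.2]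

/-! ### Inequalities between power sums of real numbers. -/

theorem sum_pow_four_le_sq {ι : Type*} (t : Finset ι) (y : ι → ℝ) :
    ∑ i ∈ t, y i ^ 4 ≤ (∑ i ∈ t, y i ^ 2) ^ 2 := by
  calc ∑ i ∈ t, y i ^ 4 = ∑ i ∈ t, (y i ^ 2) ^ 2 := sum_congr rfl fun _ _ => by ring
    _ ≤ (∑ i ∈ t, y i ^ 2) ^ 2 := sum_sq_le_sq_sum_of_nonneg fun _ _ => sq_nonneg _

/-- A power sum form of Newton's inequality `e₂ e₄ ≲ e₃²`. -/
theorem power_sum_newton {ι : Type*} [Fintype ι] (y : ι → ℝ) :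
    (2 * ∑ i, y i ^ 4 - (∑ i, y i ^ 2) ^ 2) * ∑ i, y i ^ 2 ≤ 2 * (∑ i, y i ^ 3) ^ 2 := by
  classical
  cases isEmpty_or_nonempty ι
  · simp
  obtain ⟨m, -, hm⟩ := exists_max_image (univ : Finset ι) (fun i => y i ^ 2) univ_nonempty
  rw [← add_sum_erase univ (fun i => y i ^ 4) (mem_univ m),
    ← add_sum_erase univ (fun i => y i ^ 2) (mem_univ m),
    ← add_sum_erase univ (fun i => y i ^ 3) (mem_univ m)]
  have h4 := sum_pow_four_le_sq (univ.erase m) y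
  have hQ0 : 0 ≤ ∑ i ∈ univ.erase m, y i ^ 2 := sum_nonneg fun _ _ => sq_nonneg _
  have h3 : |∑ i ∈ univ.erase m, y i ^ 3| ≤ |y m| * ∑ i ∈ univ.erase m, y i ^ 2 := by
    rw [mul_sum]
    refine (abs_sum_le_sum_abs _ _).trans (sum_le_sum fun i _ => ?_)
    rw [show y i ^ 3 = y i * y i ^ 2 by ring, abs_mul, abs_of_nonneg (sq_nonneg (y i))]
    exact mul_le_mul_of_nonneg_right (sq_le_sq.mp (hm i (mem_univ i))) (sq_nonneg _)
  set Q := ∑ i ∈ univ.erase m, y i ^ 2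
  set T := ∑ i ∈ univ.erase m, y i ^ 3
  set U := ∑ i ∈ univ.erase m, y i ^ 4
  set M := y m
  have hA : 2 * (M ^ 4 + U) - (M ^ 2 + Q) ^ 2 ≤ (M ^ 2 - Q) ^ 2 := by nlinarith
  -- If the largest square dominates, the other cubes cannot cancel `M ^ 3` below `|M| (M ^ 2 - Q)`;
  -- otherwise the left side is nonpositive.
  by_cases hQM : Q ≤ M ^ 2
  · have hT : (M * (M ^ 2 - Q)) ^ 2 ≤ (M ^ 3 + T) ^ 2 := by
      apply sq_le_sq.mpr
      have e : |M * (M ^ 2 - Q)| = |M| * (M ^ 2 - Q) := by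
        rw [abs_mul, abs_of_nonneg (by linarith : 0 ≤ M ^ 2 - Q)]
      have e3 : |M ^ 3| = |M| * M ^ 2 := by
        rw [show M ^ 3 = M * M ^ 2 by ring, abs_mul, abs_of_nonneg (sq_nonneg M)]
      have e4 : |M ^ 3| ≤ |M ^ 3 + T| + |T| := by
        have := abs_sub (M ^ 3 + T) T
        simpa using this
      rw [e]
      linarith
    calc _ ≤ (M ^ 2 - Q) ^ 2 * (M ^ 2 + Q) := mul_le_mul_of_nonneg_right hA (by positivity)
      _ ≤ (M ^ 2 - Q) ^ 2 * (2 * M ^ 2) := mul_le_mul_of_nonneg_left (by linarith) (sq_nonneg _)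
      _ = 2 * (M * (M ^ 2 - Q)) ^ 2 := by ring
      _ ≤ _ := by linarith
  · have hU : U ≤ M ^ 2 * Q := by
      rw [mul_sum]
      refine sum_le_sum fun i _ => ?_
      nlinarith [hm i (mem_univ i), sq_nonneg (y i)]
    have : 2 * (M ^ 4 + U) - (M ^ 2 + Q) ^ 2 ≤ 0 := by nlinarith
    have h5 : (2 * (M ^ 4 + U) - (M ^ 2 + Q) ^ 2) * (M ^ 2 + Q) ≤ 0 :=
      mul_nonpos_of_nonpos_of_nonneg this (by positivity)
    nlinarith [sq_nonneg (M ^ 3 + T)]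

/-- The extremal vector is `c (4, -1, -1, -1, -1)`, with `Σ y² = 20c²` and `Σ y⁴ = 260c⁴`. The
certificate is a quartic that vanishes at `4c` and doubly at `-c`, and is nonnegative on `[-2c,
4c]`. -/
theorem quartic_bound_of_neg_two_le {y : Fin 5 → ℝ} {c : ℝ} (h0 : ∑ i, y i = 0)
    (h2 : ∑ i, y i ^ 2 = 20 * c ^ 2) (h4 : ∀ i, y i ≤ 4 * c) (hlow : ∀ i, -(2 * c) ≤ y i) :
    ∑ i, y i ^ 4 ≤ 260 * c ^ 4 := by
  have h : ∀ i, 0 ≤ -y i ^ 4 + 11 * c ^ 2 * y i ^ 2 + 18 * c ^ 3 * y i + 8 * c ^ 4 := fun i => by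
    have e : -y i ^ 4 + 11 * c ^ 2 * y i ^ 2 + 18 * c ^ 3 * y i + 8 * c ^ 4 =
        (4 * c - y i) * (y i + 2 * c) * (y i + c) ^ 2 := by ring
    rw [e]
    exact mul_nonneg (mul_nonneg (by linarith [h4 i]) (by linarith [hlow i])) (sq_nonneg _)
  have hs := sum_nonneg fun i (_ : i ∈ (univ : Finset (Fin 5))) => h i
  simp only [sum_add_distrib, sum_neg_distrib, ← mul_sum, h0, h2, sum_const, card_univ,
    Fintype.card_fin, nsmul_eq_mul] at hs
  push_cast at hs
  linarith

theorem quartic_bound_of_mixed {y : Fin 5 → ℝ} {c : ℝ} (hc : 0 < c) (h0 : ∑ i, y i = 0)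
    (h2 : ∑ i, y i ^ 2 = 20 * c ^ 2) (h4 : ∀ i, y i ≤ 4 * c) {i j : Fin 5}
    (hi : 2 * c < y i) (hj : y j < -(2 * c)) (hij : -y j ≤ y i) :
    ∑ i, y i ^ 4 ≤ 260 * c ^ 4 := by
  have hne : j ∈ univ.erase i := mem_erase.mpr ⟨by rintro rfl; linarith, mem_univ j⟩
  have hcard : ((univ.erase i).erase j).card = 3 := by
    rw [card_erase_of_mem hne, card_erase_of_mem (mem_univ i)]; rfl
  have split : ∀ f : Fin 5 → ℝ, ∑ l, f l = f i + (f j + ∑ l ∈ (univ.erase i).erase j, f l) :=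
    fun f => by rw [add_sum_erase _ f hne, add_sum_erase _ f (mem_univ i)]
  have hCS := sq_sum_le_card_mul_sum_sq (s := (univ.erase i).erase j) (f := y)
  have hquart := sum_pow_four_le_sq ((univ.erase i).erase j) y
  have hQ0 : 0 ≤ ∑ l ∈ (univ.erase i).erase j, y l ^ 2 := sum_nonneg fun _ _ => sq_nonneg _
  rw [split] at h0 h2
  rw [split fun l => y l ^ 4]
  rw [hcard] at hCS
  push_cast at hCS
  set Q := ∑ l ∈ (univ.erase i).erase j, y l ^ 2
  set s := ∑ l ∈ (univ.erase i).erase j, y l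
  set u := ∑ l ∈ (univ.erase i).erase j, y l ^ 4
  have hM := h4 i
  set M := y i
  obtain ⟨m, hm⟩ : ∃ m, y j = -m := ⟨-y j, by ring⟩
  rw [hm] at h0 h2 hj hij ⊢
  have hs : s = m - M := by linarith
  rw [hs] at hCS
  have hm2 : 2 * c < m := by linarith
  -- Cauchy-Schwarz on the other three entries gives `4M² + 2m(2m - M) ≤ 60c²`, and `2m > 4c ≥ M`.
  have hA : M ^ 2 ≤ 15 * c ^ 2 := by
    nlinarith [mul_nonneg (by linarith : 0 ≤ 4 * c - M) (by linarith : 0 ≤ m),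
      mul_nonneg (by linarith : 0 ≤ m - 2 * c) (by linarith : 0 ≤ m)]
  have hB4 : 4 * c ^ 2 ≤ m ^ 2 := by nlinarith
  have hBA : m ^ 2 ≤ M ^ 2 := by nlinarith
  have hc2 : 0 < c ^ 2 := by positivity
  have hQ : Q = 20 * c ^ 2 - M ^ 2 - m ^ 2 := by linarith
  have key : (M ^ 2) ^ 2 + (m ^ 2) ^ 2 + Q ^ 2 ≤ 260 * (c ^ 2) ^ 2 := by
    generalize M ^ 2 = A at *
    generalize m ^ 2 = B at *
    generalize c ^ 2 = d at *
    -- The three squares add up to `20d`. Either `A` lies in `[10d, 15d]`, where `A² + (20d - A)² ≤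
    -- 250d²`, or all three are at most `12d`, so their squares sum to at most `240d²`.
    by_cases hA10 : 10 * d ≤ A
    · have h1 : B ^ 2 + Q ^ 2 ≤ (20 * d - A) ^ 2 := by
        have : 20 * d - A = B + Q := by linarith
        rw [this]; nlinarith
      nlinarith [mul_nonneg (by linarith : 0 ≤ A - 5 * d) (by linarith : 0 ≤ 15 * d - A)]
    · have hQ12 : Q ≤ 12 * d := by linarith
      have h1 : A ^ 2 ≤ 12 * d * A := by nlinarith
      have h2 : B ^ 2 ≤ 12 * d * B := by nlinarith
      have h3 : Q ^ 2 ≤ 12 * d * Q := by nlinarith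
      have h4 : 12 * d * A + 12 * d * B + 12 * d * Q = 240 * d ^ 2 := by rw [hQ]; ring
      nlinarith
  nlinarith

/-- Cauchy-Schwarz on the other four entries gives `|y i| ≤ 4c`. Up to the sign change `y ↦ -y`,
either all entries are at least `-2c`, or there are entries beyond `2c` on both sides and the mixed
case applies. -/
theorem quartic_bound_five {y : Fin 5 → ℝ} (h0 : ∑ i, y i = 0) :
    ∑ i, y i ^ 4 ≤ 13 / 20 * (∑ i, y i ^ 2) ^ 2 := by
  have hnn : 0 ≤ ∑ i, y i ^ 2 := sum_nonneg fun _ _ => sq_nonneg _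
  obtain ⟨c, hc0, hc⟩ : ∃ c : ℝ, 0 ≤ c ∧ ∑ i, y i ^ 2 = 20 * c ^ 2 :=
    ⟨√((∑ i, y i ^ 2) / 20), Real.sqrt_nonneg _, by rw [Real.sq_sqrt (by positivity)]; ring⟩
  rw [hc, show 13 / 20 * (20 * c ^ 2) ^ 2 = 260 * c ^ 4 by ring]
  rcases hc0.eq_or_lt with rfl | hcpos
  · have := sum_pow_four_le_sq univ y
    rw [hc] at this
    linarith
  have habs : ∀ i, |y i| ≤ 4 * c := fun i => by
    have hCS := sq_sum_le_card_mul_sum_sq (s := univ.erase i) (f := y)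
    rw [card_erase_of_mem (mem_univ i), card_univ, Fintype.card_fin] at hCS
    have e1 := add_sum_erase univ y (mem_univ i)
    have e2 := add_sum_erase univ (fun l => y l ^ 2) (mem_univ i)
    simp only [hc, h0] at e1 e2
    rw [show ∑ l ∈ univ.erase i, y l = -y i by linarith,
      show ∑ l ∈ univ.erase i, y l ^ 2 = 20 * c ^ 2 - y i ^ 2 by linarith] at hCS
    push_cast at hCS
    exact abs_le_of_sq_le_sq (by nlinarith) (by linarith)
  have hup : ∀ i, y i ≤ 4 * c := fun i => (abs_le.mp (habs i)).2
  have hdn : ∀ i, -y i ≤ 4 * c := fun i => by linarith [(abs_le.mp (habs i)).1]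
  have n0 : ∑ i, -y i = 0 := by rw [sum_neg_distrib, h0, neg_zero]
  have n2 : ∑ i, (-y i) ^ 2 = 20 * c ^ 2 := by simpa using hc
  have n4 : ∑ i, (-y i) ^ 4 = ∑ i, y i ^ 4 := sum_congr rfl fun _ _ => by ring
  by_cases hA : ∀ i, -(2 * c) ≤ y i
  · exact quartic_bound_of_neg_two_le h0 hc hup hA
  by_cases hB : ∀ i, y i ≤ 2 * c
  · rw [← n4]
    exact quartic_bound_of_neg_two_le n0 n2 hdn fun i => by linarith [hB i]
  push Not at hA hB
  obtain ⟨j, hj⟩ := hA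
  obtain ⟨i, hi⟩ := hB
  by_cases hij : -y j ≤ y i
  · exact quartic_bound_of_mixed hcpos h0 hc hup hi hj hij
  · rw [← n4]
    exact quartic_bound_of_mixed hcpos n0 n2 hdn (i := j) (j := i) (by linarith) (by linarith)
      (by linarith)

/-! ### The two active angles, their weights, and the sign of the curvature. -/

noncomputable def θ₁ (n : ℕ) : ℝ := 2 * Real.pi * (Sendov.k n : ℝ) / ((n : ℝ) + 1)

noncomputable def θ₂ (n : ℕ) : ℝ := 2 * Real.pi * ((Sendov.k n : ℝ) + 1) / ((n : ℝ) + 1)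

theorem k_bounds (n : ℕ) :
    3 * (Sendov.k n : ℝ) ≤ n + 1 ∧ (n : ℝ) + 1 ≤ 3 * (Sendov.k n : ℝ) + 2 := by
  have h : Sendov.k n = (n + 1) / 3 := rfl
  have h1 : 3 * Sendov.k n ≤ n + 1 := by omega
  have h2 : n + 1 ≤ 3 * Sendov.k n + 2 := by omega
  exact ⟨by exact_mod_cast h1, by exact_mod_cast h2⟩

theorem k_pos {n : ℕ} (hn : 3 ≤ n) : (1 : ℝ) ≤ Sendov.k n := by
  have h : Sendov.k n = (n + 1) / 3 := rfl
  have : 1 ≤ Sendov.k n := by omega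
  exact_mod_cast this

theorem two_mul_k_add_one_le {n : ℕ} (hn : 3 ≤ n) : 2 * ((Sendov.k n : ℝ) + 1) ≤ n + 1 := by
  have h : Sendov.k n = (n + 1) / 3 := rfl
  have : 2 * (Sendov.k n + 1) ≤ n + 1 := by omega
  exact_mod_cast this

theorem two_mul_k_add_one_lt {n : ℕ} (hn : 4 ≤ n) (h5 : n ≠ 5) :
    2 * ((Sendov.k n : ℝ) + 1) < n + 1 := by
  have h : Sendov.k n = (n + 1) / 3 := rfl
  have : 2 * (Sendov.k n + 1) < n + 1 := by omega
  exact_mod_cast this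

theorem cos_two_pi_div_three : Real.cos (2 * Real.pi / 3) = -1 / 2 := by
  rw [show 2 * Real.pi / 3 = Real.pi - Real.pi / 3 by ring, Real.cos_pi_sub, Real.cos_pi_div_three]
  ring

theorem θ₁_pos {n : ℕ} (hn : 3 ≤ n) : 0 < θ₁ n := by
  have := k_pos hn
  have := Real.pi_pos
  unfold θ₁; positivity

theorem θ₁_le (n : ℕ) : θ₁ n ≤ 2 * Real.pi / 3 := by
  unfold θ₁
  rw [div_le_div_iff₀ (by positivity) (by norm_num)]
  nlinarith [(k_bounds n).1, Real.pi_pos]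

theorem le_θ₂ (n : ℕ) : 2 * Real.pi / 3 ≤ θ₂ n := by
  unfold θ₂
  rw [div_le_div_iff₀ (by norm_num) (by positivity)]
  nlinarith [(k_bounds n).2, Real.pi_pos]

theorem θ₂_le {n : ℕ} (hn : 3 ≤ n) : θ₂ n ≤ Real.pi := by
  unfold θ₂
  rw [div_le_iff₀ (by positivity)]
  nlinarith [two_mul_k_add_one_le hn, Real.pi_pos]

theorem sin_θ₁_pos {n : ℕ} (hn : 3 ≤ n) : 0 < Real.sin (θ₁ n) :=
  Real.sin_pos_of_pos_of_lt_pi (θ₁_pos hn) ((θ₁_le n).trans_lt (by linarith [Real.pi_pos]))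

theorem sin_θ₂_pos {n : ℕ} (hn : 4 ≤ n) (h5 : n ≠ 5) : 0 < Real.sin (θ₂ n) := by
  have := Real.pi_pos
  refine Real.sin_pos_of_pos_of_lt_pi (lt_of_lt_of_le (by positivity) (le_θ₂ n)) ?_
  unfold θ₂
  rw [div_lt_iff₀ (by positivity)]
  nlinarith [two_mul_k_add_one_lt hn h5]

theorem u₁_eq (n : ℕ) : Sendov.u₁ n = Real.cos (θ₁ n) := rfl

theorem u₂_eq (n : ℕ) : Sendov.u₂ n = Real.cos (θ₂ n) := rfl

theorem neg_half_le_u₁ {n : ℕ} (hn : 3 ≤ n) : -1 / 2 ≤ Sendov.u₁ n := by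
  have := Real.pi_pos
  rw [u₁_eq, ← cos_two_pi_div_three]
  exact Real.cos_le_cos_of_nonneg_of_le_pi (θ₁_pos hn).le (by linarith) (θ₁_le n)

theorem u₁_lt_one {n : ℕ} (hn : 3 ≤ n) : Sendov.u₁ n < 1 := by
  have := sin_θ₁_pos hn
  rw [u₁_eq]
  nlinarith [Real.sin_sq_add_cos_sq (θ₁ n), Real.cos_le_one (θ₁ n)]

/-- The cosine is concave here, so it lies above its chord from `0` to `π/3`. -/
theorem one_sub_le_cos {w : ℝ} (h0 : 0 ≤ w) (h1 : w ≤ Real.pi / 3) :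
    1 - 3 * w / (2 * Real.pi) ≤ Real.cos w := by
  have hpi := Real.pi_pos
  have hc := strictConcaveOn_cos_Icc.concaveOn.2
    (show (0 : ℝ) ∈ Set.Icc _ _ from ⟨by linarith, by linarith⟩)
    (show Real.pi / 3 ∈ Set.Icc _ _ from ⟨by linarith, by linarith⟩)
    (show 0 ≤ 1 - 3 * w / Real.pi by rw [sub_nonneg, div_le_one hpi]; linarith)
    (show 0 ≤ 3 * w / Real.pi by positivity) (by ring)
  simp only [smul_eq_mul, mul_zero, zero_add, Real.cos_zero, mul_one, Real.cos_pi_div_three] at hc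
  have e : 3 * w / Real.pi * (Real.pi / 3) = w := by field_simp
  rw [e] at hc
  calc _ = 1 - 3 * w / Real.pi + 3 * w / Real.pi * (1 / 2) := by field_simp; ring
    _ ≤ _ := hc

/-- The margin `1/(n+1)` exceeds `1/(2n)`, which is what makes `wt₁` positive. -/
theorem u₂_le {n : ℕ} (hn : 3 ≤ n) : Sendov.u₂ n ≤ -1 / 2 - 1 / ((n : ℝ) + 1) := by
  have hpi := Real.pi_pos
  have h := one_sub_le_cos (w := Real.pi - θ₂ n) (by linarith [θ₂_le hn]) (by linarith [le_θ₂ n])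
  rw [Real.cos_pi_sub, ← u₂_eq] at h
  have hN : (0 : ℝ) < n + 1 := by positivity
  have e : 3 * (Real.pi - θ₂ n) / (2 * Real.pi) =
      3 / 2 - 3 * ((Sendov.k n : ℝ) + 1) / (n + 1) := by
    unfold θ₂; field_simp; try ring
  rw [e] at h
  have h2 : 1 + 1 / ((n : ℝ) + 1) ≤ 3 * ((Sendov.k n : ℝ) + 1) / (n + 1) := by
    rw [le_div_iff₀ hN]
    have : (1 + 1 / ((n : ℝ) + 1)) * (n + 1) = n + 2 := by field_simp; try ring
    rw [this]
    linarith [(k_bounds n).2]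
  linarith

theorem neg_one_le_u₂ (n : ℕ) : -1 ≤ Sendov.u₂ n := Real.neg_one_le_cos _

theorem u₁_add_u₂_neg {n : ℕ} (hn : 3 ≤ n) : Sendov.u₁ n + Sendov.u₂ n < 0 := by
  have hpi := Real.pi_pos
  have hN : (0 : ℝ) < n + 1 := by positivity
  have hn' : (3 : ℝ) ≤ n := by exact_mod_cast hn
  rw [u₁_eq, u₂_eq, Real.cos_add_cos]
  have e1 : (θ₁ n + θ₂ n) / 2 = Real.pi * (2 * (Sendov.k n : ℝ) + 1) / (n + 1) := by
    unfold θ₁ θ₂; field_simp; ring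
  have e2 : (θ₁ n - θ₂ n) / 2 = -(Real.pi / (n + 1)) := by
    unfold θ₁ θ₂; field_simp; ring
  rw [e1, e2, Real.cos_neg]
  have h1 : Real.cos (Real.pi * (2 * (Sendov.k n : ℝ) + 1) / (n + 1)) < 0 := by
    apply Real.cos_neg_of_pi_div_two_lt_of_lt
    · rw [div_lt_div_iff₀ two_pos hN]
      nlinarith [(k_bounds n).2, k_pos hn]
    · rw [div_lt_iff₀ hN]
      nlinarith [two_mul_k_add_one_le hn]
  have h2 : 0 < Real.cos (Real.pi / (n + 1)) := by
    apply Real.cos_pos_of_mem_Ioo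
    constructor
    · have : 0 < Real.pi / (n + 1) := by positivity
      linarith
    · exact div_lt_div_of_pos_left hpi two_pos (by linarith)
  nlinarith

/-- `wt₁` and `wt₂` are the barycentric coordinates of `-1/2 - 1/(2n)` between `u₁` and `u₂`. This
mean is what the coefficient `1 - 1/n` of `R₂` in the linear program requires. -/
noncomputable def wt₁ (n : ℕ) : ℝ :=
  (-1 / 2 - 1 / (2 * (n : ℝ)) - Sendov.u₂ n) / (Sendov.u₁ n - Sendov.u₂ n)

noncomputable def wt₂ (n : ℕ) : ℝ :=
  (Sendov.u₁ n + 1 / 2 + 1 / (2 * (n : ℝ))) / (Sendov.u₁ n - Sendov.u₂ n)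

theorem inv_add_one_gt {n : ℕ} (hn : 3 ≤ n) : 1 / (2 * (n : ℝ)) < 1 / ((n : ℝ) + 1) := by
  have hn' : (3 : ℝ) ≤ n := by exact_mod_cast hn
  exact one_div_lt_one_div_of_lt (by linarith) (by linarith)

theorem u₂_lt_u₁ {n : ℕ} (hn : 3 ≤ n) : Sendov.u₂ n < Sendov.u₁ n := by
  have : (0 : ℝ) < 1 / ((n : ℝ) + 1) := by positivity
  linarith [u₂_le hn, neg_half_le_u₁ hn]

theorem wt₁_pos {n : ℕ} (hn : 3 ≤ n) : 0 < wt₁ n :=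
  div_pos (by linarith [inv_add_one_gt hn, u₂_le hn]) (by linarith [u₂_lt_u₁ hn])

theorem wt₂_pos {n : ℕ} (hn : 3 ≤ n) : 0 < wt₂ n := by
  have : (0 : ℝ) < 1 / (2 * (n : ℝ)) := by
    have : (0 : ℝ) < n := by exact_mod_cast (by omega : 0 < n)
    positivity
  exact div_pos (by linarith [neg_half_le_u₁ hn]) (by linarith [u₂_lt_u₁ hn])

theorem wt_add {n : ℕ} (hn : 3 ≤ n) : wt₁ n + wt₂ n = 1 := by
  have : Sendov.u₁ n - Sendov.u₂ n ≠ 0 := by linarith [u₂_lt_u₁ hn]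
  unfold wt₁ wt₂
  rw [← add_div, div_eq_one_iff_eq this]; ring

theorem wt_mean {n : ℕ} (hn : 3 ≤ n) :
    wt₁ n * Sendov.u₁ n + wt₂ n * Sendov.u₂ n = -1 / 2 - 1 / (2 * (n : ℝ)) := by
  have : Sendov.u₁ n - Sendov.u₂ n ≠ 0 := by linarith [u₂_lt_u₁ hn]
  unfold wt₁ wt₂
  rw [div_mul_eq_mul_div, div_mul_eq_mul_div, ← add_div, div_eq_iff this]; ring

/-- Both factors are differences of cosines at angles near `2π/3`. The angular gaps are `j` and `3 -
j` times `2π/(3(n+1))` with `j = n + 1 - 3k ∈ {0, 1, 2}`, so `j(3 - j) ≤ 2`. -/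
theorem shifted_prod_le {n : ℕ} (hn : 9 ≤ n) :
    (Sendov.u₁ n + 1 / 2) * (-1 / 2 - Sendov.u₂ n) ≤ 8 / 100 := by
  have hpi := Real.pi_pos
  have hpi2 := Real.pi_lt_d4
  have hn' : (9 : ℝ) ≤ n := by exact_mod_cast hn
  have hN : (0 : ℝ) < n + 1 := by positivity
  have h1 : Sendov.u₁ n + 1 / 2 ≤ 2 * Real.pi / 3 - θ₁ n := by
    have e : Sendov.u₁ n + 1 / 2 = Real.cos (θ₁ n) - Real.cos (2 * Real.pi / 3) := by
      rw [cos_two_pi_div_three, u₁_eq]; ring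
    have hx : 0 ≤ (2 * Real.pi / 3 - θ₁ n) / 2 := by linarith [θ₁_le n]
    rw [e, Real.cos_sub_cos, show (θ₁ n - 2 * Real.pi / 3) / 2 = -((2 * Real.pi / 3 - θ₁ n) / 2) by ring,
      Real.sin_neg]
    have h2 := Real.sin_le hx
    have h3 := Real.sin_nonneg_of_nonneg_of_le_pi hx (by linarith [θ₁_pos (n := n) (by omega)])
    nlinarith [Real.sin_le_one ((θ₁ n + 2 * Real.pi / 3) / 2)]
  have h2 : -1 / 2 - Sendov.u₂ n ≤ √3 / 2 * (θ₂ n - 2 * Real.pi / 3) := by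
    have e : -1 / 2 - Sendov.u₂ n = Real.cos (2 * Real.pi / 3) - Real.cos (θ₂ n) := by
      rw [cos_two_pi_div_three, u₂_eq]
    have hx : 0 ≤ (θ₂ n - 2 * Real.pi / 3) / 2 := by linarith [le_θ₂ n]
    have hθ₂ := θ₂_le (n := n) (by omega)
    rw [e, Real.cos_sub_cos, show (2 * Real.pi / 3 - θ₂ n) / 2 = -((θ₂ n - 2 * Real.pi / 3) / 2) by ring,
      Real.sin_neg]
    have h2 := Real.sin_le hx
    have h3 := Real.sin_nonneg_of_nonneg_of_le_pi hx (by linarith)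
    have h4 : Real.sin ((2 * Real.pi / 3 + θ₂ n) / 2) ≤ √3 / 2 := by
      rw [← Real.sin_pi_div_three, ← Real.sin_pi_sub]
      exact Real.sin_le_sin_of_le_of_le_pi_div_two (by linarith) (by linarith)
        (by linarith [le_θ₂ n])
    have h5 : 0 ≤ Real.sin ((2 * Real.pi / 3 + θ₂ n) / 2) :=
      Real.sin_nonneg_of_nonneg_of_le_pi (by linarith) (by linarith)
    nlinarith
  have hs3 : √3 ≤ 1.7321 := Real.sqrt_le_iff.mpr ⟨by norm_num, by norm_num⟩
  have hj : (((n : ℝ) + 1) - 3 * Sendov.k n) * (3 * Sendov.k n + 3 - ((n : ℝ) + 1)) ≤ 2 := by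
    obtain ⟨a, b⟩ := k_bounds n
    have h : Sendov.k n = (n + 1) / 3 := rfl
    have h3 : n + 1 = 3 * Sendov.k n ∨ n + 1 = 3 * Sendov.k n + 1 ∨ n + 1 = 3 * Sendov.k n + 2 := by
      omega
    rcases h3 with h3 | h3 | h3 <;>
    · have h4 := congrArg (Nat.cast (R := ℝ)) h3
      push_cast at h4
      rw [h4]; ring_nf; norm_num
  have e1 : 2 * Real.pi / 3 - θ₁ n =
      2 * Real.pi / (3 * (n + 1)) * (((n : ℝ) + 1) - 3 * Sendov.k n) := by
    unfold θ₁; field_simp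
  have e2 : θ₂ n - 2 * Real.pi / 3 =
      2 * Real.pi / (3 * (n + 1)) * (3 * Sendov.k n + 3 - ((n : ℝ) + 1)) := by
    unfold θ₂; field_simp; try ring
  have h0 : 0 ≤ -1 / 2 - Sendov.u₂ n := by
    have : (0 : ℝ) < 1 / ((n : ℝ) + 1) := by positivity
    linarith [u₂_le (n := n) (by omega)]
  have hφ : 2 * Real.pi / (3 * ((n : ℝ) + 1)) ≤ 0.20944 := by
    rw [div_le_iff₀ (by positivity)]; nlinarith
  have hφ0 : 0 ≤ 2 * Real.pi / (3 * ((n : ℝ) + 1)) := by positivity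
  set φ := 2 * Real.pi / (3 * ((n : ℝ) + 1))
  have hφ2 : φ ^ 2 ≤ 0.20944 ^ 2 := pow_le_pow_left₀ hφ0 hφ 2
  have h3 : 0 ≤ 2 * Real.pi / 3 - θ₁ n := by linarith [θ₁_le n]
  calc _ ≤ (2 * Real.pi / 3 - θ₁ n) * (√3 / 2 * (θ₂ n - 2 * Real.pi / 3)) :=
        mul_le_mul h1 h2 h0 h3
    _ = √3 / 2 * φ ^ 2 * ((((n : ℝ) + 1) - 3 * Sendov.k n) * (3 * Sendov.k n + 3 - ((n : ℝ) + 1))) := by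
        rw [e1, e2]; ring
    _ ≤ √3 / 2 * φ ^ 2 * 2 := mul_le_mul_of_nonneg_left hj (by positivity)
    _ ≤ 1.7321 / 2 * 0.20944 ^ 2 * 2 := by gcongr
    _ ≤ _ := by norm_num

/-- The prescribed mean reduces the weighted second and third moments of `v` and `-w` to polynomials
in `v * w` and `w - v`. -/
theorem curvature_of_shift_bounds {n : ℕ} (hn : 4 ≤ n) {a b v w : ℝ} (ha : 0 ≤ a) (hb : 0 ≤ b)
    (hab : a + b = 1) (hmean : a * v - b * w = -1 / (2 * (n : ℝ))) (hv : 0 ≤ v) (hw : w ≤ 1 / 2)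
    (h : (v * w + (w - v) / (2 * (n : ℝ))) * (12 + 8 * (w - v)) + 4 * (v * w) / n ≤ 2 - 1 / n) :
    0 ≤ 1 / (n : ℝ) + (a * (8 * (v - 1 / 2) ^ 2 * (v + 1 / 2)) +
        b * (8 * (-w - 1 / 2) ^ 2 * (-w + 1 / 2))) / ((n : ℝ) - 3) -
      2 * (a * (2 * v) ^ 2 + b * (2 * w) ^ 2) / ((n : ℝ) - 2) := by
  have hn' : (4 : ℝ) ≤ n := by exact_mod_cast hn
  have hA : 0 ≤ a * (8 * (v - 1 / 2) ^ 2 * (v + 1 / 2)) + b * (8 * (-w - 1 / 2) ^ 2 * (-w + 1 / 2)) := by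
    have h1 : 0 ≤ v + 1 / 2 := by linarith
    have h2 : 0 ≤ -w + 1 / 2 := by linarith
    positivity
  -- The term over `n - 3` is nonnegative, so enlarging its denominator to `n - 2` only lowers the
  -- expression.
  have hstep := div_le_div_of_nonneg_left hA (by linarith : 0 < (n : ℝ) - 3)
    (by linarith : (n : ℝ) - 3 ≤ n - 2)
  refine le_trans ?_ (sub_le_sub_right (add_le_add_right hstep _) _)
  have e : 1 / (n : ℝ) = ((n - 2) / n) / (n - 2) := by
    have : (n : ℝ) - 2 ≠ 0 := by linarith
    field_simp
  rw [e, ← add_div, ← sub_div]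
  apply div_nonneg _ (by linarith)
  set t := 1 / (n : ℝ) with ht
  have ht2 : ((n : ℝ) - 2) / n = 1 - 2 * t := by rw [ht]; field_simp
  have ht3 : -1 / (2 * (n : ℝ)) = -t / 2 := by rw [ht]; ring
  have ht4 : (w - v) / (2 * (n : ℝ)) = (w - v) * t / 2 := by rw [ht]; ring
  have ht5 : 4 * (v * w) / n = 4 * (v * w) * t := by rw [ht]; ring
  rw [ht2]
  rw [ht3] at hmean
  rw [ht4, ht5] at h
  have hb' : b = 1 - a := by linarith
  have m2 : a * v ^ 2 + b * w ^ 2 = v * w + (w - v) * t / 2 := by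
    rw [hb'] at hmean ⊢
    linear_combination (v - w) * hmean
  have m3 : a * v ^ 3 - b * w ^ 3 = (v - w) * (v * w + (w - v) * t / 2) + v * w * (-t / 2) := by
    rw [← m2]
    rw [hb'] at hmean ⊢
    linear_combination (v * w) * hmean
  nlinarith

/-- The total coefficient of `quarticDefect` at second order: `1/n` comes from the squares of the
real parts, the fractions over `n - 3` and `n - 2` from the fourth and third harmonics. At `n = 3`
the division by zero returns `0`, which is harmless because `e₄` vanishes there. -/
noncomputable def curv (n : ℕ) : ℝ :=
  1 / (n : ℝ) + (wt₁ n * (8 * Sendov.u₁ n ^ 2 * (1 + Sendov.u₁ n)) +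
    wt₂ n * (8 * Sendov.u₂ n ^ 2 * (1 + Sendov.u₂ n))) / ((n : ℝ) - 3) -
  2 * (wt₁ n * (1 + 2 * Sendov.u₁ n) ^ 2 + wt₂ n * (1 + 2 * Sendov.u₂ n) ^ 2) / ((n : ℝ) - 2)

theorem curv_nonneg_of_bound {n : ℕ} (hn : 4 ≤ n) {v w : ℝ} (hv : v = Sendov.u₁ n + 1 / 2)
    (hw : w = -1 / 2 - Sendov.u₂ n)
    (h : (v * w + (w - v) / (2 * (n : ℝ))) * (12 + 8 * (w - v)) + 4 * (v * w) / n ≤ 2 - 1 / n) :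
    0 ≤ curv n := by
  have hn3 : 3 ≤ n := by omega
  have hn0 : (n : ℝ) ≠ 0 := by positivity
  have hm := wt_mean hn3
  have hs := wt_add hn3
  have := curvature_of_shift_bounds hn (wt₁_pos hn3).le (wt₂_pos hn3).le hs (v := v) (w := w)
    (by rw [hv, hw, show -1 / (2 * (n : ℝ)) = -(1 / (2 * (n : ℝ))) by ring]
        linear_combination hm + hs / 2)
    (by linarith [neg_half_le_u₁ hn3]) (by linarith [neg_one_le_u₂ n]) h
  rw [curv]
  convert this using 1
  rw [hv, hw]; ring

theorem u_six_bounds : Sendov.u₁ 6 + 1 / 2 ≤ 0.2786 ∧ 0.2753 ≤ Sendov.u₁ 6 + 1 / 2 ∧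
    -1 / 2 - Sendov.u₂ 6 ≤ 0.4126 := by
  have hpi := Real.pi_gt_d2
  have hpi2 := Real.pi_lt_d4
  have hk : Sendov.k 6 = 2 := rfl
  have e1 : Sendov.u₁ 6 = -Real.sin (Real.pi / 14) := by
    rw [u₁_eq, θ₁, hk, ← Real.cos_add_pi_div_two]; congr 1; push_cast; ring
  have e2 : Sendov.u₂ 6 = -Real.cos (Real.pi / 7) := by
    rw [u₂_eq, θ₂, hk, ← Real.cos_pi_sub]; congr 1; push_cast; ring
  have h1 := Real.sin_le (x := Real.pi / 14) (by positivity)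
  have h2 := Real.sin_gt_sub_cube (x := Real.pi / 14) (by positivity)
  have h3 := Real.cos_bound (x := Real.pi / 7) (by rw [abs_of_pos (by positivity)]; linarith)
  rw [abs_of_pos (by positivity : 0 < Real.pi / 7)] at h3
  have h4 := (abs_le.mp h3).2
  have p3 : (Real.pi / 14) ^ 3 ≤ 0.2244 ^ 3 := pow_le_pow_left₀ (by positivity) (by linarith) 3
  have p4 : (Real.pi / 7) ^ 4 ≤ 0.4488 ^ 4 := pow_le_pow_left₀ (by positivity) (by linarith) 4
  have p2 : 0.4485 ^ 2 ≤ (Real.pi / 7) ^ 2 := pow_le_pow_left₀ (by norm_num) (by linarith) 2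
  norm_num at p2 p3 p4
  rw [e1, e2]
  refine ⟨by linarith, by linarith, by linarith⟩

theorem curv_nonneg {n : ℕ} (hn : 4 ≤ n) (h5 : n ≠ 5) : 0 ≤ curv n := by
  have hn3 : 3 ≤ n := by omega
  have hv := neg_half_le_u₁ hn3
  have hw2 := neg_one_le_u₂ n
  have hw : Sendov.u₂ n ≤ -1 / 2 := by
    have : (0 : ℝ) < 1 / ((n : ℝ) + 1) := by positivity
    linarith [u₂_le hn3]
  refine curv_nonneg_of_bound hn rfl rfl ?_
  -- The cosines are exact for `n = 4, 7`; for `n = 8` the exact value `u₁ = -1/2` makes `v = 0`;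
  -- Taylor bounds serve for `n = 6`, and `shifted_prod_le` handles `n ≥ 9`.
  rcases (by omega : n = 4 ∨ n = 6 ∨ n = 7 ∨ n = 8 ∨ 9 ≤ n) with rfl | rfl | rfl | rfl | h9
  · have hk : Sendov.k 4 = 1 := rfl
    have e1 : Sendov.u₁ 4 = (√5 - 1) / 4 := by
      have h : Sendov.u₁ 4 = Real.cos (2 * (Real.pi / 5)) := by
        rw [u₁_eq, θ₁, hk]; congr 1; push_cast; ring
      rw [h, Real.cos_two_mul, Real.cos_pi_div_five]
      nlinarith [Real.sq_sqrt (show (0 : ℝ) ≤ 5 by norm_num)]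
    have e2 : Sendov.u₂ 4 = -(1 + √5) / 4 := by
      have h : Sendov.u₂ 4 = -Real.cos (Real.pi / 5) := by
        rw [u₂_eq, θ₂, hk, ← Real.cos_pi_sub]; congr 1; push_cast; ring
      rw [h, Real.cos_pi_div_five]; ring
    rw [e1, e2]
    have := Real.sq_sqrt (show (0 : ℝ) ≤ 5 by norm_num)
    push_cast
    nlinarith
  · obtain ⟨b1, b2, b3⟩ := u_six_bounds
    push_cast
    set v := Sendov.u₁ 6 + 1 / 2
    set w := -1 / 2 - Sendov.u₂ 6 with hwdef
    have hw0 : 0 ≤ w := by linarith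
    have hp : v * w ≤ 0.2786 * 0.4126 := by gcongr
    have hd : w - v ≤ 0.1373 := by linarith
    have hd' : -0.3 ≤ w - v := by linarith
    have hp0 : 0 ≤ v * w := mul_nonneg (by linarith) hw0
    have hq : v * w + (w - v) / (2 * 6) ≤ 0.12640 := by linarith
    have := mul_le_mul_of_nonneg_right hq (by linarith : 0 ≤ 12 + 8 * (w - v))
    linarith
  · have hk : Sendov.k 7 = 2 := rfl
    have e1 : Sendov.u₁ 7 = 0 := by
      rw [u₁_eq, θ₁, hk, ← Real.cos_pi_div_two]; congr 1; push_cast; ring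
    have e2 : Sendov.u₂ 7 = -(√2 / 2) := by
      rw [u₂_eq, θ₂, hk, ← Real.cos_pi_div_four, ← Real.cos_pi_sub]; congr 1; push_cast; ring
    rw [e1, e2]
    have := Real.sq_sqrt (show (0 : ℝ) ≤ 2 by norm_num)
    have : √2 ≤ 1.415 := Real.sqrt_le_iff.mpr ⟨by norm_num, by norm_num⟩
    have : 1.414 ≤ √2 := Real.le_sqrt_of_sq_le (by norm_num)
    push_cast
    nlinarith
  · have hk : Sendov.k 8 = 3 := rfl
    have e1 : Sendov.u₁ 8 = -1 / 2 := by
      rw [u₁_eq, θ₁, hk, ← cos_two_pi_div_three]; congr 1; push_cast; ring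
    rw [e1]
    push_cast
    nlinarith
  · have hp := shifted_prod_le h9
    have hn' : (9 : ℝ) ≤ n := by exact_mod_cast h9
    set v := Sendov.u₁ n + 1 / 2 with hvdef
    set w := -1 / 2 - Sendov.u₂ n with hwdef
    have hv0 : 0 ≤ v := by linarith
    have hw0 : 0 ≤ w := by linarith
    have hw1 : w ≤ 1 / 2 := by linarith
    have hv1 : v ≤ 3 / 2 := by linarith [u₁_lt_one hn3]
    have hp0 : 0 ≤ v * w := mul_nonneg hv0 hw0
    have ht : 1 / (n : ℝ) ≤ 1 / 9 := one_div_le_one_div_of_le (by norm_num) hn'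
    have ht0 : 0 ≤ 1 / (n : ℝ) := by positivity
    rw [show (w - v) / (2 * (n : ℝ)) = (w - v) * (1 / n) / 2 by ring,
      show 4 * (v * w) / (n : ℝ) = 4 * (v * w) * (1 / n) by ring]
    set t := 1 / (n : ℝ)
    have h1 : (w - v) * t ≤ 1 / 18 := by nlinarith
    have h2 : (v * w + (w - v) * t / 2) * (12 + 8 * (w - v)) ≤ 0.11 * (12 + 8 * (w - v)) :=
      mul_le_mul_of_nonneg_right (by linarith) (by linarith)
    have h3 : 4 * (v * w) * t ≤ 4 * 0.08 * (1 / 9) := by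
      apply mul_le_mul _ ht ht0 (by norm_num)
      linarith
    linarith

theorem curv_five : curv 5 = 7 / 15 := by
  have hk : Sendov.k 5 = 2 := rfl
  have e1 : Sendov.u₁ 5 = -1 / 2 := by
    rw [u₁_eq, θ₁, hk, ← cos_two_pi_div_three]; congr 1; push_cast; ring
  have e2 : Sendov.u₂ 5 = -1 := by
    rw [u₂_eq, θ₂, hk, ← Real.cos_pi]; congr 1; push_cast; ring
  rw [curv, wt₁, wt₂, e1, e2]
  norm_num

open Filter Topology Asymptotics

/-! ### Calculus of orders in `s`. -/

section Order

variable {ι : Type*} {l : Filter ι} {s : ι → ℝ} {f g : ι → ℝ} {j k : ℕ}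

/-- `f = O(s ^ k)` along `l`. -/
def Ord (l : Filter ι) (s : ι → ℝ) (k : ℕ) (f : ι → ℝ) : Prop :=
  f =O[l] fun i => s i ^ k

theorem Ord.add (hf : Ord l s k f) (hg : Ord l s k g) : Ord l s k fun i => f i + g i :=
  IsBigO.add hf hg

theorem Ord.sub (hf : Ord l s k f) (hg : Ord l s k g) : Ord l s k fun i => f i - g i :=
  IsBigO.sub hf hg

theorem Ord.neg (hf : Ord l s k f) : Ord l s k fun i => -f i := IsBigO.neg_left hf

theorem Ord.const_mul (c : ℝ) (hf : Ord l s k f) : Ord l s k fun i => c * f i :=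
  IsBigO.const_mul_left hf c

theorem Ord.mul (hf : Ord l s j f) (hg : Ord l s k g) : Ord l s (j + k) fun i => f i * g i := by
  have := IsBigO.mul hf hg
  simpa only [Ord, pow_add] using this

theorem Ord.congr (hf : Ord l s k f) (h : ∀ i, f i = g i) : Ord l s k g := by
  have : f = g := funext h
  rwa [← this]

theorem Ord.mono (hs : Tendsto s l (𝓝 0)) (hf : Ord l s k f) (h : j ≤ k) : Ord l s j f := by
  refine IsBigO.trans hf ?_
  refine IsBigO.of_bound 1 ?_
  have h1 : ∀ᶠ i in l, |s i| < 1 := by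
    have := hs.abs
    rw [abs_zero] at this
    exact this.eventually_lt_const one_pos
  filter_upwards [h1] with i hi
  rw [one_mul, Real.norm_eq_abs, Real.norm_eq_abs, abs_pow, abs_pow]
  exact pow_le_pow_of_le_one (abs_nonneg _) hi.le h

theorem Ord.zero : Ord l s k fun _ => 0 := isBigO_zero _ _

theorem Ord.sum {κ : Type*} {t : Finset κ} {F : κ → ι → ℝ} (h : ∀ a ∈ t, Ord l s k (F a)) :
    Ord l s k fun i => ∑ a ∈ t, F a i := by
  exact Ord.congr (IsBigO.sum h) fun i => by simp

theorem Ord.self_pow (k : ℕ) : Ord l s k fun i => s i ^ k := isBigO_refl _ _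

theorem Ord.const (c : ℝ) : Ord l s 0 fun _ => c := by
  have := (Ord.self_pow (l := l) (s := s) 0).const_mul c
  exact this.congr fun i => by simp

theorem Ord.of_abs_le (hg : Ord l s k g) (h : ∀ᶠ i in l, |f i| ≤ |g i|) : Ord l s k f :=
  (IsBigO.of_bound 1 (by simpa using h)).trans hg

theorem Ord.exists_bound (hf : Ord l s k f) : ∃ C, 0 < C ∧ ∀ᶠ i in l, |f i| ≤ C * |s i| ^ k := by
  obtain ⟨C, hC, h⟩ := IsBigO.exists_pos hf
  exact ⟨C, hC, by simpa [IsBigOWith, abs_pow] using h⟩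

theorem Ord.of_bound (C : ℝ) (h : ∀ᶠ i in l, |f i| ≤ C * |s i| ^ k) : Ord l s k f :=
  IsBigO.of_bound C (by simpa [abs_pow] using h)

end Order

section Grade

variable {ι : Type*} {l : Filter ι} {s : ι → ℝ} {f g : ι → ℂ} {j k : ℕ}

/-- The size of a homogeneous form of degree `k` in complex numbers whose real parts are `O(s²)`
and whose imaginary parts are `O(s)`. -/
def Grade (l : Filter ι) (s : ι → ℝ) (k : ℕ) (f : ι → ℂ) : Prop :=
  Ord l s (2 * ((k + 1) / 2)) (fun i => (f i).re) ∧ Ord l s (2 * (k / 2) + 1) fun i => (f i).im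

theorem Grade.mul (hs : Tendsto s l (𝓝 0)) (hf : Grade l s j f) (hg : Grade l s k g) :
    Grade l s (j + k) fun i => f i * g i := by
  constructor
  · simp only [Complex.mul_re]
    exact ((hf.1.mul hg.1).mono hs (by omega)).sub ((hf.2.mul hg.2).mono hs (by omega))
  · simp only [Complex.mul_im]
    exact ((hf.1.mul hg.2).mono hs (by omega)).add ((hf.2.mul hg.1).mono hs (by omega))

theorem Grade.sum {κ : Type*} {t : Finset κ} {F : κ → ι → ℂ} (h : ∀ a ∈ t, Grade l s k (F a)) :
    Grade l s k fun i => ∑ a ∈ t, F a i := by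
  constructor
  · simp only [Complex.re_sum]; exact Ord.sum fun a ha => (h a ha).1
  · simp only [Complex.im_sum]; exact Ord.sum fun a ha => (h a ha).2

theorem Grade.one : Grade l s 0 fun _ => 1 :=
  ⟨by simpa using Ord.const 1, by simpa using Ord.zero⟩

theorem Grade.prod (hs : Tendsto s l (𝓝 0)) {κ : Type*} {t : Finset κ} {F : κ → ι → ℂ}
    (h : ∀ a ∈ t, Grade l s 1 (F a)) : Grade l s t.card fun i => ∏ a ∈ t, F a i := by
  classical
  induction t using Finset.induction_on with
  | empty => simpa using Grade.one
  | insert a t ha ih =>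
    rw [card_insert_of_notMem ha, add_comm]
    simp only [prod_insert ha]
    exact (h a (mem_insert_self a t)).mul hs (ih fun b hb => h b (mem_insert_of_mem hb))

theorem Grade.real_mul (c : ℝ) (hf : Grade l s k f) : Grade l s k fun i => (c : ℂ) * f i :=
  ⟨by simpa using hf.1.const_mul c, by simpa using hf.2.const_mul c⟩

theorem Grade.esym (hs : Tendsto s l (𝓝 0)) {n : ℕ} {ζ : ι → Fin n → ℂ}
    (h : ∀ a, Grade l s 1 fun i => ζ i a) (m : ℕ) : Grade l s m fun i => esym (ζ i) m := by
  unfold CritBound.esym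
  refine Grade.sum fun t ht => ?_
  rw [← (mem_powersetCard.mp ht).2]
  exact Grade.prod hs fun a _ => h a

theorem coef_eq_real_mul {n : ℕ} (ζ : Fin n → ℂ) (m : ℕ) :
    coef ζ m = (((-1) ^ m / ((n : ℝ) + 1 - m) : ℝ) : ℂ) * esym ζ m := by
  rw [coef]; push_cast; ring

theorem Grade.coef (hs : Tendsto s l (𝓝 0)) {n : ℕ} {ζ : ι → Fin n → ℂ}
    (h : ∀ a, Grade l s 1 fun i => ζ i a) (m : ℕ) : Grade l s m fun i => coef (ζ i) m := by
  simp only [coef_eq_real_mul]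
  exact (Grade.esym hs h m).real_mul _

end Grade

/-! ### Symmetric functions through power sums. -/

section Newton

variable {n : ℕ} (ζ : Fin n → ℂ)

theorem esym_eq_aeval (m : ℕ) : esym ζ m = MvPolynomial.aeval ζ (MvPolynomial.esymm (Fin n) ℂ m) := by
  simp [esym, MvPolynomial.esymm]

theorem newton_identity (k : ℕ) : (k : ℂ) * esym ζ k = (-1) ^ (k + 1) *
    ∑ a ∈ range k, (-1) ^ a * esym ζ a * ∑ i, ζ i ^ (k - a) := by
  have := congrArg (MvPolynomial.aeval ζ) (MvPolynomial.mul_esymm_eq_sum (Fin n) ℂ k)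
  rw [sum_filter, Finset.Nat.sum_antidiagonal_eq_sum_range_succ_mk, sum_range_succ] at this
  simp only [lt_irrefl, if_false, add_zero] at this
  rw [sum_congr rfl fun a ha => if_pos (mem_range.mp ha)] at this
  simpa [esym_eq_aeval, MvPolynomial.psum] using this

theorem esym_one : esym ζ 1 = ∑ i, ζ i := by
  have := newton_identity ζ 1
  simpa [esym_zero] using this

theorem esym_two : esym ζ 2 = ((∑ i, ζ i) ^ 2 - ∑ i, ζ i ^ 2) / 2 := by
  have := newton_identity ζ 2
  simp [sum_range_succ, esym_zero, esym_one] at this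
  linear_combination this / 2

theorem esym_three : esym ζ 3 =
    ((∑ i, ζ i) ^ 3 - 3 * (∑ i, ζ i) * ∑ i, ζ i ^ 2 + 2 * ∑ i, ζ i ^ 3) / 6 := by
  have := newton_identity ζ 3
  simp [sum_range_succ, esym_zero, esym_one, esym_two] at this
  linear_combination this / 3

theorem esym_four : esym ζ 4 =
    ((∑ i, ζ i) ^ 4 - 6 * (∑ i, ζ i) ^ 2 * ∑ i, ζ i ^ 2 + 3 * (∑ i, ζ i ^ 2) ^ 2 +
      8 * (∑ i, ζ i) * ∑ i, ζ i ^ 3 - 6 * ∑ i, ζ i ^ 4) / 24 := by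
  have := newton_identity ζ 4
  simp [sum_range_succ, esym_zero, esym_one, esym_two, esym_three] at this
  linear_combination this / 4

end Newton

/-! ### Even and odd parts of the boundary form in the angle. -/

section Trig

variable {n : ℕ}

/-- The real and imaginary parts of the trigonometric polynomial `gsum`, split by parity. -/
noncomputable def cosSum (ζ : Fin n → ℂ) (p : ℂ → ℝ) (e : ℕ) (θ : ℝ) : ℝ :=
  ∑ j ∈ range (n + 1), ((j : ℝ) + 1) ^ e * p (coef ζ (j + 1)) * Real.cos (((j : ℝ) + 1) * θ)

noncomputable def sinSum (ζ : Fin n → ℂ) (p : ℂ → ℝ) (e : ℕ) (θ : ℝ) : ℝ :=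
  ∑ j ∈ range (n + 1), ((j : ℝ) + 1) ^ e * p (coef ζ (j + 1)) * Real.sin (((j : ℝ) + 1) * θ)

theorem exp_pow_eq (θ : ℝ) (m : ℕ) : Complex.exp (-(θ * Complex.I)) ^ m =
    (Real.cos (m * θ) : ℂ) - (Real.sin (m * θ) : ℂ) * Complex.I := by
  rw [← Complex.exp_nat_mul, show (m : ℂ) * -(θ * Complex.I) = ((-(m * θ) : ℝ) : ℂ) * Complex.I by
    push_cast; ring, Complex.exp_mul_I, ← Complex.ofReal_cos, ← Complex.ofReal_sin, Real.cos_neg,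
    Real.sin_neg]
  push_cast; ring

theorem re_mul_sub_mul_I (A : ℂ) (c d : ℝ) :
    (A * ((c : ℂ) - (d : ℂ) * Complex.I)).re = A.re * c + A.im * d := by
  simp [Complex.mul_re]

theorem im_mul_sub_mul_I (A : ℂ) (c d : ℝ) :
    (A * ((c : ℂ) - (d : ℂ) * Complex.I)).im = A.im * c - A.re * d := by
  simp [Complex.mul_im]; ring

theorem gsum_exp_re (ζ : Fin n → ℂ) (b : ℂ) (θ : ℝ) :
    (gsum ζ b (Complex.exp (-(θ * Complex.I)))).re =
      ((constCoef ζ b).re + cosSum ζ Complex.re 0 θ) + sinSum ζ Complex.im 0 θ := by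
  rw [gsum, Complex.add_re, Complex.re_sum, cosSum, sinSum, add_assoc, ← sum_add_distrib]
  congr 1
  refine sum_congr rfl fun j _ => ?_
  rw [exp_pow_eq, re_mul_sub_mul_I]
  push_cast
  ring

theorem gsum_exp_im (ζ : Fin n → ℂ) (b : ℂ) (θ : ℝ) :
    (gsum ζ b (Complex.exp (-(θ * Complex.I)))).im =
      ((constCoef ζ b).im + cosSum ζ Complex.im 0 θ) - sinSum ζ Complex.re 0 θ := by
  rw [gsum, Complex.add_im, Complex.im_sum, cosSum, sinSum, add_sub_assoc, ← sum_sub_distrib]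
  congr 1
  refine sum_congr rfl fun j _ => ?_
  rw [exp_pow_eq, im_mul_sub_mul_I]
  push_cast
  ring

theorem hsum_exp_re (ζ : Fin n → ℂ) (θ : ℝ) :
    (hsum ζ (Complex.exp (-(θ * Complex.I)))).re =
      cosSum ζ Complex.re 1 θ + sinSum ζ Complex.im 1 θ := by
  rw [hsum, Complex.re_sum, cosSum, sinSum, ← sum_add_distrib]
  refine sum_congr rfl fun j _ => ?_
  rw [exp_pow_eq, show (j : ℂ) + 1 = (((j : ℝ) + 1 : ℝ) : ℂ) by push_cast; ring, re_mul_sub_mul_I,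
    Complex.re_ofReal_mul, Complex.im_ofReal_mul]
  push_cast
  ring

theorem hsum_exp_im (ζ : Fin n → ℂ) (θ : ℝ) :
    (hsum ζ (Complex.exp (-(θ * Complex.I)))).im =
      cosSum ζ Complex.im 1 θ - sinSum ζ Complex.re 1 θ := by
  rw [hsum, Complex.im_sum, cosSum, sinSum, ← sum_sub_distrib]
  refine sum_congr rfl fun j _ => ?_
  rw [exp_pow_eq, show (j : ℂ) + 1 = (((j : ℝ) + 1 : ℝ) : ℂ) by push_cast; ring, im_mul_sub_mul_I,
    Complex.re_ofReal_mul, Complex.im_ofReal_mul]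
  push_cast
  ring

theorem cosSum_neg (ζ : Fin n → ℂ) (p : ℂ → ℝ) (e : ℕ) (θ : ℝ) :
    cosSum ζ p e (-θ) = cosSum ζ p e θ := by
  simp [cosSum]

theorem sinSum_neg (ζ : Fin n → ℂ) (p : ℂ → ℝ) (e : ℕ) (θ : ℝ) :
    sinSum ζ p e (-θ) = -sinSum ζ p e θ := by
  simp [sinSum]

/-- The even part of the boundary form. -/
noncomputable def evenForm (ζ : Fin n → ℂ) (b : ℂ) (θ : ℝ) : ℝ :=
  let CR := (constCoef ζ b).re + cosSum ζ Complex.re 0 θ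
  let CI := (constCoef ζ b).im + cosSum ζ Complex.im 0 θ
  let SR := sinSum ζ Complex.re 0 θ
  let SI := sinSum ζ Complex.im 0 θ
  CR + ((n : ℝ) + 1) / 2 * (CR ^ 2 + SI ^ 2 + CI ^ 2 + SR ^ 2) -
    ((n : ℝ) + 1) * (CR * (constCoef ζ b).re + CI * (constCoef ζ b).im) -
    (CR * cosSum ζ Complex.re 1 θ + SI * sinSum ζ Complex.im 1 θ + CI * cosSum ζ Complex.im 1 θ +
      SR * sinSum ζ Complex.re 1 θ)

/-- The odd part of the boundary form. -/
noncomputable def oddForm (ζ : Fin n → ℂ) (b : ℂ) (θ : ℝ) : ℝ :=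
  let CR := (constCoef ζ b).re + cosSum ζ Complex.re 0 θ
  let CI := (constCoef ζ b).im + cosSum ζ Complex.im 0 θ
  let SR := sinSum ζ Complex.re 0 θ
  let SI := sinSum ζ Complex.im 0 θ
  SI + ((n : ℝ) + 1) * (CR * SI - CI * SR) -
    ((n : ℝ) + 1) * (SI * (constCoef ζ b).re - SR * (constCoef ζ b).im) -
    (CR * sinSum ζ Complex.im 1 θ + SI * cosSum ζ Complex.re 1 θ - CI * sinSum ζ Complex.re 1 θ -
      SR * cosSum ζ Complex.im 1 θ)

theorem boundary_form_eq (ζ : Fin n → ℂ) (b : ℂ) (θ : ℝ) :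
    ((starRingEnd ℂ) (gsum ζ b (Complex.exp (-(θ * Complex.I)))) *
      (1 + ((n : ℂ) + 1) / 2 * gsum ζ b (Complex.exp (-(θ * Complex.I))) -
        ((n : ℂ) + 1) * constCoef ζ b - hsum ζ (Complex.exp (-(θ * Complex.I))))).re =
      evenForm ζ b θ + oddForm ζ b θ := by
  have key : ∀ (G A H : ℂ), ((starRingEnd ℂ) G * (1 + ((n : ℂ) + 1) / 2 * G - ((n : ℂ) + 1) * A - H)).re =
      G.re + ((n : ℝ) + 1) / 2 * (G.re ^ 2 + G.im ^ 2) -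
        ((n : ℝ) + 1) * (G.re * A.re + G.im * A.im) - (G.re * H.re + G.im * H.im) := by
    intro G A H
    have e1 : ((n : ℂ) + 1) / 2 = ((((n : ℝ) + 1) / 2 : ℝ) : ℂ) := by push_cast; ring
    have e2 : ((n : ℂ) + 1) = (((n : ℝ) + 1 : ℝ) : ℂ) := by push_cast; ring
    rw [e1, e2]
    simp only [Complex.mul_re, Complex.conj_re, Complex.conj_im, Complex.sub_re, Complex.add_re,
      Complex.sub_im, Complex.add_im, Complex.mul_im, Complex.ofReal_re, Complex.ofReal_im,
      Complex.one_re, Complex.one_im]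
    ring
  rw [key, gsum_exp_re, gsum_exp_im, hsum_exp_re, hsum_exp_im, evenForm, oddForm]
  ring

theorem evenForm_neg (ζ : Fin n → ℂ) (b : ℂ) (θ : ℝ) : evenForm ζ b (-θ) = evenForm ζ b θ := by
  simp only [evenForm, cosSum_neg, sinSum_neg]; ring

theorem oddForm_neg (ζ : Fin n → ℂ) (b : ℂ) (θ : ℝ) : oddForm ζ b (-θ) = -oddForm ζ b θ := by
  simp only [oddForm, cosSum_neg, sinSum_neg]; ring

/-- Both `θ` and `-θ` give roots of unity; the inequalities there read `even ± odd ≥ 0`. -/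
theorem abs_oddForm_le {ζ : Fin n → ℂ} {b : ℂ}
    (h : ∀ w : ℂ, w ^ (n + 1) = 1 → 0 ≤ ((starRingEnd ℂ) (gsum ζ b w) *
      (1 + ((n : ℂ) + 1) / 2 * gsum ζ b w - ((n : ℂ) + 1) * constCoef ζ b - hsum ζ w)).re)
    {θ : ℝ} {m : ℤ} (hθ : ((n : ℝ) + 1) * θ = m * (2 * Real.pi)) :
    |oddForm ζ b θ| ≤ evenForm ζ b θ := by
  have hw : ∀ (x : ℝ) (q : ℤ), ((n : ℝ) + 1) * x = q * (2 * Real.pi) →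
      Complex.exp (-(x * Complex.I)) ^ (n + 1) = 1 := fun x q hx => by
    rw [← Complex.exp_nat_mul, Complex.exp_eq_one_iff]
    refine ⟨-q, ?_⟩
    have := congrArg (fun t : ℝ => (t : ℂ)) hx
    push_cast at this ⊢
    linear_combination -Complex.I * this
  have h1 := h _ (hw θ m hθ)
  have h2 := h _ (hw (-θ) (-m) (by push_cast; linarith))
  rw [boundary_form_eq] at h1 h2
  rw [evenForm_neg, oddForm_neg] at h2
  exact abs_le.mpr ⟨by linarith, by linarith⟩

end Trig

/-! ### Expansion of the boundary form in `s`. -/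

section Expansion

variable {ι : Type*} {l : Filter ι} {s : ι → ℝ} {n : ℕ} {ζ : ι → Fin n → ℂ} {k : ℕ}

theorem Ord.coef_re (hs : Tendsto s l (𝓝 0)) (hζ : ∀ a, Grade l s 1 fun i => ζ i a) {m : ℕ}
    (h : k ≤ 2 * ((m + 1) / 2)) : Ord l s k fun i => (coef (ζ i) m).re :=
  (Grade.coef hs hζ m).1.mono hs h

theorem Ord.coef_im (hs : Tendsto s l (𝓝 0)) (hζ : ∀ a, Grade l s 1 fun i => ζ i a) {m : ℕ}
    (h : k ≤ 2 * (m / 2) + 1) : Ord l s k fun i => (coef (ζ i) m).im :=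
  (Grade.coef hs hζ m).2.mono hs h

theorem Ord.mul_const {f : ι → ℝ} (hf : Ord l s k f) (c : ℝ) : Ord l s k fun i => f i * c :=
  (hf.const_mul c).congr fun _ => mul_comm _ _

theorem sum_range_split_four (hn : 3 ≤ n) (f : ℕ → ℝ) :
    ∑ j ∈ range (n + 1), f j = f 0 + f 1 + f 2 + f 3 + ∑ j ∈ range (n - 3), f (j + 4) := by
  obtain ⟨m, rfl⟩ := Nat.exists_eq_add_of_le' hn
  rw [sum_range_succ', sum_range_succ', sum_range_succ', sum_range_succ']
  simp only [Nat.add_sub_cancel, zero_add]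
  ring_nf

theorem Ord.cosSum_re (hs : Tendsto s l (𝓝 0)) (hζ : ∀ a, Grade l s 1 fun i => ζ i a) (e : ℕ)
    (θ : ℝ) : Ord l s 2 fun i => cosSum (ζ i) Complex.re e θ :=
  Ord.sum fun j _ => (((Ord.coef_re hs hζ (m := j + 1) (by omega)).const_mul _).mul_const _)

theorem Ord.sinSum_re (hs : Tendsto s l (𝓝 0)) (hζ : ∀ a, Grade l s 1 fun i => ζ i a) (e : ℕ)
    (θ : ℝ) : Ord l s 2 fun i => sinSum (ζ i) Complex.re e θ :=
  Ord.sum fun j _ => (((Ord.coef_re hs hζ (m := j + 1) (by omega)).const_mul _).mul_const _)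

theorem Ord.coef_im_succ (hs : Tendsto s l (𝓝 0)) (hζ : ∀ a, Grade l s 1 fun i => ζ i a)
    (hk : k ≤ 3) (h1 : Ord l s k fun i => (coef (ζ i) 1).im) (j : ℕ) :
    Ord l s k fun i => (coef (ζ i) (j + 1)).im := by
  cases j with
  | zero => exact h1
  | succ j => exact Ord.coef_im hs hζ (by omega)

theorem Ord.cosSum_im (hs : Tendsto s l (𝓝 0)) (hζ : ∀ a, Grade l s 1 fun i => ζ i a)
    (hk : k ≤ 3) (h1 : Ord l s k fun i => (coef (ζ i) 1).im) (e : ℕ) (θ : ℝ) :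
    Ord l s k fun i => cosSum (ζ i) Complex.im e θ :=
  Ord.sum fun j _ => (((Ord.coef_im_succ hs hζ hk h1 j).const_mul _).mul_const _)

theorem Ord.sinSum_im (hs : Tendsto s l (𝓝 0)) (hζ : ∀ a, Grade l s 1 fun i => ζ i a)
    (hk : k ≤ 3) (h1 : Ord l s k fun i => (coef (ζ i) 1).im) (e : ℕ) (θ : ℝ) :
    Ord l s k fun i => sinSum (ζ i) Complex.im e θ :=
  Ord.sum fun j _ => (((Ord.coef_im_succ hs hζ hk h1 j).const_mul _).mul_const _)

theorem Ord.one_sub_sq_pow (hs : Tendsto s l (𝓝 0)) (N : ℕ) : Ord l s 6 fun i =>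
    (1 - s i ^ 2) ^ N - (1 - N * s i ^ 2 + N * (N - 1) / 2 * s i ^ 4) := by
  induction N with
  | zero => exact Ord.zero.congr fun i => by simp
  | succ N ih =>
    have h1 := (ih.sub ((((Ord.self_pow 2).mul ih).mono hs (by norm_num : 6 ≤ 2 + 6)))).sub
      ((Ord.self_pow (l := l) (s := s) 6).const_mul (N * (N - 1) / 2))
    refine h1.congr fun i => ?_
    push_cast
    ring

theorem Ord.one_sub_sq_pow_linear (hs : Tendsto s l (𝓝 0)) (N : ℕ) : Ord l s 4 fun i =>
    (1 - s i ^ 2) ^ N - (1 - N * s i ^ 2) :=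
  (((Ord.one_sub_sq_pow hs N).mono hs (by norm_num : 4 ≤ 6)).add
    ((Ord.self_pow 4).const_mul (N * (N - 1) / 2 : ℝ))).congr fun i => by ring

theorem Ord.one_sub_sq_pow_sub_one (hs : Tendsto s l (𝓝 0)) (N : ℕ) : Ord l s 2 fun i =>
    (1 - s i ^ 2) ^ N - 1 :=
  (((Ord.one_sub_sq_pow_linear hs N).mono hs (by norm_num : 2 ≤ 4)).sub
    ((Ord.self_pow 2).const_mul (N : ℝ))).congr fun i => by ring

theorem Ord.one_sub_sq_pow_zero (hs : Tendsto s l (𝓝 0)) (N : ℕ) : Ord l s 0 fun i =>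
    (1 - s i ^ 2) ^ N :=
  (((Ord.one_sub_sq_pow_sub_one hs N).mono hs (by norm_num : 0 ≤ 2)).add
    (Ord.const 1)).congr fun i => by ring

theorem constCoef_re (z : Fin n → ℂ) (b : ℝ) : (constCoef z b).re =
    (1 - b ^ (n + 1)) / ((n : ℝ) + 1) - ∑ j ∈ range (n + 1), (coef z (j + 1)).re * b ^ (n - j) := by
  have e : (1 - (b : ℂ) ^ (n + 1)) / ((n : ℂ) + 1) = (((1 - b ^ (n + 1)) / ((n : ℝ) + 1) : ℝ) : ℂ) := by
    push_cast; rfl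
  rw [constCoef, e, Complex.sub_re, Complex.ofReal_re, Complex.re_sum]
  congr 1
  refine sum_congr rfl fun j _ => ?_
  rw [← Complex.ofReal_pow, Complex.re_mul_ofReal]

theorem constCoef_im (z : Fin n → ℂ) (b : ℝ) : (constCoef z b).im =
    -∑ j ∈ range (n + 1), (coef z (j + 1)).im * b ^ (n - j) := by
  have e : (1 - (b : ℂ) ^ (n + 1)) / ((n : ℂ) + 1) = (((1 - b ^ (n + 1)) / ((n : ℝ) + 1) : ℝ) : ℂ) := by
    push_cast; rfl
  rw [constCoef, e, Complex.sub_im, Complex.ofReal_im, Complex.im_sum, zero_sub]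
  congr 1
  refine sum_congr rfl fun j _ => ?_
  rw [← Complex.ofReal_pow, Complex.im_mul_ofReal]

/-- The point `β = 1 - s²`, as a complex number. -/
noncomputable def basePt (s : ι → ℝ) (i : ι) : ℂ := ((1 - s i ^ 2 : ℝ) : ℂ)

theorem Ord.constCoef_im (hs : Tendsto s l (𝓝 0)) (hζ : ∀ a, Grade l s 1 fun i => ζ i a)
    (hk : k ≤ 3) (h1 : Ord l s k fun i => (coef (ζ i) 1).im) :
    Ord l s k fun i => (constCoef (ζ i) (basePt s i)).im := by
  simp only [basePt, CritBound.constCoef_im]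
  exact (Ord.sum fun j _ => (Ord.coef_im_succ hs hζ hk h1 j).mul (Ord.one_sub_sq_pow_zero hs _)).neg

/-- First order form of the normalisation `P(β) = 0`. -/
theorem Ord.constCoef_re_first (hs : Tendsto s l (𝓝 0)) (hζ : ∀ a, Grade l s 1 fun i => ζ i a)
    (hn : 3 ≤ n) : Ord l s 6 fun i => (constCoef (ζ i) (basePt s i)).re + (coef (ζ i) 1).re +
      (coef (ζ i) 2).re + (coef (ζ i) 3).re + (coef (ζ i) 4).re -
      (s i ^ 2 - n / 2 * s i ^ 4 + n * s i ^ 2 * (coef (ζ i) 1).re +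
        (n - 1) * s i ^ 2 * (coef (ζ i) 2).re) := by
  have hn1 : ((n - 1 : ℕ) : ℝ) = n - 1 := by rw [Nat.cast_sub (by omega)]; norm_num
  have h0 := (Ord.one_sub_sq_pow hs (n + 1)).const_mul (-1 / ((n : ℝ) + 1))
  have h1 := (Ord.coef_re hs hζ (m := 1) (k := 2) (by norm_num)).mul (Ord.one_sub_sq_pow_linear hs n)
  have h2 := (Ord.coef_re hs hζ (m := 2) (k := 2) (by norm_num)).mul
    (Ord.one_sub_sq_pow_linear hs (n - 1))
  have h3 := (Ord.coef_re hs hζ (m := 3) (k := 4) (by norm_num)).mul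
    (Ord.one_sub_sq_pow_sub_one hs (n - 2))
  have h4 := (Ord.coef_re hs hζ (m := 4) (k := 4) (by norm_num)).mul
    (Ord.one_sub_sq_pow_sub_one hs (n - 3))
  have h5 : Ord l s 6 fun i => ∑ j ∈ range (n - 3),
      (coef (ζ i) (j + 4 + 1)).re * (1 - s i ^ 2) ^ (n - (j + 4)) :=
    Ord.sum fun j _ => (Ord.coef_re hs hζ (k := 6) (by omega)).mul (Ord.one_sub_sq_pow_zero hs _)
  refine (((((h0.sub h1).sub h2).sub h3).sub h4).sub h5).congr fun i => ?_
  rw [basePt, CritBound.constCoef_re, sum_range_split_four hn, hn1]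
  have : (n : ℝ) + 1 ≠ 0 := by positivity
  simp only [Nat.sub_zero, zero_add]
  push_cast
  field_simp
  ring

theorem Ord.constCoef_re_sum (hs : Tendsto s l (𝓝 0)) (hζ : ∀ a, Grade l s 1 fun i => ζ i a)
    (hn : 3 ≤ n) : Ord l s 4 fun i => (constCoef (ζ i) (basePt s i)).re + (coef (ζ i) 1).re +
      (coef (ζ i) 2).re - s i ^ 2 := by
  have h := (Ord.constCoef_re_first hs hζ hn).mono hs (by norm_num : 4 ≤ 6)
  have h1 := ((Ord.self_pow (l := l) (s := s) 2).mul
    (Ord.coef_re hs hζ (m := 1) (k := 2) (by norm_num))).const_mul (n : ℝ)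
  have h2 := ((Ord.self_pow (l := l) (s := s) 2).mul
    (Ord.coef_re hs hζ (m := 2) (k := 2) (by norm_num))).const_mul ((n : ℝ) - 1)
  have h3 := Ord.coef_re hs hζ (m := 3) (k := 4) (by norm_num)
  have h4 := Ord.coef_re hs hζ (m := 4) (k := 4) (by norm_num)
  exact (((((h.sub h3).sub h4).add h1).add h2).sub
    ((Ord.self_pow (l := l) (s := s) 4).const_mul (n / 2 : ℝ))).congr fun i => by ring

theorem Ord.constCoef_re_two (hs : Tendsto s l (𝓝 0)) (hζ : ∀ a, Grade l s 1 fun i => ζ i a)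
    (hn : 3 ≤ n) : Ord l s 2 fun i => (constCoef (ζ i) (basePt s i)).re := by
  have h := (Ord.constCoef_re_sum hs hζ hn).mono hs (by norm_num : 2 ≤ 4)
  have h1 := Ord.coef_re hs hζ (m := 1) (k := 2) (by norm_num)
  have h2 := Ord.coef_re hs hζ (m := 2) (k := 2) (by norm_num)
  exact (((h.sub h1).sub h2).add (Ord.self_pow 2)).congr fun i => by ring

/-- Every remaining term pairs an imaginary sum with a real one of order `s²`. The exponent `k` is
left free so that improved bounds on `Im (coef 1)` can be fed back. -/
theorem Ord.oddForm_sub (hs : Tendsto s l (𝓝 0)) (hζ : ∀ a, Grade l s 1 fun i => ζ i a)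
    (hn : 3 ≤ n) (hk : k ≤ 3) (h1 : Ord l s k fun i => (coef (ζ i) 1).im) (θ : ℝ) :
    Ord l s (2 + k) fun i => oddForm (ζ i) (basePt s i) θ - sinSum (ζ i) Complex.im 0 θ := by
  have r0 := Ord.constCoef_re_two hs hζ hn
  have i0 := Ord.constCoef_im hs hζ hk h1
  have CR := r0.add (Ord.cosSum_re hs hζ 0 θ)
  have CI := i0.add (Ord.cosSum_im hs hζ hk h1 0 θ)
  have SR := Ord.sinSum_re hs hζ 0 θ
  have SI := Ord.sinSum_im hs hζ hk h1 0 θ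
  have CR' := Ord.cosSum_re hs hζ 1 θ
  have CI' := Ord.cosSum_im hs hζ hk h1 1 θ
  have SR' := Ord.sinSum_re hs hζ 1 θ
  have SI' := Ord.sinSum_im hs hζ hk h1 1 θ
  have t1 := ((CR.mul SI).sub (SR.mul CI)).const_mul ((n : ℝ) + 1)
  have t2 := ((r0.mul SI).sub (SR.mul i0)).const_mul ((n : ℝ) + 1)
  have t3 := (((CR.mul SI').add (CR'.mul SI)).sub (SR'.mul CI)).sub (SR.mul CI')
  exact ((t1.sub t2).sub t3).congr fun i => by simp only [oddForm]; ring

/-- Imaginary parts enter the even form only through products of two of them. -/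
theorem Ord.evenForm_sub (hs : Tendsto s l (𝓝 0)) (hζ : ∀ a, Grade l s 1 fun i => ζ i a)
    (hk : k ≤ 3) (h1 : Ord l s k fun i => (coef (ζ i) 1).im) (θ : ℝ) :
    Ord l s (k + k) fun i => evenForm (ζ i) (basePt s i) θ -
      (((constCoef (ζ i) (basePt s i)).re + cosSum (ζ i) Complex.re 0 θ) +
        ((constCoef (ζ i) (basePt s i)).re + cosSum (ζ i) Complex.re 0 θ) *
          (((n : ℝ) + 1) / 2 * ((constCoef (ζ i) (basePt s i)).re + cosSum (ζ i) Complex.re 0 θ) -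
            ((n : ℝ) + 1) * (constCoef (ζ i) (basePt s i)).re - cosSum (ζ i) Complex.re 1 θ) +
        sinSum (ζ i) Complex.re 0 θ *
          (((n : ℝ) + 1) / 2 * sinSum (ζ i) Complex.re 0 θ - sinSum (ζ i) Complex.re 1 θ)) := by
  have i0 := Ord.constCoef_im hs hζ hk h1
  have CI := i0.add (Ord.cosSum_im hs hζ hk h1 0 θ)
  have SI := Ord.sinSum_im hs hζ hk h1 0 θ
  have CI' := Ord.cosSum_im hs hζ hk h1 1 θ
  have SI' := Ord.sinSum_im hs hζ hk h1 1 θ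
  have t1 := ((SI.mul SI).add (CI.mul CI)).const_mul (((n : ℝ) + 1) / 2)
  have t2 := (CI.mul i0).const_mul ((n : ℝ) + 1)
  have t3 := (SI.mul SI').add (CI.mul CI')
  exact ((t1.sub t2).sub t3).congr fun i => by simp only [evenForm]; ring

theorem Ord.evenForm_sub_quadratic (hs : Tendsto s l (𝓝 0))
    (hζ : ∀ a, Grade l s 1 fun i => ζ i a) (hn : 3 ≤ n) {j : ℕ} (hj : j ≤ 4) (hjk : j ≤ k + k)
    (hk : k ≤ 3) (h1 : Ord l s k fun i => (coef (ζ i) 1).im) (θ : ℝ) :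
    Ord l s j fun i => evenForm (ζ i) (basePt s i) θ -
      ((constCoef (ζ i) (basePt s i)).re + cosSum (ζ i) Complex.re 0 θ) := by
  have r0 := Ord.constCoef_re_two hs hζ hn
  have CR := r0.add (Ord.cosSum_re hs hζ 0 θ)
  have SR := Ord.sinSum_re hs hζ 0 θ
  have CR' := Ord.cosSum_re hs hζ 1 θ
  have SR' := Ord.sinSum_re hs hζ 1 θ
  have t1 := CR.mul (((CR.const_mul (((n : ℝ) + 1) / 2)).sub (r0.const_mul ((n : ℝ) + 1))).sub CR')
  have t2 := SR.mul ((SR.const_mul (((n : ℝ) + 1) / 2)).sub SR')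
  have t3 := (Ord.evenForm_sub hs hζ hk h1 θ).mono hs hjk
  exact (t3.add ((t1.add t2).mono hs hj)).congr fun i => by ring

theorem Ord.sinSum_im_sub (hs : Tendsto s l (𝓝 0)) (hζ : ∀ a, Grade l s 1 fun i => ζ i a)
    (hn : 3 ≤ n) (θ : ℝ) : Ord l s 5 fun i => sinSum (ζ i) Complex.im 0 θ -
      ((coef (ζ i) 1).im * Real.sin θ + (coef (ζ i) 2).im * Real.sin (2 * θ) +
        (coef (ζ i) 3).im * Real.sin (3 * θ)) := by
  have h4 := (Ord.coef_im hs hζ (m := 4) (k := 5) (by norm_num)).mul_const (Real.sin (4 * θ))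
  have h5 : Ord l s 5 fun i => ∑ j ∈ range (n - 3),
      ((j + 4 : ℕ) + 1 : ℝ) ^ 0 * (coef (ζ i) (j + 4 + 1)).im * Real.sin (((j + 4 : ℕ) + 1 : ℝ) * θ) :=
    Ord.sum fun j _ => ((Ord.coef_im hs hζ (k := 5) (by omega)).const_mul _).mul_const _
  refine (h4.add h5).congr fun i => ?_
  rw [sinSum, sum_range_split_four hn]
  push_cast
  norm_num
  ring

theorem Ord.cosSum_re_sub (hs : Tendsto s l (𝓝 0)) (hζ : ∀ a, Grade l s 1 fun i => ζ i a)
    (hn : 3 ≤ n) (θ : ℝ) : Ord l s 6 fun i => cosSum (ζ i) Complex.re 0 θ -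
      ((coef (ζ i) 1).re * Real.cos θ + (coef (ζ i) 2).re * Real.cos (2 * θ) +
        (coef (ζ i) 3).re * Real.cos (3 * θ) + (coef (ζ i) 4).re * Real.cos (4 * θ)) := by
  have h5 : Ord l s 6 fun i => ∑ j ∈ range (n - 3),
      ((j + 4 : ℕ) + 1 : ℝ) ^ 0 * (coef (ζ i) (j + 4 + 1)).re * Real.cos (((j + 4 : ℕ) + 1 : ℝ) * θ) :=
    Ord.sum fun j _ => ((Ord.coef_re hs hζ (k := 6) (by omega)).const_mul _).mul_const _
  refine h5.congr fun i => ?_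
  rw [cosSum, sum_range_split_four hn]
  push_cast
  norm_num

theorem Ord.sinSum_re_sub (hs : Tendsto s l (𝓝 0)) (hζ : ∀ a, Grade l s 1 fun i => ζ i a)
    (hn : 3 ≤ n) (e : ℕ) (θ : ℝ) : Ord l s 4 fun i => sinSum (ζ i) Complex.re e θ -
      ((coef (ζ i) 1).re * Real.sin θ + 2 ^ e * (coef (ζ i) 2).re * Real.sin (2 * θ)) := by
  have h3 := ((Ord.coef_re hs hζ (m := 3) (k := 4) (by norm_num)).mul_const (Real.sin (3 * θ))).const_mul (3 ^ e)
  have h4 := ((Ord.coef_re hs hζ (m := 4) (k := 4) (by norm_num)).mul_const (Real.sin (4 * θ))).const_mul (4 ^ e)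
  have h5 : Ord l s 4 fun i => ∑ j ∈ range (n - 3),
      ((j + 4 : ℕ) + 1 : ℝ) ^ e * (coef (ζ i) (j + 4 + 1)).re * Real.sin (((j + 4 : ℕ) + 1 : ℝ) * θ) :=
    Ord.sum fun j _ => ((Ord.coef_re hs hζ (k := 4) (by omega)).const_mul _).mul_const _
  refine ((h3.add h4).add h5).congr fun i => ?_
  rw [sinSum, sum_range_split_four hn]
  push_cast
  norm_num
  ring

end Expansion

/-! ### Real moments of the critical points. -/

section Moments

variable {ι : Type*} {l : Filter ι} {s : ι → ℝ} {n : ℕ} {ζ : ι → Fin n → ℂ} {k : ℕ}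

noncomputable def mom (z : Fin n → ℂ) (a b : ℕ) : ℝ := ∑ i, (z i).re ^ a * (z i).im ^ b

theorem Ord.pow {f : ι → ℝ} (hf : Ord l s k f) (m : ℕ) : Ord l s (k * m) fun i => f i ^ m := by
  have := IsBigO.pow hf m
  simpa only [Ord, ← pow_mul] using this

theorem Ord.mom (hζ : ∀ a, Grade l s 1 fun i => ζ i a) (a b : ℕ) :
    Ord l s (2 * a + b) fun i => mom (ζ i) a b :=
  Ord.sum fun c _ => by
    have h1 := (hζ c).1.pow a
    have h2 := (hζ c).2.pow b
    exact (show Ord l s (2 * a) _ from h1).mul (show Ord l s b _ by simpa using h2)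

theorem sum_re (z : Fin n → ℂ) : (∑ i, z i).re = mom z 1 0 := by simp [mom]

theorem sum_im (z : Fin n → ℂ) : (∑ i, z i).im = mom z 0 1 := by simp [mom]

theorem sum_sq_re (z : Fin n → ℂ) : (∑ i, z i ^ 2).re = mom z 2 0 - mom z 0 2 := by
  rw [Complex.re_sum, mom, mom, ← sum_sub_distrib]
  refine sum_congr rfl fun i _ => ?_
  simp [pow_succ, Complex.mul_re]

theorem sum_sq_im (z : Fin n → ℂ) : (∑ i, z i ^ 2).im = 2 * mom z 1 1 := by
  rw [Complex.im_sum, mom, mul_sum]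
  refine sum_congr rfl fun i _ => ?_
  simp [pow_succ, Complex.mul_im]; ring

theorem sum_cube_re (z : Fin n → ℂ) : (∑ i, z i ^ 3).re = mom z 3 0 - 3 * mom z 1 2 := by
  rw [Complex.re_sum, mom, mom, mul_sum, ← sum_sub_distrib]
  refine sum_congr rfl fun i _ => ?_
  simp [pow_succ, Complex.mul_re, Complex.mul_im]; ring

theorem sum_cube_im (z : Fin n → ℂ) : (∑ i, z i ^ 3).im = 3 * mom z 2 1 - mom z 0 3 := by
  rw [Complex.im_sum, mom, mom, mul_sum, ← sum_sub_distrib]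
  refine sum_congr rfl fun i _ => ?_
  simp [pow_succ, Complex.mul_re, Complex.mul_im]; ring

theorem sum_four_re (z : Fin n → ℂ) :
    (∑ i, z i ^ 4).re = mom z 4 0 - 6 * mom z 2 2 + mom z 0 4 := by
  rw [Complex.re_sum, mom, mom, mom, mul_sum, ← sum_sub_distrib, ← sum_add_distrib]
  refine sum_congr rfl fun i _ => ?_
  simp [pow_succ, Complex.mul_re, Complex.mul_im]; ring

theorem esym_two_re (z : Fin n → ℂ) :
    (esym z 2).re = (mom z 1 0 ^ 2 - mom z 0 1 ^ 2 - mom z 2 0 + mom z 0 2) / 2 := by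
  rw [esym_two, show (2 : ℂ) = ((2 : ℝ) : ℂ) by norm_num, Complex.div_ofReal_re]
  rw [Complex.sub_re, sum_sq_re, pow_two, Complex.mul_re, sum_re, sum_im]
  ring

theorem esym_two_im (z : Fin n → ℂ) : (esym z 2).im = mom z 1 0 * mom z 0 1 - mom z 1 1 := by
  rw [esym_two, show (2 : ℂ) = ((2 : ℝ) : ℂ) by norm_num, Complex.div_ofReal_im]
  rw [Complex.sub_im, sum_sq_im, pow_two, Complex.mul_im, sum_re, sum_im]
  ring

theorem esym_three_eq (z : Fin n → ℂ) : esym z 3 =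
    ((1 / 6 : ℝ) : ℂ) * (∑ i, z i) ^ 3 - ((1 / 2 : ℝ) : ℂ) * ((∑ i, z i) * ∑ i, z i ^ 2) +
      ((1 / 3 : ℝ) : ℂ) * ∑ i, z i ^ 3 := by
  rw [esym_three]; push_cast; ring

theorem esym_four_eq (z : Fin n → ℂ) : esym z 4 =
    ((1 / 24 : ℝ) : ℂ) * (∑ i, z i) ^ 4 - ((1 / 4 : ℝ) : ℂ) * ((∑ i, z i) ^ 2 * ∑ i, z i ^ 2) +
      ((1 / 8 : ℝ) : ℂ) * (∑ i, z i ^ 2) ^ 2 + ((1 / 3 : ℝ) : ℂ) * ((∑ i, z i) * ∑ i, z i ^ 3) -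
      ((1 / 4 : ℝ) : ℂ) * ∑ i, z i ^ 4 := by
  rw [esym_four]; push_cast; ring

theorem esym_three_re (z : Fin n → ℂ) : (esym z 3).re =
    1 / 6 * (mom z 1 0 ^ 3 - 3 * mom z 1 0 * mom z 0 1 ^ 2) -
      1 / 2 * (mom z 1 0 * (mom z 2 0 - mom z 0 2) - mom z 0 1 * (2 * mom z 1 1)) +
      1 / 3 * (mom z 3 0 - 3 * mom z 1 2) := by
  rw [esym_three_eq, Complex.add_re, Complex.sub_re, Complex.re_ofReal_mul, Complex.re_ofReal_mul,
    Complex.re_ofReal_mul, sum_cube_re, Complex.mul_re (∑ i, z i), sum_sq_re, sum_sq_im]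
  simp only [pow_succ, pow_zero, one_mul, Complex.mul_re, Complex.mul_im, sum_re, sum_im]
  ring

theorem esym_three_im (z : Fin n → ℂ) : (esym z 3).im =
    1 / 6 * (3 * mom z 1 0 ^ 2 * mom z 0 1 - mom z 0 1 ^ 3) -
      1 / 2 * (mom z 1 0 * (2 * mom z 1 1) + mom z 0 1 * (mom z 2 0 - mom z 0 2)) +
      1 / 3 * (3 * mom z 2 1 - mom z 0 3) := by
  rw [esym_three_eq, Complex.add_im, Complex.sub_im, Complex.im_ofReal_mul, Complex.im_ofReal_mul,
    Complex.im_ofReal_mul, sum_cube_im, Complex.mul_im (∑ i, z i), sum_sq_re, sum_sq_im]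
  simp only [pow_succ, pow_zero, one_mul, Complex.mul_re, Complex.mul_im, sum_re, sum_im]
  ring

theorem esym_four_re (z : Fin n → ℂ) : (esym z 4).re =
    1 / 24 * (mom z 1 0 ^ 4 - 6 * mom z 1 0 ^ 2 * mom z 0 1 ^ 2 + mom z 0 1 ^ 4) -
      1 / 4 * ((mom z 1 0 ^ 2 - mom z 0 1 ^ 2) * (mom z 2 0 - mom z 0 2) -
        2 * mom z 1 0 * mom z 0 1 * (2 * mom z 1 1)) +
      1 / 8 * ((mom z 2 0 - mom z 0 2) ^ 2 - (2 * mom z 1 1) ^ 2) +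
      1 / 3 * (mom z 1 0 * (mom z 3 0 - 3 * mom z 1 2) -
        mom z 0 1 * (3 * mom z 2 1 - mom z 0 3)) -
      1 / 4 * (mom z 4 0 - 6 * mom z 2 2 + mom z 0 4) := by
  have h2 : ((∑ i, z i) ^ 2).re = mom z 1 0 ^ 2 - mom z 0 1 ^ 2 := by
    rw [pow_two, Complex.mul_re, sum_re, sum_im]; ring
  have h2' : ((∑ i, z i) ^ 2).im = 2 * mom z 1 0 * mom z 0 1 := by
    rw [pow_two, Complex.mul_im, sum_re, sum_im]; ring
  have h4 : ((∑ i, z i) ^ 4).re =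
      mom z 1 0 ^ 4 - 6 * mom z 1 0 ^ 2 * mom z 0 1 ^ 2 + mom z 0 1 ^ 4 := by
    rw [show (∑ i, z i) ^ 4 = (∑ i, z i) ^ 2 * (∑ i, z i) ^ 2 by ring, Complex.mul_re, h2, h2']; ring
  have hq : ((∑ i, z i ^ 2) ^ 2).re = (mom z 2 0 - mom z 0 2) ^ 2 - (2 * mom z 1 1) ^ 2 := by
    rw [pow_two (∑ i, z i ^ 2), Complex.mul_re, sum_sq_re, sum_sq_im]; ring
  rw [esym_four_eq, Complex.sub_re, Complex.add_re, Complex.add_re, Complex.sub_re]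
  simp only [Complex.re_ofReal_mul]
  rw [h4, hq, Complex.mul_re ((∑ i, z i) ^ 2), h2, h2', Complex.mul_re (∑ i, z i), sum_four_re,
    sum_sq_re, sum_sq_im, sum_cube_re, sum_cube_im, sum_re, sum_im]

/-- Once the sum of the imaginary parts is `O(s³)`, every product containing it is negligible;
counting `2a + b` for each moment discards the others. -/
theorem Ord.esym_three_re (hs : Tendsto s l (𝓝 0)) (hζ : ∀ a, Grade l s 1 fun i => ζ i a)
    (hJ : Ord l s 3 fun i => CritBound.mom (ζ i) 0 1) : Ord l s 6 fun i => (esym (ζ i) 3).re -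
      (1 / 2 * CritBound.mom (ζ i) 1 0 * CritBound.mom (ζ i) 0 2 - CritBound.mom (ζ i) 1 2) := by
  have M := Ord.mom hζ
  have t1 := ((M 1 0).pow 3).const_mul (1 / 6)
  have t2 := (((M 1 0).mul (hJ.pow 2)).mono hs (by norm_num : 6 ≤ _)).const_mul (1 / 2)
  have t3 := ((M 1 0).mul (M 2 0)).const_mul (1 / 2)
  have t4 := (hJ.mul (M 1 1))
  have t5 := (M 3 0).const_mul (1 / 3)
  exact ((((t1.sub t2).sub t3).add t4).add t5).congr fun i => by rw [CritBound.esym_three_re]; ring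

theorem Ord.esym_three_im (hs : Tendsto s l (𝓝 0)) (hζ : ∀ a, Grade l s 1 fun i => ζ i a)
    (hJ : Ord l s 3 fun i => CritBound.mom (ζ i) 0 1) : Ord l s 5 fun i => (esym (ζ i) 3).im +
      CritBound.mom (ζ i) 0 3 / 3 := by
  have M := Ord.mom hζ
  have t1 := (((M 1 0).pow 2).mul hJ).const_mul (1 / 2)
  have t2 := (hJ.pow 3).const_mul (1 / 6)
  have t3 := (M 1 0).mul (M 1 1)
  have t4 := (hJ.mul (M 2 0)).const_mul (1 / 2)
  have t5 := (hJ.mul (M 0 2)).const_mul (1 / 2)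
  have t6 := M 2 1
  exact (((((t1.mono hs (by norm_num : 5 ≤ _)).sub (t2.mono hs (by norm_num : 5 ≤ _))).sub
    (t3.mono hs (by norm_num : 5 ≤ _))).sub (t4.mono hs (by norm_num : 5 ≤ _))).add t5).add t6
    |>.congr fun i => by rw [CritBound.esym_three_im]; ring

theorem Ord.esym_four_re (hs : Tendsto s l (𝓝 0)) (hζ : ∀ a, Grade l s 1 fun i => ζ i a)
    (hJ : Ord l s 3 fun i => CritBound.mom (ζ i) 0 1) : Ord l s 6 fun i => (esym (ζ i) 4).re -
      (CritBound.mom (ζ i) 0 2 ^ 2 - 2 * CritBound.mom (ζ i) 0 4) / 8 := by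
  have M := Ord.mom hζ
  have X := M 1 0
  have up : ∀ {f : ι → ℝ} {m : ℕ}, 6 ≤ m → Ord l s m f → Ord l s 6 f := fun h hf => hf.mono hs h
  have t1 := up (by norm_num) ((X.pow 4).const_mul (1 / 24))
  have t2 := up (by norm_num) (((X.pow 2).mul (hJ.pow 2)).const_mul (1 / 4))
  have t3 := up (by norm_num) ((hJ.pow 4).const_mul (1 / 24))
  have t4 := up (by norm_num) ((((X.pow 2).sub ((hJ.pow 2).mono hs (by norm_num : 2 * 2 ≤ _))).mul
    (((M 2 0).mono hs (by norm_num : 2 ≤ _)).sub (M 0 2))).const_mul (1 / 4))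
  have t5 := up (by norm_num) ((X.mul hJ).mul (M 1 1))
  have t6 := up (by norm_num) (((M 2 0).pow 2).const_mul (1 / 8))
  have t7 := up (by norm_num) (((M 2 0).mul (M 0 2)).const_mul (1 / 4))
  have t8 := up (by norm_num) (((M 1 1).pow 2).const_mul (1 / 2))
  have t9 := up (by norm_num) ((X.mul (((M 3 0).mono hs (by norm_num : 4 ≤ _)).sub
    ((M 1 2).const_mul 3))).const_mul (1 / 3))
  have t10 := up (by norm_num) ((hJ.mul ((((M 2 1).const_mul 3).mono hs (by norm_num : 3 ≤ _)).sub
    (M 0 3))).const_mul (1 / 3))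
  have t11 := up (by norm_num) ((M 4 0).const_mul (1 / 4))
  have t12 := up (by norm_num) ((M 2 2).const_mul (3 / 2))
  exact (((((((((((t1.sub t2).add t3).sub t4).add t5).add t6).sub t7).sub t8).add t9).sub
    t10).sub t11).add t12) |>.congr fun i => by rw [CritBound.esym_four_re]; ring

theorem coef_one_re (z : Fin n → ℂ) : (coef z 1).re = -mom z 1 0 / n := by
  rw [coef_eq_real_mul, Complex.re_ofReal_mul, esym_one, sum_re]; push_cast; ring

theorem coef_one_im (z : Fin n → ℂ) : (coef z 1).im = -mom z 0 1 / n := by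
  rw [coef_eq_real_mul, Complex.im_ofReal_mul, esym_one, sum_im]; push_cast; ring

theorem natCast_add_one_sub_two (n : ℕ) : (n : ℝ) + 1 - (2 : ℕ) = n - 1 := by push_cast; ring

theorem natCast_add_one_sub_three (n : ℕ) : (n : ℝ) + 1 - (3 : ℕ) = n - 2 := by push_cast; ring

theorem natCast_add_one_sub_four (n : ℕ) : (n : ℝ) + 1 - (4 : ℕ) = n - 3 := by push_cast; ring

theorem coef_two_re (z : Fin n → ℂ) : (coef z 2).re = (esym z 2).re / ((n : ℝ) - 1) := by
  rw [coef_eq_real_mul, Complex.re_ofReal_mul, natCast_add_one_sub_two]; ring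

theorem coef_two_im (z : Fin n → ℂ) : (coef z 2).im = (esym z 2).im / ((n : ℝ) - 1) := by
  rw [coef_eq_real_mul, Complex.im_ofReal_mul, natCast_add_one_sub_two]; ring

theorem coef_three_re (z : Fin n → ℂ) : (coef z 3).re = -(esym z 3).re / ((n : ℝ) - 2) := by
  rw [coef_eq_real_mul, Complex.re_ofReal_mul, natCast_add_one_sub_three]; ring

theorem coef_three_im (z : Fin n → ℂ) : (coef z 3).im = -(esym z 3).im / ((n : ℝ) - 2) := by
  rw [coef_eq_real_mul, Complex.im_ofReal_mul, natCast_add_one_sub_three]; ring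

theorem coef_four_re (z : Fin n → ℂ) : (coef z 4).re = (esym z 4).re / ((n : ℝ) - 3) := by
  rw [coef_eq_real_mul, Complex.re_ofReal_mul, natCast_add_one_sub_four]; ring

end Moments

/-! ### Extremal configurations and the first bound on the sum of imaginary parts. -/

section FirstOrder

variable {ι : Type*} {l : Filter ι} {s r : ι → ℝ} {n : ℕ} {ζ : ι → Fin n → ℂ} {c : ℝ}

theorem Ord.of_nonneg_add {k : ℕ} {f g : ι → ℝ} (hf : ∀ i, 0 ≤ f i) (hg : ∀ i, 0 ≤ g i)
    (h : Ord l s k fun i => f i + g i) : Ord l s k f :=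
  h.of_abs_le (Eventually.of_forall fun i => by
    rw [abs_of_nonneg (hf i), abs_of_nonneg (add_nonneg (hf i) (hg i))]; linarith [hg i])

theorem Ord.of_mul_const {k : ℕ} {f : ι → ℝ} {a : ℝ} (ha : a ≠ 0)
    (h : Ord l s k fun i => f i * a) : Ord l s k f :=
  (h.mul_const a⁻¹).congr fun i => by field_simp

/-- The critical points of a family of polynomials with roots in the closed unit disk, one of
them at `1 - s²`, whose distance `r` to the nearest critical point is nearly extremal. -/
structure Config (l : Filter ι) (s r : ι → ℝ) (ζ : ι → Fin n → ℂ) (c : ℝ) : Prop where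
  three_le : 3 ≤ n
  tendsto : Tendsto s l (𝓝 0)
  r_nonneg : ∀ i, 0 ≤ r i
  crit : ∀ i a, r i ≤ ‖basePt s i - ζ i a‖
  bdry : ∀ i, ∀ w : ℂ, w ^ (n + 1) = 1 → 0 ≤ ((starRingEnd ℂ) (gsum (ζ i) (basePt s i) w) *
      (1 + ((n : ℂ) + 1) / 2 * gsum (ζ i) (basePt s i) w - ((n : ℂ) + 1) * constCoef (ζ i) (basePt s i) -
        hsum (ζ i) w)).re
  grade : ∀ a, Grade l s 1 fun i => ζ i a
  low : ∀ i, 1 + (Sendov.D₁ n + Sendov.D₂ n / n) * s i ^ 2 + c * s i ^ 4 ≤ r i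

namespace Config

variable (h : Config l s r ζ c)
include h

theorem n_ge : (3 : ℝ) ≤ n := by exact_mod_cast h.three_le

theorem abs_oddForm_θ₁_le (i : ι) :
    |oddForm (ζ i) (basePt s i) (θ₁ n)| ≤ evenForm (ζ i) (basePt s i) (θ₁ n) :=
  abs_oddForm_le (h.bdry i) (m := Sendov.k n) (by
    have : (n : ℝ) + 1 ≠ 0 := by positivity
    unfold θ₁; push_cast; field_simp)

theorem abs_oddForm_θ₂_le (i : ι) :
    |oddForm (ζ i) (basePt s i) (θ₂ n)| ≤ evenForm (ζ i) (basePt s i) (θ₂ n) :=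
  abs_oddForm_le (h.bdry i) (m := Sendov.k n + 1) (by
    have : (n : ℝ) + 1 ≠ 0 := by positivity
    unfold θ₂; push_cast; field_simp)

theorem evenForm_θ₁_nonneg (i : ι) : 0 ≤ evenForm (ζ i) (basePt s i) (θ₁ n) :=
  (abs_nonneg _).trans (h.abs_oddForm_θ₁_le i)

theorem evenForm_θ₂_nonneg (i : ι) : 0 ≤ evenForm (ζ i) (basePt s i) (θ₂ n) :=
  (abs_nonneg _).trans (h.abs_oddForm_θ₂_le i)

theorem oddForm_θ₁ {k : ℕ} (he : Ord l s k fun i => evenForm (ζ i) (basePt s i) (θ₁ n)) :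
    Ord l s k fun i => oddForm (ζ i) (basePt s i) (θ₁ n) :=
  he.of_abs_le (Eventually.of_forall fun i =>
    (h.abs_oddForm_θ₁_le i).trans (le_abs_self _))

theorem oddForm_θ₂ {k : ℕ} (he : Ord l s k fun i => evenForm (ζ i) (basePt s i) (θ₂ n)) :
    Ord l s k fun i => oddForm (ζ i) (basePt s i) (θ₂ n) :=
  he.of_abs_le (Eventually.of_forall fun i =>
    (h.abs_oddForm_θ₂_le i).trans (le_abs_self _))

/-- The other imaginary coefficients are already `O(s³)`, and `sin θ₁ ≠ 0`. -/
theorem coef_one_im_of_sinSum {k : ℕ} (hk : k ≤ 3)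
    (hs : Ord l s k fun i => sinSum (ζ i) Complex.im 0 (θ₁ n)) :
    Ord l s k fun i => (coef (ζ i) 1).im := by
  have h0 := (Ord.sinSum_im_sub h.tendsto h.grade h.three_le (θ₁ n)).mono h.tendsto
    (by omega : k ≤ 5)
  have h2 := (Ord.coef_im h.tendsto h.grade (m := 2) (k := k) (by omega)).mul_const
    (Real.sin (2 * θ₁ n))
  have h3 := (Ord.coef_im h.tendsto h.grade (m := 3) (k := k) (by omega)).mul_const
    (Real.sin (3 * θ₁ n))
  refine Ord.of_mul_const (sin_θ₁_pos h.three_le).ne' ?_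
  exact (((hs.sub h0).sub h2).sub h3).congr fun i => by ring

/-- The even form is `O(s²)`, it dominates the odd form, and the odd form is the sine sum up to
`O(s³)`; this improves the a priori `O(s)`. -/
theorem coef_one_im_two : Ord l s 2 fun i => (coef (ζ i) 1).im := by
  have h1 : Ord l s 1 fun i => (coef (ζ i) 1).im := Ord.coef_im h.tendsto h.grade (by norm_num)
  have he := Ord.evenForm_sub_quadratic h.tendsto h.grade h.three_le (j := 2) (by norm_num)
    (by norm_num) (by norm_num) h1 (θ₁ n)
  have r0 := Ord.constCoef_re_two h.tendsto h.grade h.three_le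
  have he2 : Ord l s 2 fun i => evenForm (ζ i) (basePt s i) (θ₁ n) :=
    (he.add (r0.add (Ord.cosSum_re h.tendsto h.grade 0 (θ₁ n)))).congr fun i => by ring
  have ho := (Ord.oddForm_sub h.tendsto h.grade h.three_le (by norm_num) h1 (θ₁ n)).mono h.tendsto
    (by norm_num : 2 ≤ 2 + 1)
  exact h.coef_one_im_of_sinSum (by norm_num)
    (((h.oddForm_θ₁ he2).sub ho).congr fun i => by ring)

end Config

end FirstOrder

/-! ### Multipliers of the linear program. -/

section Weights

variable {n : ℕ}

noncomputable def lam₁ (n : ℕ) : ℝ := wt₁ n / (1 - Sendov.u₁ n)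

noncomputable def lam₂ (n : ℕ) : ℝ := wt₂ n / (1 - Sendov.u₂ n)

theorem one_sub_u₁_pos (hn : 3 ≤ n) : 0 < 1 - Sendov.u₁ n := by linarith [u₁_lt_one hn]

theorem one_sub_u₂_pos (hn : 3 ≤ n) : 0 < 1 - Sendov.u₂ n := by
  linarith [u₁_lt_one hn, u₂_lt_u₁ hn]

theorem lam₁_pos (hn : 3 ≤ n) : 0 < lam₁ n := div_pos (wt₁_pos hn) (one_sub_u₁_pos hn)

theorem lam₂_pos (hn : 3 ≤ n) : 0 < lam₂ n := div_pos (wt₂_pos hn) (one_sub_u₂_pos hn)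

/-- The dual value: the multipliers act on the normalisation `s²` at `θ = 0`, so the optimum of `r -
1` is `(lam₁ + lam₂ - 1) s²`. -/
theorem lam_add (hn : 3 ≤ n) : lam₁ n + lam₂ n = 1 + Sendov.D₁ n + Sendov.D₂ n / n := by
  have h1 := (one_sub_u₁_pos hn).ne'
  have h2 := (one_sub_u₂_pos hn).ne'
  have h3 : Sendov.u₁ n - Sendov.u₂ n ≠ 0 := by linarith [u₂_lt_u₁ hn]
  have h4 : (n : ℝ) ≠ 0 := by
    have : 0 < n := by omega
    positivity
  unfold lam₁ lam₂ wt₁ wt₂ Sendov.D₁ Sendov.D₂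
  field_simp
  ring

/-- The dual certificate. For `f = a + b cos θ + c cos 2θ`, the differences `f(0) - f(θ)` contain
the factor `1 - cos θ`, which the multipliers cancel; the weights' mean then produces exactly `b +
(1 - 1/n) c`. -/
theorem weighted_sum (hn : 3 ≤ n) (a b c : ℝ) :
    lam₁ n * (a + b * Sendov.u₁ n + c * (2 * Sendov.u₁ n ^ 2 - 1)) +
      lam₂ n * (a + b * Sendov.u₂ n + c * (2 * Sendov.u₂ n ^ 2 - 1)) =
    (lam₁ n + lam₂ n) * (a + b + c) - b - (1 - 1 / (n : ℝ)) * c := by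
  have h1 := (one_sub_u₁_pos hn).ne'
  have h2 := (one_sub_u₂_pos hn).ne'
  have e1 : lam₁ n * (1 - Sendov.u₁ n) = wt₁ n := div_mul_cancel₀ _ h1
  have e2 : lam₂ n * (1 - Sendov.u₂ n) = wt₂ n := div_mul_cancel₀ _ h2
  have e3 := wt_add hn
  have e4 := wt_mean hn
  have e5 : 1 / (2 * (n : ℝ)) = 1 / n / 2 := by ring
  rw [e5] at e4
  rw [← e1, ← e2] at e3 e4
  linear_combination (-b - 2 * c) * e3 - 2 * c * e4

/-- The coefficients of `cos θ` and `cos 2θ` in the extremal nonnegative cosine polynomial. -/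
noncomputable def xi (n : ℕ) : ℝ := 2 * Sendov.D₂ n * (Sendov.u₁ n + Sendov.u₂ n)

noncomputable def eta (n : ℕ) : ℝ := -Sendov.D₂ n

theorem eta_pos (hn : 3 ≤ n) : 0 < eta n := by
  have h1 := one_sub_u₁_pos hn
  have h2 := one_sub_u₂_pos hn
  unfold eta Sendov.D₂
  rw [neg_div, neg_neg]
  positivity

end Weights

/-! ### First-order analysis: every slack is `O(s⁴)`. -/

section FirstOrder

variable {ι : Type*} {l : Filter ι} {s r : ι → ℝ} {n : ℕ} {ζ : ι → Fin n → ℂ} {c : ℝ}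

noncomputable def slack (s r : ι → ℝ) (ζ : ι → Fin n → ℂ) (i : ι) (a : Fin n) : ℝ :=
  ‖basePt s i - ζ i a‖ ^ 2 - r i ^ 2

theorem slack_eq (i : ι) (a : Fin n) : slack s r ζ i a =
    (1 - s i ^ 2 - (ζ i a).re) ^ 2 + (ζ i a).im ^ 2 - r i ^ 2 := by
  rw [slack, ← Complex.normSq_eq_norm_sq, Complex.normSq_apply, basePt]
  simp only [Complex.sub_re, Complex.sub_im, Complex.ofReal_re, Complex.ofReal_im]
  ring

theorem sum_slack_eq_mom (i : ι) : ∑ a, slack s r ζ i a =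
    n * ((1 - s i ^ 2) ^ 2 - r i ^ 2) - 2 * (1 - s i ^ 2) * mom (ζ i) 1 0 + mom (ζ i) 2 0 +
      mom (ζ i) 0 2 := by
  have e : ∀ a, slack s r ζ i a = ((1 - s i ^ 2) ^ 2 - r i ^ 2) -
      2 * (1 - s i ^ 2) * ((ζ i a).re ^ 1 * (ζ i a).im ^ 0) + (ζ i a).re ^ 2 * (ζ i a).im ^ 0 +
      (ζ i a).re ^ 0 * (ζ i a).im ^ 2 := fun a => by rw [slack_eq]; ring
  simp only [e, sum_add_distrib, sum_sub_distrib, ← mul_sum, mom, sum_const, card_univ,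
    Fintype.card_fin, nsmul_eq_mul]
  ring

/-- The sum of the squared imaginary parts is eliminated through the real part of the second
coefficient. -/
theorem sum_slack_eq (hn : 3 ≤ n) (i : ι) : ∑ a, slack s r ζ i a =
    n * ((1 - s i ^ 2) ^ 2 - r i ^ 2) + 2 * n * (1 - s i ^ 2) * (coef (ζ i) 1).re +
      2 * (n - 1) * (coef (ζ i) 2).re - n ^ 2 * (coef (ζ i) 1).re ^ 2 + mom (ζ i) 0 1 ^ 2 +
      2 * mom (ζ i) 2 0 := by
  have hn' : (3 : ℝ) ≤ n := by exact_mod_cast hn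
  have h0 : (n : ℝ) ≠ 0 := by linarith
  have h1 : (n : ℝ) - 1 ≠ 0 := by linarith
  rw [sum_slack_eq_mom, coef_one_re, coef_two_re, esym_two_re]
  field_simp
  ring

namespace Config

variable (h : Config l s r ζ c)
include h

theorem slack_nonneg (i : ι) (a : Fin n) : 0 ≤ slack s r ζ i a := by
  rw [slack, sub_nonneg]
  exact pow_le_pow_left₀ (h.r_nonneg i) (h.crit i a) 2

theorem n_ne : (n : ℝ) ≠ 0 := by linarith [h.n_ge]

theorem mom_zero_one {k : ℕ} (hk : Ord l s k fun i => (coef (ζ i) 1).im) :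
    Ord l s k fun i => mom (ζ i) 0 1 :=
  (hk.const_mul (-(n : ℝ))).congr fun i => by
    rw [coef_one_im]; field_simp [h.n_ne]

/-- The lower estimate is `low`; the upper one holds because a single critical point is already at
distance `1 + O(s²)`. -/
theorem r_sub_one : Ord l s 2 fun i => r i - 1 := by
  have h0 : 0 < n := by linarith [h.three_le]
  have hz := h.grade ⟨0, h0⟩
  have h1 : Ord l s 2 fun i => (1 - s i ^ 2 - (ζ i ⟨0, h0⟩).re) ^ 2 + (ζ i ⟨0, h0⟩).im ^ 2 - 1 := by
    have a : Ord l s 2 fun i => s i ^ 2 + (ζ i ⟨0, h0⟩).re := (Ord.self_pow 2).add hz.1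
    have b := hz.2.pow 2
    exact ((((a.pow 2).mono h.tendsto (by norm_num : 2 ≤ 2 * 2)).sub (a.const_mul 2)).add
      (show Ord l s 2 _ from b)).congr fun i => by ring
  obtain ⟨C, hC, hb⟩ := h1.exists_bound
  refine Ord.of_bound (C + |Sendov.D₁ n + Sendov.D₂ n / n| + |c|) ?_
  have hs1 : ∀ᶠ i in l, |s i| < 1 := by
    have := h.tendsto.abs
    rw [abs_zero] at this
    exact this.eventually_lt_const one_pos
  filter_upwards [hb, hs1] with i hi hs
  have hlow := h.low i
  have hsl := h.slack_nonneg i ⟨0, h0⟩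
  rw [slack_eq] at hsl
  have hr := h.r_nonneg i
  rw [sq_abs] at hi ⊢
  have hi2 := (abs_le.mp hi).2
  set d := s i ^ 2 with hd
  have hd0 : 0 ≤ d := sq_nonneg _
  have hd1 : d ≤ 1 := by rw [hd, ← sq_abs]; nlinarith [abs_nonneg (s i)]
  have hd4 : s i ^ 4 = d ^ 2 := by rw [hd]; ring
  rw [hd4] at hlow
  have ha1 := mul_le_mul_of_nonneg_right (neg_abs_le (Sendov.D₁ n + Sendov.D₂ n / n)) hd0
  have ha2 := mul_le_mul_of_nonneg_right (neg_abs_le c) (sq_nonneg d)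
  have hdd : |c| * d ^ 2 ≤ |c| * d := mul_le_mul_of_nonneg_left (by nlinarith) (abs_nonneg c)
  have hD0 : 0 ≤ |Sendov.D₁ n + Sendov.D₂ n / n| * d := mul_nonneg (abs_nonneg _) hd0
  have hc0 : 0 ≤ |c| * d := mul_nonneg (abs_nonneg _) hd0
  have hCd : 0 ≤ C * d := by positivity
  refine abs_le.mpr ⟨by nlinarith, ?_⟩
  rcases le_total (r i) 1 with h1 | h1 <;> nlinarith

theorem cosSum_expand (θ : ℝ) : Ord l s 4 fun i =>
    ((constCoef (ζ i) (basePt s i)).re + cosSum (ζ i) Complex.re 0 θ) -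
      ((constCoef (ζ i) (basePt s i)).re + (coef (ζ i) 1).re * Real.cos θ +
        (coef (ζ i) 2).re * (2 * Real.cos θ ^ 2 - 1)) := by
  have h0 := (Ord.cosSum_re_sub h.tendsto h.grade h.three_le θ).mono h.tendsto (by norm_num : 4 ≤ 6)
  have h3 := (Ord.coef_re h.tendsto h.grade (m := 3) (k := 4) (by norm_num)).mul_const (Real.cos (3 * θ))
  have h4 := (Ord.coef_re h.tendsto h.grade (m := 4) (k := 4) (by norm_num)).mul_const (Real.cos (4 * θ))
  exact ((h0.add h3).add h4).congr fun i => by rw [Real.cos_two_mul]; ring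

theorem evenForm_expand (θ : ℝ) : Ord l s 4 fun i => evenForm (ζ i) (basePt s i) θ -
      ((constCoef (ζ i) (basePt s i)).re + (coef (ζ i) 1).re * Real.cos θ +
        (coef (ζ i) 2).re * (2 * Real.cos θ ^ 2 - 1)) :=
  ((Ord.evenForm_sub_quadratic h.tendsto h.grade h.three_le (j := 4) le_rfl (by norm_num)
    (by norm_num) h.coef_one_im_two θ).add (h.cosSum_expand θ)).congr fun i => by ring

theorem sum_slack_expand : Ord l s 4 fun i => ∑ a, slack s r ζ i a -
    (-2 * n * s i ^ 2 - 2 * n * (r i - 1) + 2 * n * (coef (ζ i) 1).re +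
      2 * (n - 1) * (coef (ζ i) 2).re) := by
  have hR1 := Ord.coef_re h.tendsto h.grade (m := 1) (k := 2) (by norm_num)
  have t1 := (Ord.self_pow (l := l) (s := s) 4).const_mul (n : ℝ)
  have t2 := (h.r_sub_one.pow 2).const_mul (n : ℝ)
  have t3 := ((Ord.self_pow 2).mul hR1).const_mul (2 * n : ℝ)
  have t4 := (hR1.pow 2).const_mul ((n : ℝ) ^ 2)
  have t5 := (h.mom_zero_one h.coef_one_im_two).pow 2
  have t6 := (Ord.mom h.grade 2 0).const_mul 2
  exact (((((t1.sub t2).sub t3).sub t4).add t5).add t6).congr fun i => by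
    rw [sum_slack_eq h.three_le]; ring

/-- All the slack in the linear program is of second order. -/
theorem first_order_total : Ord l s 4 fun i =>
    (r i - (1 + (Sendov.D₁ n + Sendov.D₂ n / n) * s i ^ 2 + c * s i ^ 4)) +
      ((∑ a, slack s r ζ i a) / (2 * n) + (lam₁ n * evenForm (ζ i) (basePt s i) (θ₁ n) +
        lam₂ n * evenForm (ζ i) (basePt s i) (θ₂ n))) := by
  have t1 := (h.sum_slack_expand).const_mul (1 / (2 * n : ℝ))
  have t2 := (h.evenForm_expand (θ₁ n)).const_mul (lam₁ n)
  have t3 := (h.evenForm_expand (θ₂ n)).const_mul (lam₂ n)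
  have t4 := (Ord.constCoef_re_sum h.tendsto h.grade h.three_le).const_mul (lam₁ n + lam₂ n)
  have t5 := (Ord.self_pow (l := l) (s := s) 4).const_mul c
  refine ((((t1.add t2).add t3).add t4).sub t5).congr fun i => ?_
  have hw := weighted_sum h.three_le (constCoef (ζ i) (basePt s i)).re (coef (ζ i) 1).re
    (coef (ζ i) 2).re
  have hl := lam_add h.three_le
  rw [← u₁_eq, ← u₂_eq]
  have e : 1 / (2 * (n : ℝ)) * (-2 * n * s i ^ 2 - 2 * n * (r i - 1) + 2 * n * (coef (ζ i) 1).re +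
      2 * (n - 1) * (coef (ζ i) 2).re) =
      -s i ^ 2 - (r i - 1) + (coef (ζ i) 1).re + (1 - 1 / n) * (coef (ζ i) 2).re := by
    have := h.n_ne
    field_simp
  linear_combination -e - hw - s i ^ 2 * hl

theorem gap_nonneg (i : ι) :
    0 ≤ r i - (1 + (Sendov.D₁ n + Sendov.D₂ n / n) * s i ^ 2 + c * s i ^ 4) := by
  linarith [h.low i]

theorem sum_slack_nonneg (i : ι) : 0 ≤ ∑ a, slack s r ζ i a :=
  sum_nonneg fun a _ => h.slack_nonneg i a

/-- The gap is one of the nonnegative terms of a sum that is `O(s⁴)`; the statements that follow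
extract the other terms in the same way. -/
theorem r_first_order : Ord l s 4 fun i =>
    r i - (1 + (Sendov.D₁ n + Sendov.D₂ n / n) * s i ^ 2) := by
  have hn := h.n_ge
  have h1 := Ord.of_nonneg_add h.gap_nonneg (fun i => by
    have := h.sum_slack_nonneg i
    have := mul_nonneg (lam₁_pos h.three_le).le (h.evenForm_θ₁_nonneg i)
    have := mul_nonneg (lam₂_pos h.three_le).le (h.evenForm_θ₂_nonneg i)
    positivity) h.first_order_total
  exact (h1.add ((Ord.self_pow 4).const_mul c)).congr fun i => by ring

theorem rest_first_order : Ord l s 4 fun i =>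
    (∑ a, slack s r ζ i a) / (2 * n) + (lam₁ n * evenForm (ζ i) (basePt s i) (θ₁ n) +
        lam₂ n * evenForm (ζ i) (basePt s i) (θ₂ n)) :=
  ((h.first_order_total.sub h.r_first_order).add ((Ord.self_pow 4).const_mul c)).congr
    fun i => by ring

theorem sum_slack_first_order : Ord l s 4 fun i => ∑ a, slack s r ζ i a := by
  have hn := h.n_ge
  have h1 := Ord.of_nonneg_add (fun i => by
      have := h.sum_slack_nonneg i
      positivity) (fun i => by
    have := mul_nonneg (lam₁_pos h.three_le).le (h.evenForm_θ₁_nonneg i)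
    have := mul_nonneg (lam₂_pos h.three_le).le (h.evenForm_θ₂_nonneg i)
    positivity) h.rest_first_order
  exact (h1.const_mul (2 * n)).congr fun i => by field_simp

theorem slack_first_order (a : Fin n) : Ord l s 4 fun i => slack s r ζ i a :=
  h.sum_slack_first_order.of_abs_le (Eventually.of_forall fun i => by
    rw [abs_of_nonneg (h.slack_nonneg i a), abs_of_nonneg (h.sum_slack_nonneg i)]
    exact single_le_sum (fun b _ => h.slack_nonneg i b) (mem_univ a))

theorem evenForms_first_order : Ord l s 4 fun i => lam₁ n * evenForm (ζ i) (basePt s i) (θ₁ n) +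
        lam₂ n * evenForm (ζ i) (basePt s i) (θ₂ n) :=
  (h.rest_first_order.sub (h.sum_slack_first_order.mul_const (1 / (2 * n)))).congr fun i => by
    ring

theorem evenForm_θ₁_first_order : Ord l s 4 fun i => evenForm (ζ i) (basePt s i) (θ₁ n) :=
  Ord.of_mul_const (lam₁_pos h.three_le).ne' <|
    (Ord.of_nonneg_add (fun i => mul_nonneg (lam₁_pos h.three_le).le (h.evenForm_θ₁_nonneg i))
      (fun i => mul_nonneg (lam₂_pos h.three_le).le (h.evenForm_θ₂_nonneg i))
      h.evenForms_first_order).congr fun _ => mul_comm _ _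

theorem evenForm_θ₂_first_order : Ord l s 4 fun i => evenForm (ζ i) (basePt s i) (θ₂ n) :=
  Ord.of_mul_const (lam₂_pos h.three_le).ne' <|
    (Ord.of_nonneg_add (fun i => mul_nonneg (lam₂_pos h.three_le).le (h.evenForm_θ₂_nonneg i))
      (fun i => mul_nonneg (lam₁_pos h.three_le).le (h.evenForm_θ₁_nonneg i))
      (h.evenForms_first_order.congr fun _ => add_comm _ _)).congr fun _ => mul_comm _ _

theorem cosSum_first_order_aux {θ : ℝ}
    (he : Ord l s 4 fun i => evenForm (ζ i) (basePt s i) θ) : Ord l s 4 fun i =>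
    (constCoef (ζ i) (basePt s i)).re + cosSum (ζ i) Complex.re 0 θ :=
  (he.sub (Ord.evenForm_sub_quadratic h.tendsto h.grade h.three_le (j := 4) le_rfl (by norm_num)
    (by norm_num) h.coef_one_im_two θ)).congr fun i => by ring

/-- The quadratic in `cos θ` vanishes at `u₁` and `u₂` and equals `s²` at `1`, all up to `O(s⁴)`;
three values determine its coefficients. -/
theorem coef_two_first_order : Ord l s 4 fun i => (coef (ζ i) 2).re - eta n * s i ^ 2 := by
  have h1 := h.evenForm_θ₁_first_order.sub (h.evenForm_expand (θ₁ n))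
  have h2 := h.evenForm_θ₂_first_order.sub (h.evenForm_expand (θ₂ n))
  have h0 := Ord.constCoef_re_sum h.tendsto h.grade h.three_le
  have p1 := (one_sub_u₁_pos h.three_le).ne'
  have p2 := (one_sub_u₂_pos h.three_le).ne'
  have p3 : Sendov.u₁ n - Sendov.u₂ n ≠ 0 := by linarith [u₂_lt_u₁ h.three_le]
  refine (((h0.sub h1).const_mul (1 / (2 * (1 - Sendov.u₁ n) * (Sendov.u₁ n - Sendov.u₂ n)))).sub
    ((h0.sub h2).const_mul (1 / (2 * (1 - Sendov.u₂ n) * (Sendov.u₁ n - Sendov.u₂ n))))).congr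
    fun i => ?_
  rw [← u₁_eq, ← u₂_eq, eta, Sendov.D₂]
  field_simp
  ring

theorem coef_one_first_order : Ord l s 4 fun i => (coef (ζ i) 1).re - xi n * s i ^ 2 := by
  have h1 := h.evenForm_θ₁_first_order.sub (h.evenForm_expand (θ₁ n))
  have h0 := Ord.constCoef_re_sum h.tendsto h.grade h.three_le
  have h2 := h.coef_two_first_order
  have p1 := (one_sub_u₁_pos h.three_le).ne'
  have p2 := (one_sub_u₂_pos h.three_le).ne'
  refine (((h0.sub h1).const_mul (1 / (1 - Sendov.u₁ n))).sub
    (h2.const_mul (2 * (1 + Sendov.u₁ n)))).congr fun i => ?_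
  rw [← u₁_eq, xi, eta, Sendov.D₂]
  field_simp
  ring

/-- The same feedback as in `coef_one_im_two`, started from an even form that is now `O(s⁴)`. -/
theorem coef_one_im_three : Ord l s 3 fun i => (coef (ζ i) 1).im := by
  have h1 := h.oddForm_θ₁ h.evenForm_θ₁_first_order
  have h2 := Ord.oddForm_sub h.tendsto h.grade h.three_le (by norm_num) h.coef_one_im_two (θ₁ n)
  exact h.coef_one_im_of_sinSum le_rfl
    (((h1.sub h2).mono h.tendsto (by norm_num : 3 ≤ 4)).congr fun i => by ring)

theorem mom_zero_one_three : Ord l s 3 fun i => mom (ζ i) 0 1 :=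
  h.mom_zero_one h.coef_one_im_three

end Config

end FirstOrder

/-! ### Second-order analysis. -/

section SecondOrder

variable {ι : Type*} {l : Filter ι} {s r : ι → ℝ} {n : ℕ} {ζ : ι → Fin n → ℂ} {c : ℝ}

/-- This is `e₄` of the imaginary parts when their sum is zero, hence the leading part of `Re
e₄(ζ)`. It is the one quantity of order `s⁴` that the first-order data leave undetermined. -/
noncomputable def quarticDefect (z : Fin n → ℂ) : ℝ := (mom z 0 2 ^ 2 - 2 * mom z 0 4) / 8

/-- The leading coefficient of the sum of squares of the imaginary parts. -/
noncomputable def sqCoef (n : ℕ) : ℝ := 2 * ((n : ℝ) - 1) * eta n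

noncomputable def rate (n : ℕ) : ℝ := Sendov.D₁ n + Sendov.D₂ n / n

noncomputable def mixedCoef (n : ℕ) : ℝ := -(1 + rate n) * sqCoef n + sqCoef n ^ 2 / 4

noncomputable def reSqCoef (n : ℕ) : ℝ := (1 + rate n) * (n * xi n) + mixedCoef n / 2

noncomputable def thirdCoef (n : ℕ) : ℝ :=
  (1 / 2 * (n * xi n) * sqCoef n + mixedCoef n) / ((n : ℝ) - 2)

/-- The `s⁴` contribution of the products of real-coefficient sine sums in `evenForm`. -/
noncomputable def quadCoef (n : ℕ) (θ : ℝ) : ℝ :=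
  (xi n * Real.sin θ + eta n * Real.sin (2 * θ)) *
    (((n : ℝ) + 1) / 2 * (xi n * Real.sin θ + eta n * Real.sin (2 * θ)) -
      (xi n * Real.sin θ + 2 * eta n * Real.sin (2 * θ)))

/-- The value of the primal optimum, in agreement with the dual value in `lam_add`. -/
theorem one_add_rate (hn : 3 ≤ n) : 1 + rate n = xi n + (1 - 1 / (n : ℝ)) * eta n := by
  have h1 := (one_sub_u₁_pos hn).ne'
  have h2 := (one_sub_u₂_pos hn).ne'
  have h4 : (n : ℝ) ≠ 0 := by
    have : 0 < n := by omega
    positivity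
  unfold rate xi eta Sendov.D₁ Sendov.D₂
  field_simp
  ring

theorem thirdCoef_eq (hn : 3 ≤ n) : thirdCoef n = (1 + rate n) * ((n : ℝ) - 1) * eta n := by
  have hn' : (3 : ℝ) ≤ n := by exact_mod_cast hn
  have h0 : (n : ℝ) ≠ 0 := by linarith
  have h2 : (n : ℝ) - 2 ≠ 0 := by linarith
  rw [thirdCoef, mixedCoef, sqCoef, one_add_rate hn]
  field_simp
  ring

theorem re_eq_slack (i : ι) (a : Fin n) : (ζ i a).re = ((1 - s i ^ 2) ^ 2 - r i ^ 2) / 2 +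
    (ζ i a).im ^ 2 / 2 + (ζ i a).re ^ 2 / 2 - slack s r ζ i a / 2 + s i ^ 2 * (ζ i a).re := by
  rw [slack_eq]; ring

/-- Solving the equation of the circle about the base point for the real part trades one real factor
for two imaginary ones, up to slack. This reduces mixed moments to moments of the imaginary parts.
-/
theorem mom_succ (a b : ℕ) (i : ι) : mom (ζ i) (a + 1) b =
    ((1 - s i ^ 2) ^ 2 - r i ^ 2) / 2 * mom (ζ i) a b + mom (ζ i) a (b + 2) / 2 +
      mom (ζ i) (a + 2) b / 2 -
      (∑ c, slack s r ζ i c * ((ζ i c).re ^ a * (ζ i c).im ^ b)) / 2 +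
      s i ^ 2 * mom (ζ i) (a + 1) b := by
  simp only [mom, mul_sum, sum_div, ← sum_add_distrib, ← sum_sub_distrib]
  refine sum_congr rfl fun c _ => ?_
  have := re_eq_slack (s := s) (r := r) (ζ := ζ) i c
  linear_combination ((ζ i c).re ^ a * (ζ i c).im ^ b) * this

noncomputable def secondCoef (n : ℕ) : ℝ :=
  1 / 2 - rate n ^ 2 / 2 - xi n - n * xi n ^ 2 / 2 + reSqCoef n / n +
    (lam₁ n + lam₂ n) * (-n / 2 + n * xi n + (n - 1) * eta n) +
    (lam₁ n * quadCoef n (θ₁ n) + lam₂ n * quadCoef n (θ₂ n)) -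
    thirdCoef n * (wt₁ n * (1 + 2 * Sendov.u₁ n) ^ 2 + wt₂ n * (1 + 2 * Sendov.u₂ n) ^ 2)

namespace Config

variable (h : Config l s r ζ c)
include h

theorem sub_one_ne : (n : ℝ) - 1 ≠ 0 := by linarith [h.n_ge]

theorem sub_two_ne : (n : ℝ) - 2 ≠ 0 := by linarith [h.n_ge]

theorem kappa_expand : Ord l s 4 fun i =>
    ((1 - s i ^ 2) ^ 2 - r i ^ 2) / 2 + (1 + rate n) * s i ^ 2 := by
  have t1 := h.r_first_order
  have t2 := h.r_sub_one.pow 2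
  exact ((((Ord.self_pow (l := l) (s := s) 4).const_mul (1 / 2)).sub t1).sub
    (t2.const_mul (1 / 2))).congr fun i => by rw [rate]; ring

theorem mom_one_zero_expand : Ord l s 4 fun i => mom (ζ i) 1 0 + n * xi n * s i ^ 2 :=
  (h.coef_one_first_order.const_mul (-(n : ℝ))).congr fun i => by
    rw [coef_one_re]; field_simp [h.n_ne]; ring

theorem mom_zero_two_expand : Ord l s 4 fun i => mom (ζ i) 0 2 - sqCoef n * s i ^ 2 := by
  have t1 := h.coef_two_first_order.const_mul (2 * ((n : ℝ) - 1))
  have t2 := (Ord.mom h.grade 1 0).pow 2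
  have t3 := (h.mom_zero_one_three.pow 2).mono h.tendsto (by norm_num : 4 ≤ 3 * 2)
  have t4 := Ord.mom h.grade 2 0
  exact (((t1.sub t2).add t3).add t4).congr fun i => by
    rw [coef_two_re, esym_two_re, sqCoef]; field_simp [h.sub_one_ne]; ring

theorem sum_slack_mul (a b : ℕ) : Ord l s (4 + (2 * a + b)) fun i =>
    ∑ c, slack s r ζ i c * ((ζ i c).re ^ a * (ζ i c).im ^ b) :=
  Ord.sum fun c _ => (h.slack_first_order c).mul
    ((show Ord l s (2 * a) _ from (h.grade c).1.pow a).mul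
      (show Ord l s b _ by simpa using (h.grade c).2.pow b))

theorem mom_one_two_expand : Ord l s 6 fun i =>
    mom (ζ i) 1 2 - (mixedCoef n * s i ^ 4 - 2 * quarticDefect (ζ i)) := by
  have q2 := Ord.mom h.grade 0 2
  have e2 := h.mom_zero_two_expand
  have t1 := h.kappa_expand.mul q2
  have t2 := ((Ord.self_pow 2).mul e2).const_mul (1 + rate n)
  have t3 := (e2.mul q2).const_mul (1 / 4)
  have t4 := ((Ord.self_pow 2).mul e2).const_mul (sqCoef n / 4)
  have t5 := (Ord.mom h.grade 2 2).const_mul (1 / 2)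
  have t6 := (h.sum_slack_mul 0 2).const_mul (1 / 2)
  have t7 := (Ord.self_pow 2).mul (Ord.mom h.grade 1 2)
  refine ((((((t1.sub t2).add t3).add t4).add t5).sub t6).add t7).congr fun i => ?_
  have e := mom_succ (s := s) (r := r) (ζ := ζ) 0 2 i
  rw [quarticDefect, mixedCoef]
  linear_combination -e

theorem mom_two_zero_expand : Ord l s 6 fun i =>
    mom (ζ i) 2 0 - (reSqCoef n * s i ^ 4 - quarticDefect (ζ i)) := by
  have t1 := h.kappa_expand.mul (Ord.mom h.grade 1 0)
  have t2 := ((Ord.self_pow 2).mul h.mom_one_zero_expand).const_mul (1 + rate n)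
  have t3 := h.mom_one_two_expand.const_mul (1 / 2)
  have t5 := (Ord.mom h.grade 3 0).const_mul (1 / 2)
  have t6 := (h.sum_slack_mul 1 0).const_mul (1 / 2)
  have t7 := (Ord.self_pow 2).mul (Ord.mom h.grade 2 0)
  refine (((((t1.sub t2).add t3).add t5).sub t6).add t7).congr fun i => ?_
  have e := mom_succ (s := s) (r := r) (ζ := ζ) 1 0 i
  rw [reSqCoef]
  linear_combination -e

theorem coef_three_expand : Ord l s 6 fun i =>
    (coef (ζ i) 3).re - (thirdCoef n * s i ^ 4 - 2 * quarticDefect (ζ i) / ((n : ℝ) - 2)) := by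
  have t1 := Ord.esym_three_re h.tendsto h.grade h.mom_zero_one_three
  have t2 := h.mom_one_two_expand
  have t3 := (h.mom_one_zero_expand.mul (Ord.mom h.grade 0 2)).const_mul (1 / 2)
  have t4 := ((Ord.self_pow 2).mul h.mom_zero_two_expand).const_mul (1 / 2 * (n * xi n))
  refine ((((t2.sub t1).sub t3).add t4).const_mul (1 / ((n : ℝ) - 2))).congr fun i => ?_
  rw [coef_three_re, thirdCoef]
  have := h.sub_two_ne
  field_simp
  ring

theorem coef_four_expand : Ord l s 6 fun i =>
    (coef (ζ i) 4).re - quarticDefect (ζ i) / ((n : ℝ) - 3) :=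
  ((Ord.esym_four_re h.tendsto h.grade h.mom_zero_one_three).const_mul (1 / ((n : ℝ) - 3))).congr
    fun i => by rw [coef_four_re, quarticDefect]; ring

theorem sinSum_expand (e : ℕ) (θ : ℝ) : Ord l s 4 fun i => sinSum (ζ i) Complex.re e θ -
    (xi n * Real.sin θ + 2 ^ e * eta n * Real.sin (2 * θ)) * s i ^ 2 :=
  (((Ord.sinSum_re_sub h.tendsto h.grade h.three_le e θ).add
    (h.coef_one_first_order.mul_const (Real.sin θ))).add
    ((h.coef_two_first_order.mul_const (Real.sin (2 * θ))).const_mul (2 ^ e))).congr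
    fun i => by ring

/-- Where the even form is `O(s⁴)` so is the cosine sum, and its products with other sums are
`O(s⁶)`; of the quadratic terms only the sine sums survive. -/
theorem evenForm_second {θ : ℝ} (he : Ord l s 4 fun i => evenForm (ζ i) (basePt s i) θ) :
    Ord l s 6 fun i => evenForm (ζ i) (basePt s i) θ -
      ((constCoef (ζ i) (basePt s i)).re + (coef (ζ i) 1).re * Real.cos θ +
        (coef (ζ i) 2).re * (2 * Real.cos θ ^ 2 - 1) +
        (thirdCoef n * s i ^ 4 - 2 * quarticDefect (ζ i) / ((n : ℝ) - 2)) * Real.cos (3 * θ) +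
        quarticDefect (ζ i) / ((n : ℝ) - 3) * Real.cos (4 * θ) + quadCoef n θ * s i ^ 4) := by
  have r0 := Ord.constCoef_re_two h.tendsto h.grade h.three_le
  have CR := h.cosSum_first_order_aux he
  have CR2 := CR.mono h.tendsto (by norm_num : 2 ≤ 4)
  have CR' := Ord.cosSum_re h.tendsto h.grade 1 θ
  have SR := Ord.sinSum_re h.tendsto h.grade 0 θ
  have SR' := Ord.sinSum_re h.tendsto h.grade 1 θ
  have t0 := Ord.evenForm_sub h.tendsto h.grade le_rfl h.coef_one_im_three θ
  have t1 := CR.mul (((CR2.const_mul (((n : ℝ) + 1) / 2)).sub (r0.const_mul ((n : ℝ) + 1))).sub CR')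
  have t2 := Ord.cosSum_re_sub h.tendsto h.grade h.three_le θ
  have t3 := h.coef_three_expand.mul_const (Real.cos (3 * θ))
  have t4 := h.coef_four_expand.mul_const (Real.cos (4 * θ))
  have t5 := (h.sinSum_expand 0 θ).mul ((SR.const_mul (((n : ℝ) + 1) / 2)).sub SR')
  have t6 := ((Ord.self_pow 2).mul ((((h.sinSum_expand 0 θ).const_mul (((n : ℝ) + 1) / 2)).sub
    (h.sinSum_expand 1 θ)))).const_mul (xi n * Real.sin θ + eta n * Real.sin (2 * θ))
  refine ((((((t0.add t1).add t2).add t3).add t4).add t5).add t6).congr fun i => ?_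
  rw [quadCoef, Real.cos_two_mul]
  ring

theorem sum_slack_second : Ord l s 6 fun i => (∑ a, slack s r ζ i a) / (2 * n) -
    (-s i ^ 2 - (r i - 1) + (coef (ζ i) 1).re + (1 - 1 / (n : ℝ)) * (coef (ζ i) 2).re +
      (1 / 2 - rate n ^ 2 / 2 - xi n - n * xi n ^ 2 / 2 + reSqCoef n / n) * s i ^ 4 -
      quarticDefect (ζ i) / n) := by
  have hR1 := Ord.coef_re h.tendsto h.grade (m := 1) (k := 2) (by norm_num)
  have hr : Ord l s 4 fun i => (r i - 1) - rate n * s i ^ 2 :=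
    h.r_first_order.congr fun i => by rw [rate]; ring
  have t1 := (hr.mul h.r_sub_one).const_mul (1 / 2)
  have t2 := ((Ord.self_pow 2).mul hr).const_mul (rate n / 2)
  have t3 := (Ord.self_pow 2).mul h.coef_one_first_order
  have t4 := (h.coef_one_first_order.mul hR1).const_mul (n / 2 : ℝ)
  have t5 := ((Ord.self_pow 2).mul h.coef_one_first_order).const_mul (n * xi n / 2)
  have t6 := (h.mom_zero_one_three.pow 2).const_mul (1 / (2 * n : ℝ))
  have t7 := h.mom_two_zero_expand.const_mul (1 / n : ℝ)
  refine ((((((t6.sub t1).sub t2).sub t3).sub t4).sub t5).add t7).congr fun i => ?_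
  rw [sum_slack_eq h.three_le]
  have := h.n_ne
  field_simp
  ring

/-- The normalisation at `θ = 0` removes the constant term, so the third and fourth harmonics enter
through `1 - cos 3θ` and `1 - cos 4θ`. -/
theorem lam_mul_one_sub_cos :
    lam₁ n * (1 - Real.cos (3 * θ₁ n)) = wt₁ n * (1 + 2 * Sendov.u₁ n) ^ 2 ∧
    lam₂ n * (1 - Real.cos (3 * θ₂ n)) = wt₂ n * (1 + 2 * Sendov.u₂ n) ^ 2 ∧
    lam₁ n * (1 - Real.cos (4 * θ₁ n)) = wt₁ n * (8 * Sendov.u₁ n ^ 2 * (1 + Sendov.u₁ n)) ∧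
    lam₂ n * (1 - Real.cos (4 * θ₂ n)) = wt₂ n * (8 * Sendov.u₂ n ^ 2 * (1 + Sendov.u₂ n)) := by
  have h1 := (one_sub_u₁_pos h.three_le).ne'
  have h2 := (one_sub_u₂_pos h.three_le).ne'
  have e4 : ∀ θ : ℝ, Real.cos (4 * θ) = 2 * (2 * Real.cos θ ^ 2 - 1) ^ 2 - 1 := fun θ => by
    rw [show 4 * θ = 2 * (2 * θ) by ring, Real.cos_two_mul, Real.cos_two_mul]
  rw [lam₁, lam₂, e4, e4, Real.cos_three_mul, Real.cos_three_mul, ← u₁_eq, ← u₂_eq]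
  refine ⟨?_, ?_, ?_, ?_⟩ <;> field_simp <;> ring

/-- The first-order certificate with the same multipliers, the third and fourth coefficients and all
quadratic terms now retained. -/
theorem second_order_total : Ord l s 6 fun i =>
    (r i - (1 + rate n * s i ^ 2 + secondCoef n * s i ^ 4)) +
      (∑ a, slack s r ζ i a) / (2 * n) + (lam₁ n * evenForm (ζ i) (basePt s i) (θ₁ n) +
        lam₂ n * evenForm (ζ i) (basePt s i) (θ₂ n)) + curv n * quarticDefect (ζ i) := by
  have t1 := h.sum_slack_second
  have t2 := (h.evenForm_second h.evenForm_θ₁_first_order).const_mul (lam₁ n)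
  have t3 := (h.evenForm_second h.evenForm_θ₂_first_order).const_mul (lam₂ n)
  have t4 := (Ord.constCoef_re_first h.tendsto h.grade h.three_le).const_mul (lam₁ n + lam₂ n)
  have t5 := h.coef_three_expand.const_mul (lam₁ n + lam₂ n)
  have t6 := h.coef_four_expand.const_mul (lam₁ n + lam₂ n)
  have t7 := ((Ord.self_pow 2).mul h.coef_one_first_order).const_mul ((lam₁ n + lam₂ n) * n)
  have t8 := ((Ord.self_pow 2).mul h.coef_two_first_order).const_mul ((lam₁ n + lam₂ n) * (n - 1))
  refine (((((((t1.add t2).add t3).add t4).sub t5).sub t6).add t7).add t8).congr fun i => ?_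
  have hw := weighted_sum h.three_le (constCoef (ζ i) (basePt s i)).re (coef (ζ i) 1).re
    (coef (ζ i) 2).re
  have hl : lam₁ n + lam₂ n = 1 + rate n := by rw [lam_add h.three_le, rate]; ring
  obtain ⟨c1, c2, c3, c4⟩ := h.lam_mul_one_sub_cos
  rw [← u₁_eq, ← u₂_eq, curv, secondCoef]
  linear_combination -hw - s i ^ 2 * hl + (thirdCoef n * s i ^ 4 - 2 * quarticDefect (ζ i) / ((n : ℝ) - 2)) * (c1 + c2) + quarticDefect (ζ i) / ((n : ℝ) - 3) * (c3 + c4)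

end Config

end SecondOrder

theorem secondCoef_eq {n : ℕ} (hn : 3 ≤ n) : secondCoef n = Sendov.D n := by
  have hn' : (3 : ℝ) ≤ n := by exact_mod_cast hn
  have h0 : (n : ℝ) ≠ 0 := by linarith
  have h1 := (one_sub_u₁_pos hn).ne'
  have h2 := (one_sub_u₂_pos hn).ne'
  have h3 : Sendov.u₁ n - Sendov.u₂ n ≠ 0 := by linarith [u₂_lt_u₁ hn]
  -- Here `xi sin θ₁ + eta sin 2θ₁ = 2 D₂ u₂ sin θ₁`, and `sin² θ₁` cancels the denominator `1 - u₁`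
  -- of `lam₁`.
  have q1 : lam₁ n * quadCoef n (θ₁ n) = wt₁ n * (1 + Sendov.u₁ n) *
      ((2 * Sendov.D₂ n * Sendov.u₂ n) * (((n : ℝ) + 1) / 2 * (2 * Sendov.D₂ n * Sendov.u₂ n) -
        2 * Sendov.D₂ n * (Sendov.u₂ n - Sendov.u₁ n))) := by
    have hs := Real.sin_sq (θ₁ n)
    rw [← u₁_eq] at hs
    rw [lam₁, quadCoef, xi, eta, Real.sin_two_mul, ← u₁_eq]
    generalize Sendov.u₁ n = u at *
    generalize Sendov.u₂ n = v at *
    have e : wt₁ n * (1 + u) = wt₁ n / (1 - u) * (1 - u ^ 2) := by field_simp; ring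
    rw [e, ← hs]
    ring
  have q2 : lam₂ n * quadCoef n (θ₂ n) = wt₂ n * (1 + Sendov.u₂ n) *
      ((2 * Sendov.D₂ n * Sendov.u₁ n) * (((n : ℝ) + 1) / 2 * (2 * Sendov.D₂ n * Sendov.u₁ n) -
        2 * Sendov.D₂ n * (Sendov.u₁ n - Sendov.u₂ n))) := by
    have hs := Real.sin_sq (θ₂ n)
    rw [← u₂_eq] at hs
    rw [lam₂, quadCoef, xi, eta, Real.sin_two_mul, ← u₂_eq]
    generalize Sendov.u₁ n = u at *
    generalize Sendov.u₂ n = v at *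
    have e : wt₂ n * (1 + v) = wt₂ n / (1 - v) * (1 - v ^ 2) := by field_simp; ring
    rw [e, ← hs]
    ring
  rw [secondCoef, q1, q2, lam_add hn, thirdCoef_eq hn, reSqCoef, mixedCoef, sqCoef, rate, xi, eta,
    wt₁, wt₂, Sendov.D, Sendov.D₃, Sendov.D₄, Sendov.D₅, Sendov.D₆, Sendov.D₁, Sendov.D₂]
  generalize Sendov.u₁ n = u at *
  generalize Sendov.u₂ n = v at *
  field_simp
  ring

/-! ### Control of the quartic defect and the final bound. -/

section Conclusion

variable {ι : Type*} {l : Filter ι} {s r : ι → ℝ} {n : ℕ} {ζ : ι → Fin n → ℂ} {c : ℝ}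

/-- The imaginary parts of the first three coefficients reduce, to order `s⁴`, to the first and
third moments of the imaginary parts of the critical points. -/
theorem sin_expand_of_oddForm {θ : ℝ} (h : Config l s r ζ c)
    (he : Ord l s 4 fun i => oddForm (ζ i) (basePt s i) θ) : Ord l s 4 fun i =>
      (-mom (ζ i) 0 1 / n + mom (ζ i) 0 3 * (-Real.cos θ / ((n : ℝ) - 1) +
        (4 * Real.cos θ ^ 2 - 1) / (3 * ((n : ℝ) - 2)))) * Real.sin θ := by
  have hs := h.tendsto
  have J := h.mom_zero_one_three
  have t0 := (Ord.oddForm_sub hs h.grade h.three_le le_rfl h.coef_one_im_three θ).mono hs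
    (by norm_num : 4 ≤ 2 + 3)
  have t1 := (Ord.sinSum_im_sub hs h.grade h.three_le θ).mono hs (by norm_num : 4 ≤ 5)
  have m11 : Ord l s 4 fun i => mom (ζ i) 1 1 - mom (ζ i) 0 3 / 2 := by
    have a1 := (h.kappa_expand.mul J).mono hs (by norm_num : 4 ≤ 4 + 3)
    have a2 := (((Ord.self_pow 2).mul J).const_mul (1 + rate n)).mono hs (by norm_num : 4 ≤ 2 + 3)
    have a3 := ((Ord.mom h.grade 2 1).const_mul (1 / 2)).mono hs (by norm_num : 4 ≤ 2 * 2 + 1)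
    have a4 := ((h.sum_slack_mul 0 1).const_mul (1 / 2)).mono hs (by norm_num : 4 ≤ 4 + (2 * 0 + 1))
    have a5 := ((Ord.self_pow 2).mul (Ord.mom h.grade 1 1)).mono hs
      (by norm_num : 4 ≤ 2 + (2 * 1 + 1))
    refine ((((a1.sub a2).add a3).sub a4).add a5).congr fun i => ?_
    have e := mom_succ (s := s) (r := r) (ζ := ζ) 0 1 i
    linear_combination -e
  have i2 : Ord l s 4 fun i => (coef (ζ i) 2).im + mom (ζ i) 0 3 / (2 * ((n : ℝ) - 1)) := by
    have a1 := ((Ord.mom h.grade 1 0).mul J).mono hs (by norm_num : 4 ≤ 2 * 1 + 0 + 3)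
    refine ((a1.sub m11).const_mul (1 / ((n : ℝ) - 1))).congr fun i => ?_
    rw [coef_two_im, esym_two_im]
    field_simp [h.sub_one_ne]
    ring
  have i3 : Ord l s 4 fun i => (coef (ζ i) 3).im - mom (ζ i) 0 3 / (3 * ((n : ℝ) - 2)) := by
    have a1 := (Ord.esym_three_im hs h.grade J).mono hs (by norm_num : 4 ≤ 5)
    refine (a1.const_mul (-1 / ((n : ℝ) - 2))).congr fun i => ?_
    rw [coef_three_im]
    field_simp [h.sub_two_ne]
    ring
  refine (((he.sub t0).sub t1).sub (i2.mul_const (Real.sin (2 * θ)))).sub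
    (i3.mul_const (Real.sin (3 * θ))) |>.congr fun i => ?_
  have e3 : Real.sin (3 * θ) = Real.sin θ * (4 * Real.cos θ ^ 2 - 1) := by
    rw [Real.sin_three_mul]
    linear_combination (-4 * Real.sin θ) * Real.sin_sq_add_cos_sq θ
  rw [Real.sin_two_mul, e3, coef_one_im]
  have := h.sub_one_ne
  have := h.sub_two_ne
  have := h.n_ne
  field_simp
  ring

theorem quarticDefect_newton (z : Fin n → ℂ) :
    -quarticDefect z * mom z 0 2 ≤ mom z 0 3 ^ 2 / 4 := by
  have := power_sum_newton fun i => (z i).im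
  have e : ∀ b, ∑ i, (z i).im ^ b = mom z 0 b := fun b => by simp [mom]
  rw [e, e, e] at this
  rw [quarticDefect]
  linarith

namespace Config

variable (h : Config l s r ζ c)
include h

/-- The relation of `sin_expand_of_oddForm` holds at two angles with nonzero sine; subtracting
eliminates the first moment. The remaining factor is nonzero because `u₁ > u₂` and `u₁ + u₂ < 0`. -/
theorem mom_zero_three (h4 : 4 ≤ n) (h5 : n ≠ 5) : Ord l s 4 fun i => mom (ζ i) 0 3 := by
  have hn := h.n_ge
  have t1 := Ord.of_mul_const (sin_θ₁_pos h.three_le).ne'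
    (sin_expand_of_oddForm h (h.oddForm_θ₁ h.evenForm_θ₁_first_order))
  have t2 := Ord.of_mul_const (sin_θ₂_pos h4 h5).ne'
    (sin_expand_of_oddForm h (h.oddForm_θ₂ h.evenForm_θ₂_first_order))
  rw [← u₁_eq] at t1
  rw [← u₂_eq] at t2
  have d1 : 0 < Sendov.u₁ n - Sendov.u₂ n := by linarith [u₂_lt_u₁ h.three_le]
  have d2 : 4 * (Sendov.u₁ n + Sendov.u₂ n) / (3 * ((n : ℝ) - 2)) - 1 / ((n : ℝ) - 1) < 0 := by
    have a1 : 4 * (Sendov.u₁ n + Sendov.u₂ n) / (3 * ((n : ℝ) - 2)) ≤ 0 :=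
      div_nonpos_of_nonpos_of_nonneg (by linarith [u₁_add_u₂_neg h.three_le]) (by linarith)
    have a2 : 0 < 1 / ((n : ℝ) - 1) := by
      have : (0 : ℝ) < n - 1 := by linarith
      positivity
    linarith
  refine Ord.of_mul_const (mul_ne_zero d1.ne' d2.ne) ((t1.sub t2).congr fun i => ?_)
  have := h.sub_one_ne
  have := h.sub_two_ne
  field_simp
  ring

theorem quarticDefect_ord : Ord l s 4 fun i => quarticDefect (ζ i) :=
  ((((Ord.mom h.grade 0 2).pow 2).sub ((Ord.mom h.grade 0 4).const_mul 2)).const_mul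
    (1 / 8)).congr fun i => by rw [quarticDefect]; ring

/-- By Newton's inequality `-W` is at most a quarter of the squared third moment, `O(s⁸)`, divided
by the second moment, which is at least a positive multiple of `s²`. -/
theorem neg_quarticDefect_le (h4 : 4 ≤ n) (h5 : n ≠ 5) :
    ∃ C, 0 ≤ C ∧ ∀ᶠ i in l, -quarticDefect (ζ i) ≤ C * s i ^ 6 := by
  obtain ⟨C₃, hC₃, b3⟩ := (h.mom_zero_three h4 h5).exists_bound
  obtain ⟨C₂, hC₂, b2⟩ := h.mom_zero_two_expand.exists_bound
  obtain ⟨C₄, hC₄, b4⟩ := h.quarticDefect_ord.exists_bound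
  have hQ : 0 < sqCoef n := by
    have := eta_pos h.three_le
    have := h.n_ge
    unfold sqCoef
    have : (0 : ℝ) < n - 1 := by linarith
    positivity
  set Q := sqCoef n
  have hsq : Tendsto (fun i => C₂ * s i ^ 2) l (𝓝 0) := by
    simpa using (h.tendsto.pow 2).const_mul C₂
  have hs2 : ∀ᶠ i in l, C₂ * s i ^ 2 < Q / 2 := hsq.eventually_lt_const (by positivity)
  refine ⟨C₃ ^ 2 / (2 * Q), by positivity, ?_⟩
  filter_upwards [b3, b2, b4, hs2] with i b3 b2 b4 hs2
  have e4 : |s i| ^ 4 = s i ^ 4 := by rw [← abs_pow, abs_of_nonneg (by positivity)]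
  rw [e4] at b2 b3 b4
  -- The case `s = 0`, which allows no division, is settled by the bound `|W| ≤ C₄ s⁴`.
  rcases eq_or_ne (s i) 0 with h0 | h0
  · rw [h0] at b4 ⊢
    norm_num at b4 ⊢
    rw [b4]
  have hspos : 0 < s i ^ 2 := by positivity
  have hq2 : Q / 2 * s i ^ 2 ≤ mom (ζ i) 0 2 := by
    have := (abs_le.mp b2).1
    nlinarith
  have hN := CritBound.quarticDefect_newton (ζ i)
  have h3sq : mom (ζ i) 0 3 ^ 2 ≤ C₃ ^ 2 * s i ^ 8 := by
    have := pow_le_pow_left₀ (abs_nonneg _) b3 2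
    rw [sq_abs] at this
    calc _ ≤ _ := this
      _ = _ := by ring
  by_cases hW : -quarticDefect (ζ i) ≤ 0
  · exact hW.trans (by positivity)
  push Not at hW
  have hstep : -quarticDefect (ζ i) * (Q / 2 * s i ^ 2) ≤ C₃ ^ 2 * s i ^ 8 / 4 :=
    (mul_le_mul_of_nonneg_left hq2 hW.le).trans (hN.trans (by linarith))
  have e : C₃ ^ 2 * s i ^ 8 / 4 = C₃ ^ 2 / (2 * Q) * s i ^ 6 * (Q / 2 * s i ^ 2) := by
    field_simp; ring
  rw [e] at hstep
  exact le_of_mul_le_mul_right hstep (by positivity)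

theorem gap_le : ∃ C, ∀ᶠ i in l, r i ≤ 1 + rate n * s i ^ 2 + Sendov.D n * s i ^ 4 -
    curv n * quarticDefect (ζ i) + C * s i ^ 6 := by
  obtain ⟨C, hC, hb⟩ := h.second_order_total.exists_bound
  refine ⟨C, ?_⟩
  filter_upwards [hb] with i hi
  have := (abs_le.mp hi).2
  have e6 : |s i| ^ 6 = s i ^ 6 := by rw [← abs_pow, abs_of_nonneg (by positivity)]
  rw [secondCoef_eq h.three_le, e6] at this
  have hn := h.n_ge
  have p1 := h.sum_slack_nonneg i
  have p2 := mul_nonneg (lam₁_pos h.three_le).le (h.evenForm_θ₁_nonneg i)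
  have p3 := mul_nonneg (lam₂_pos h.three_le).le (h.evenForm_θ₂_nonneg i)
  have p4 : 0 ≤ (∑ a, slack s r ζ i a) / (2 * n) := by positivity
  linarith

theorem upper_general (h4 : 4 ≤ n) (h5 : n ≠ 5) : ∃ C, ∀ᶠ i in l,
    r i ≤ 1 + rate n * s i ^ 2 + Sendov.D n * s i ^ 4 + C * s i ^ 6 := by
  obtain ⟨C, hC⟩ := h.gap_le
  obtain ⟨C', hC'0, hC'⟩ := h.neg_quarticDefect_le h4 h5
  refine ⟨C + curv n * C', ?_⟩
  filter_upwards [hC, hC'] with i h1 h2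
  have := mul_le_mul_of_nonneg_left h2 (curv_nonneg h4 h5)
  linarith

end Config

theorem Config.upper_three {ζ : ι → Fin 3 → ℂ} (h : Config l s r ζ c) : ∃ C, ∀ᶠ i in l,
    r i ≤ 1 + rate 3 * s i ^ 2 + Sendov.D 3 * s i ^ 4 + C * s i ^ 6 := by
  obtain ⟨C, hC⟩ := h.gap_le
  have hW : Ord l s 6 fun i => quarticDefect (ζ i) :=
    (Ord.esym_four_re h.tendsto h.grade h.mom_zero_one_three).neg.congr fun i => by
      rw [esym_eq_zero _ (by norm_num : 3 < 4), quarticDefect]; simp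
  obtain ⟨C', hC'0, hC'⟩ := hW.exists_bound
  refine ⟨C + |curv 3| * C', ?_⟩
  filter_upwards [hC, hC'] with i h1 h2
  have e6 : |s i| ^ 6 = s i ^ 6 := by rw [← abs_pow, abs_of_nonneg (by positivity)]
  rw [e6] at h2
  have h3 : -(curv 3 * quarticDefect (ζ i)) ≤ |curv 3| * (C' * s i ^ 6) :=
    (neg_le_abs _).trans (by rw [abs_mul]; exact mul_le_mul_of_nonneg_left h2 (abs_nonneg _))
  linarith

/-- `quartic_bound_five` applied to the centred imaginary parts; the constant is `3/80 = (2 · 13/20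
- 1) / 8`. -/
theorem quarticDefect_five_lower (z : Fin 5 → ℂ) : -quarticDefect z ≤ 3 / 80 * mom z 0 2 ^ 2 +
    1 / 4 * (4 / 5 * mom z 0 1 * mom z 0 3 - 6 / 25 * mom z 0 1 ^ 2 * mom z 0 2 +
      3 / 125 * mom z 0 1 ^ 4) := by
  set m := mom z 0 1 / 5 with hm
  have e1 : ∑ i, (z i).im = 5 * m := by rw [hm]; simp [mom]; ring
  have e : ∀ b, ∑ i, (z i).im ^ b = mom z 0 b := fun b => by simp [mom]
  have h0 : ∑ i, ((z i).im - m) = 0 := by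
    rw [sum_sub_distrib, e1]; simp
  have h2 : ∑ i, ((z i).im - m) ^ 2 = mom z 0 2 - 5 * m ^ 2 := by
    have : ∀ i, ((z i).im - m) ^ 2 = (z i).im ^ 2 - 2 * m * (z i).im + m ^ 2 := fun i => by ring
    simp only [this, sum_add_distrib, sum_sub_distrib, ← mul_sum, e1, e]
    simp; ring
  have h4 : ∑ i, ((z i).im - m) ^ 4 =
      mom z 0 4 - 4 * m * mom z 0 3 + 6 * m ^ 2 * mom z 0 2 - 15 * m ^ 4 := by
    have : ∀ i, ((z i).im - m) ^ 4 = (z i).im ^ 4 - 4 * m * (z i).im ^ 3 +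
        6 * m ^ 2 * (z i).im ^ 2 - 4 * m ^ 3 * (z i).im + m ^ 4 := fun i => by ring
    simp only [this, sum_add_distrib, sum_sub_distrib, ← mul_sum, e1, e]
    simp; ring
  have hq := quartic_bound_five h0
  rw [h2, h4] at hq
  have hm5 : mom z 0 1 = 5 * m := by rw [hm]; ring
  have hle : (mom z 0 2 - 5 * m ^ 2) ^ 2 ≤ mom z 0 2 ^ 2 := by
    have p1 : 0 ≤ mom z 0 2 - 5 * m ^ 2 := by rw [← h2]; positivity
    nlinarith [sq_nonneg m]
  rw [quarticDefect, hm5]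
  nlinarith

/-- The second moment is `(4/3) s²` to leading order, so `-W ≤ (3/80)(4/3)² s⁴ = s⁴/15` up to
`O(s⁶)`; multiplying by `curv 5 = 7/15` gives `7/225`. -/
theorem Config.upper_five {ζ : ι → Fin 5 → ℂ} (h : Config l s r ζ c) : ∃ C, ∀ᶠ i in l,
    r i ≤ 1 + rate 5 * s i ^ 2 + (Sendov.D 5 + 7 / 225) * s i ^ 4 + C * s i ^ 6 := by
  obtain ⟨C, hC⟩ := h.gap_le
  have hQ : sqCoef 5 = 4 / 3 := by
    have hk : Sendov.k 5 = 2 := rfl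
    have e1 : Sendov.u₁ 5 = -1 / 2 := by
      rw [u₁_eq, θ₁, hk, ← cos_two_pi_div_three]; congr 1; push_cast; ring
    have e2 : Sendov.u₂ 5 = -1 := by
      rw [u₂_eq, θ₂, hk, ← Real.cos_pi]; congr 1; push_cast; ring
    rw [sqCoef, eta, Sendov.D₂, e1, e2]; norm_num
  have J := h.mom_zero_one_three
  have q2 := Ord.mom h.grade 0 2
  have e2 := h.mom_zero_two_expand
  rw [hQ] at e2
  have t1 := (e2.mul q2).const_mul (3 / 80)
  have t2 := ((Ord.self_pow 2).mul e2).const_mul (3 / 80 * (4 / 3))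
  have t3 := (J.mul (Ord.mom h.grade 0 3)).const_mul (1 / 5)
  have t4 := (((J.pow 2).mul q2).mono h.tendsto (by norm_num : 6 ≤ _)).const_mul (6 / 100)
  have t5 := ((J.pow 4).mono h.tendsto (by norm_num : 6 ≤ _)).const_mul (3 / 500)
  have hW : Ord l s 6 fun i => 3 / 80 * mom (ζ i) 0 2 ^ 2 +
      1 / 4 * (4 / 5 * mom (ζ i) 0 1 * mom (ζ i) 0 3 - 6 / 25 * mom (ζ i) 0 1 ^ 2 * mom (ζ i) 0 2 +
      3 / 125 * mom (ζ i) 0 1 ^ 4) - 1 / 15 * s i ^ 4 :=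
    ((((t1.add t2).add t3).sub t4).add t5).congr fun i => by ring
  obtain ⟨C', hC'0, hC'⟩ := hW.exists_bound
  refine ⟨C + 7 / 15 * C', ?_⟩
  filter_upwards [hC, hC'] with i h1 h2
  have e6 : |s i| ^ 6 = s i ^ 6 := by rw [← abs_pow, abs_of_nonneg (by positivity)]
  rw [e6] at h2
  have h3 := (abs_le.mp h2).2
  have h4 := quarticDefect_five_lower (ζ i)
  rw [curv_five] at h1
  linarith

theorem Config.upper (h : Config l s r ζ c) : ∃ C, ∀ᶠ i in l,
    r i ≤ 1 + rate n * s i ^ 2 + (Sendov.D n + Sendov.Δ n) * s i ^ 4 + C * s i ^ 6 := by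
  have h3 := h.three_le
  rcases (by omega : n = 3 ∨ n = 5 ∨ (4 ≤ n ∧ n ≠ 5)) with rfl | rfl | ⟨h4, h5⟩
  · simpa [Sendov.Δ] using h.upper_three
  · simpa [Sendov.Δ] using h.upper_five
  · simpa [Sendov.Δ, h5] using h.upper_general h4 h5

end Conclusion

/-- A family of counterexamples with errors `N (1 - β) ^ 3` yields an extremal configuration. -/
theorem eventual_bound {n : ℕ} (hn : 3 ≤ n) : ∃ C ε : ℝ, 0 < ε ∧ ∀ β : ℝ, 1 - ε < β → β ≤ 1 →
    ∀ P ∈ Sendov.S (n + 1) (β : ℂ), Sendov.critDist P (β : ℂ) ≤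
      1 + (Sendov.D₁ n + Sendov.D₂ n / (n : ℝ)) * (1 - β) +
        (Sendov.D n + Sendov.Δ n) * (1 - β) ^ 2 + C * (1 - β) ^ 3 := by
  set c := Sendov.D n + Sendov.Δ n with hc
  obtain ⟨K, ε, hε, hK⟩ := critical_point_bounds n
    (c := |Sendov.D₁ n + Sendov.D₂ n / n| + |c|) (by positivity)
  by_contra hcon
  push Not at hcon
  -- The negation is used with constant `N` and a radius of at most `1/(N+1)`, so that `β N → 1`.
  choose β hβ1 hβ2 P hP hbig using fun N : ℕ => hcon N (min (min ε 1) (1 / ((N : ℝ) + 1)))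
    (by positivity)
  choose a z ζ ha hPz hd hz using fun N => exists_crit_root_data (hP N)
  have hδ : ∀ N, 1 - β N < min ε 1 ∧ 1 - β N < 1 / ((N : ℝ) + 1) := fun N => by
    have := hβ1 N
    constructor
    · linarith [min_le_left (min ε 1) (1 / ((N : ℝ) + 1))]
    · linarith [min_le_right (min ε 1) (1 / ((N : ℝ) + 1))]
  set s : ℕ → ℝ := fun N => √(1 - β N) with hs
  have hs2 : ∀ N, s N ^ 2 = 1 - β N := fun N => Real.sq_sqrt (by linarith [hβ2 N])
  have hs4 : ∀ N, s N ^ 4 = (1 - β N) ^ 2 := fun N => by rw [← hs2]; ring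
  have hs6 : ∀ N, s N ^ 6 = (1 - β N) ^ 3 := fun N => by rw [← hs2]; ring
  have hbase : ∀ N, basePt s N = (β N : ℂ) := fun N => by
    rw [basePt, hs2]; push_cast; ring
  have hδt : Tendsto (fun N => 1 - β N) atTop (𝓝 0) :=
    squeeze_zero (fun N => by linarith [hβ2 N]) (fun N => (hδ N).2.le)
      tendsto_one_div_add_atTop_nhds_zero_nat
  have hst : Tendsto s atTop (𝓝 0) := by
    have := (Real.continuous_sqrt.tendsto 0).comp hδt
    rwa [Real.sqrt_zero] at this
  set r : ℕ → ℝ := fun N => Sendov.critDist (P N) (β N : ℂ) with hr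
  have hcrit : ∀ N b, r N ≤ ‖(β N : ℂ) - ζ N b‖ := fun N b => by
    simp only [hr]
    rw [hPz N]
    exact critDist_le (hd N) b
  -- The nonnegative term `N (1 - β) ^ 3` is dropped here; it is used only for the final
  -- contradiction, once `N ≥ C`.
  have hlow : ∀ N, 1 + (Sendov.D₁ n + Sendov.D₂ n / n) * (1 - β N) + c * (1 - β N) ^ 2 ≤ r N :=
    fun N => by
      have h1 := hbig N
      have h2 : 0 ≤ (N : ℝ) * (1 - β N) ^ 3 :=
        mul_nonneg N.cast_nonneg (pow_nonneg (by linarith [hβ2 N]) 3)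
      simp only [hr]
      linarith
  have hbounds : ∀ N b, |(ζ N b).re| ≤ K * (1 - β N) ∧ (ζ N b).im ^ 2 ≤ K * (1 - β N) :=
    fun N b => by
    refine hK (β N) (by linarith [(hδ N).1, min_le_left ε 1]) (hβ2 N) (z N) (ζ N) (hz N)
      (fun b => le_trans ?_ (hcrit N b)) (hd N) b
    refine le_trans ?_ (hlow N)
    have d0 : 0 ≤ 1 - β N := by linarith [hβ2 N]
    have d1 : 1 - β N ≤ 1 := by linarith [(hδ N).1, min_le_right ε 1]
    have a1 := mul_le_mul_of_nonneg_right (neg_abs_le (Sendov.D₁ n + Sendov.D₂ n / n)) d0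
    have a2 := mul_le_mul_of_nonneg_right (neg_abs_le c) (sq_nonneg (1 - β N))
    have a3 : |c| * (1 - β N) ^ 2 ≤ |c| * (1 - β N) :=
      mul_le_mul_of_nonneg_left (by nlinarith) (abs_nonneg c)
    linarith
  have hcfg : Config atTop s r ζ c :=
    { three_le := hn
      tendsto := hst
      r_nonneg := fun N => Metric.infDist_nonneg
      crit := fun N b => by rw [hbase]; exact hcrit N b
      bdry := fun N w hw => by
        rw [hbase]
        refine boundary_inequality ?_ (hz N) (hd N) hw
        rw [Complex.norm_real, Real.norm_eq_abs, abs_le]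
        constructor <;> linarith [(hδ N).1, min_le_right ε 1, hβ2 N]
      grade := fun b => by
        constructor
        · refine Ord.of_bound K (Eventually.of_forall fun N => ?_)
          norm_num
          rw [hs2]
          exact (hbounds N b).1
        · refine Ord.of_bound (√K) (Eventually.of_forall fun N => ?_)
          have hK0 : 0 ≤ K * (1 - β N) := (sq_nonneg _).trans (hbounds N b).2
          norm_num
          rw [abs_of_nonneg (Real.sqrt_nonneg (1 - β N)), ← Real.sqrt_mul' K (by linarith [hβ2 N])]
          exact Real.abs_le_sqrt (hbounds N b).2
      low := fun N => by rw [hs2, hs4]; exact hlow N }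
  obtain ⟨C, hC⟩ := hcfg.upper
  obtain ⟨N, hN, hNC⟩ := (hC.and (eventually_ge_atTop ⌈C⌉₊)).exists
  have h1 := hbig N
  have h2 : C ≤ N := (Nat.le_ceil C).trans (by exact_mod_cast hNC)
  rw [hs2, hs4, hs6, rate] at hN
  have h3 := mul_le_mul_of_nonneg_right h2 (pow_nonneg (by linarith [hβ2 N] : 0 ≤ 1 - β N) 3)
  simp only [hr] at hN
  linarith

end CritBound

theorem proposition5 (n : ℕ) (hn : 3 ≤ n) :
    ∃ C ε : ℝ, 0 < ε ∧ ∀ β : ℝ, 1 - ε < β → β ≤ 1 →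
      ∀ P ∈ Sendov.S (n + 1) (β : ℂ),
        Sendov.critDist P (β : ℂ) ≤
          1 + (Sendov.D₁ n + Sendov.D₂ n / (n : ℝ)) * (1 - β)
            + (Sendov.D n + Sendov.Δ n) * (1 - β) ^ 2
            + C * (1 - β) ^ (Sendov.α n + 1) := by
  obtain ⟨C, ε, hε, h⟩ := CritBound.eventual_bound hn
  -- With `0 ≤ 1 - β ≤ 1` and `α + 1 ≤ 3`, the cube is at most the required power; the absolute
  -- value makes the coefficient nonnegative.
  refine ⟨|C|, min ε 1, by positivity, fun β hβ hβ1 P hP => ?_⟩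
  refine (h β (by linarith [min_le_left ε 1]) hβ1 P hP).trans ?_
  have d0 : 0 ≤ 1 - β := by linarith
  have d1 : 1 - β ≤ 1 := by linarith [min_le_right ε 1]
  have hα : 0 < Sendov.α n + 1 ∧ Sendov.α n + 1 ≤ 3 := by
    unfold Sendov.α; split_ifs <;> norm_num
  have hpow : (1 - β) ^ 3 ≤ (1 - β) ^ (Sendov.α n + 1) := by
    have := Real.rpow_le_rpow_of_exponent_ge' d0 d1 hα.1.le hα.2
    calc (1 - β) ^ 3 = (1 - β) ^ (3 : ℝ) := by rw [← Real.rpow_natCast]; norm_num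
      _ ≤ _ := this
  have h1 : C * (1 - β) ^ 3 ≤ |C| * (1 - β) ^ 3 :=
    mul_le_mul_of_nonneg_right (le_abs_self C) (pow_nonneg d0 3)
  have h2 := mul_le_mul_of_nonneg_left hpow (abs_nonneg C)
  linarith
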